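/- **Games.** A *game* is a set of moves $M_A$, each with a polarity (Opponent $O=-1$ or Proponent $P=+1$), and a partial order $\le_A$ in which every move has finitely many predecessors. It is *filiform* when $\le_A$ is total; filiform games are taken to be finite. $A^*$ is $A$ with polarities exchanged, $A\otimes B$ is the disjoint union, and $A\multimap B=A^*\otimes B$. The game $A\mathbin{\triangleleft}B$ ("$A$ before $B$") has moves $M_A\uplus M_B$, with the orders of $A$ and $B$ and every move of $A$ below every move of $B$; $I$ is the empty game, and $O$, $P$ also denote the games with a single move of that polarity. A *strategy* on a game $A$ is a partial order $\le_\sigma$ on $M_A$ such that $\le_\sigma\cup\le_A$ is acyclic and such that $m<_\sigma n$ implies that $m$ is an Opponent move and $n$ a Proponent move. $\mathbf{Games}$ is the category whose objects are the finite filiform games and whose morphisms $A\to B$ are the strategies on $A\multimap B$. The composite of $\sigma:A\to B$ and $\tau:B\to C$ is the restriction to the moves of $A$ and $C$ of the transitive closure of $\le_\sigma\cup\le_\tau$ (this is again a strategy). The identity of $A$ relates the two copies $m_L,m_R$ of each move $m$: $m_L\le m_R$ if $m$ is a Proponent move of $A$, and $m_R\le m_L$ if $m$ is an Opponent move of $A$.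 It is a monoidal category with tensor $\triangleleft$ (on strategies $\sigma:A\to B$ and $\tau:C\to D$, $\le_{\sigma\triangleleft\tau}$ is $\le_\sigma\cup\le_\tau$), with unit $I$ and the evident structural isomorphisms. **The theory $\mathfrak G$.** It is the monoidal equational theory (theory of strict monoidal categories with given generators and equations) with two atomic types $O$, $P$ and thirteen generators $$\mu^O:O\otimes O\to O,\quad \eta^O:I\to O,\quad \delta^O:O\to O\otimes O,\quad \varepsilon^O:O\to I,\quad \gamma^O:O\otimes O\to O\otimes O,$$ $$\mu^P:P\otimes P\to P,\quad \eta^P:I\to P,\quad \delta^P:P\to P\otimes P,\quad \varepsilon^P:P\to I,\quad \gamma^P:P\otimes P\to P\otimes P,$$ $$\eta^{OP}:I\to O\otimes P,\quad \varepsilon^{OP}:P\otimes O\to I,\quad \gamma^{OP}:P\otimes O\to O\otimes P,$$ subject to the following equations. 1. $(O,\mu^O,\eta^O,\delta^O,\varepsilon^O,\gamma^O)$ is a bicommutative qualitative bialgebra: $\gamma^O$ satisfies the Yang–Baxter equation and $\gamma^O\gamma^O=\mathrm{id}$; $(\mu^O,\eta^O)$ is a monoid and $(\delta^O,\varepsilon^O)$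 a comonoid; $\mu^O,\eta^O,\delta^O,\varepsilon^O$ can be slid through $\gamma^O$ on either side; $\mu^O\gamma^O=\mu^O$ and $\gamma^O\delta^O=\delta^O$; $\delta^O\mu^O=(\mu^O\otimes\mu^O)(O\otimes\gamma^O\otimes O)(\delta^O\otimes\delta^O)$, $\varepsilon^O\eta^O=\mathrm{id}_I$, $\varepsilon^O\mu^O=\varepsilon^O\otimes\varepsilon^O$, $\delta^O\eta^O=\eta^O\otimes\eta^O$; and $\mu^O\delta^O=\mathrm{id}_O$. 2. $P$ is left dual to $O$ with unit $\eta^{OP}$ and counit $\varepsilon^{OP}$: $(\varepsilon^{OP}\otimes P)(P\otimes\eta^{OP})=\mathrm{id}_P$ and $(O\otimes\varepsilon^{OP})(\eta^{OP}\otimes O)=\mathrm{id}_O$. 3. The Proponent structure is the dual of the Opponent structure: writing $\eta_2=(O\otimes\eta^{OP}\otimes P)\,\eta^{OP}$ and $\varepsilon_2=\varepsilon^{OP}\,(P\otimes\varepsilon^{OP}\otimes O)$, - $\mu^P=(\varepsilon_2\otimes P)(P\otimes P\otimes\delta^O\otimes P)(P\otimes P\otimes\eta^{OP})$, - $\delta^P=(\varepsilon^{OP}\otimes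 P\otimes P)(P\otimes\mu^O\otimes P\otimes P)(P\otimes\eta_2)$, - $\eta^P=(\varepsilon^O\otimes P)\,\eta^{OP}$ and $\varepsilon^P=\varepsilon^{OP}(P\otimes\eta^O)$, - $\gamma^P=(\varepsilon_2\otimes P\otimes P)(P\otimes P\otimes\gamma^O\otimes P\otimes P)(P\otimes P\otimes\eta_2)$, - $\gamma^{OP}=(\varepsilon^{OP}\otimes O\otimes P)(P\otimes\gamma^O\otimes P)(P\otimes O\otimes\eta^{OP})$. The strict monoidal category $\mathcal G$ generated by $\mathfrak G$ has the words in $O,P$ as objects, and as morphisms the formal composites and tensor products of generators and identities, modulo the smallest congruence containing the axioms of strict monoidal categories and the equations above. **Theorem.** The theory $\mathfrak G$ is a presentation of $\mathbf{Games}$: the monoidal categories $\mathcal G$ and $\mathbf{Games}$ are monoidally equivalent (there are strong monoidal functors in both directions and invertible monoidal natural transformations between their composites and the identities). Moreover the equivalence $\mathcal G\to\mathbf{Games}$ can be chosen so that, up to the canonical isomorphisms, it sends the types $O$ and $P$ to the games $O$ and $P$ and every generator $g:A\to B$ to the following strategy on $A\multimap B$: for $\gamma^O,\gamma^P,\gamma^{OP}$,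 the strategy relating the first move of each side with the second move of the other side (from the Opponent move to the Proponent move); for any other generator, the strategy in which every Opponent move of $A\multimap B$ is below every Proponent move. -/

import Mathlib

open CategoryTheory MonoidalCategory

namespace FOC

/-! ### Games -/

/-- The two polarities: `O` is the Opponent polarity (`-1`), `P` is the Proponent polarity (`+1`). -/
inductive Polarity : Type
  | O
  | P

/-- The opposite polarity. -/
def Polarity.neg : Polarity → Polarity
  | O => P
  | P => O

/-- A game: a set of moves with a polarity and a partial order, such that every move has a finite
set of predecessors. -/
structure Game where
  Moves : Type
  pol : Moves → Polarity
  le : Moves → Moves → Prop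
  le_refl : ∀ m, le m m
  le_trans : ∀ m n p, le m n → le n p → le m p
  le_antisymm : ∀ m n, le m n → le n m → m = n
  finite_down : ∀ m, {n | le n m}.Finite

/-- The tensor product of two games: disjoint union. -/
abbrev Game.tensor (A B : Game) : Game where
  Moves := A.Moves ⊕ B.Moves
  pol := Sum.elim A.pol B.pol
  le := Sum.LiftRel A.le B.le
  le_refl := by
    rintro (m | m)
    · exact .inl (A.le_refl m)
    · exact .inr (B.le_refl m)
  le_trans := by
    rintro _ _ _ (⟨h⟩ | ⟨h⟩) (⟨h'⟩ | ⟨h'⟩)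
    · exact .inl (A.le_trans _ _ _ h h')
    · exact .inr (B.le_trans _ _ _ h h')
  le_antisymm := by
    rintro _ _ (⟨h⟩ | ⟨h⟩) (⟨h'⟩ | ⟨h'⟩)
    · exact congrArg _ (A.le_antisymm _ _ h h')
    · exact congrArg _ (B.le_antisymm _ _ h h')
  finite_down := by
    rintro (m | m)
    · refine ((A.finite_down m).image Sum.inl).subset ?_
      rintro _ (⟨h⟩ | ⟨h⟩)
      exact ⟨_, h, rfl⟩
    · refine ((B.finite_down m).image Sum.inr).subset ?_
      rintro _ (⟨h⟩ | ⟨h⟩)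
      exact ⟨_, h, rfl⟩

/-- The opposite game: polarities are exchanged. -/
abbrev Game.opp (A : Game) : Game := { A with pol := fun m => (A.pol m).neg }

/-- The arrow game `A ⊸ B`, that is `A* ⊗ B`. -/
abbrev Game.arrow (A B : Game) : Game := A.opp.tensor B

/-- A (finite) filiform game: its set of moves is finite and its order is total. -/
structure FiliformGame extends Game where
  finite : Finite Moves
  le_total : ∀ m n, le m n ∨ le n m

namespace FiliformGame

/-- The game "`A` before `B`": the disjoint union of the moves, every move of `A` being below every
move of `B`. -/
abbrev before (A B : FiliformGame) : FiliformGame where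
  Moves := A.Moves ⊕ B.Moves
  pol := Sum.elim A.pol B.pol
  le := Sum.Lex A.le B.le
  le_refl := by
    rintro (m | m)
    · exact .inl (A.le_refl m)
    · exact .inr (B.le_refl m)
  le_trans := by
    rintro _ _ _ (h | h | _) (h' | h' | _)
    · exact .inl (A.le_trans _ _ _ h h')
    · exact .sep _ _
    · exact .inr (B.le_trans _ _ _ h h')
    · exact .sep _ _
  le_antisymm := by
    rintro _ _ (h | h | _) (h' | h' | _)
    · exact congrArg _ (A.le_antisymm _ _ h h')
    · exact congrArg _ (B.le_antisymm _ _ h h')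
  finite_down := fun _ =>
    have := A.finite
    have := B.finite
    Set.toFinite _
  finite :=
    have := A.finite
    have := B.finite
    inferInstance
  le_total := by
    rintro (m | m) (n | n)
    · exact (A.le_total m n).imp .inl .inl
    · exact .inl (.sep _ _)
    · exact .inr (.sep _ _)
    · exact (B.le_total m n).imp .inr .inr

/-- The empty game `I`. -/
abbrev empty : FiliformGame where
  Moves := Empty
  pol := Empty.elim
  le := fun _ _ => True
  le_refl := fun _ => trivial
  le_trans := fun _ _ _ _ _ => trivial
  le_antisymm := fun m => m.elim
  finite_down := fun m => m.elim
  finite := inferInstance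
  le_total := fun m => m.elim

/-- The game with exactly one move, of polarity `X`. -/
abbrev single (X : Polarity) : FiliformGame where
  Moves := Unit
  pol := fun _ => X
  le := fun _ _ => True
  le_refl := fun _ => trivial
  le_trans := fun _ _ _ _ _ => trivial
  le_antisymm := fun _ _ _ _ => rfl
  finite_down := fun _ => Set.toFinite _
  finite := inferInstance
  le_total := fun _ _ => .inl trivial

end FiliformGame

/-! ### Strategies -/

/-- Two partial orders on the same set are compatible when their union is acyclic, i.e. when the
transitive closure of the union is antisymmetric. -/
def Compatible {M : Type} (r s : M → M → Prop) : Prop :=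
  ∀ x y, Relation.TransGen (fun a b => r a b ∨ s a b) x y →
    Relation.TransGen (fun a b => r a b ∨ s a b) y x → x = y

/-- A strategy on a game: a partial order on the moves which is compatible with the order of the
game and in which every strict relation goes from an Opponent move to a Proponent move. -/
@[ext]
structure Strategy (A : Game) where
  le : A.Moves → A.Moves → Prop
  le_refl : ∀ m, le m m
  le_trans : ∀ m n p, le m n → le n p → le m p
  le_antisymm : ∀ m n, le m n → le n m → m = n
  compatible : Compatible A.le le
  polarized : ∀ m n, le m n → m ≠ n → A.pol m = .O ∧ A.pol n = .P

theorem compatible_of_le {M : Type} {r s : M → M → Prop} (K : M → M → Prop)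
    (trans : ∀ x y z, K x y → K y z → K x z) (antisymm : ∀ x y, K x y → K y x → x = y)
    (hr : ∀ x y, r x y → K x y) (hs : ∀ x y, s x y → K x y) : Compatible r s := by
  have key : ∀ x y, Relation.TransGen (fun a b => r a b ∨ s a b) x y → K x y := by
    intro x y h
    induction h with
    | single h => exact h.elim (hr _ _) (hs _ _)
    | tail _ h ih => exact trans _ _ _ ih (h.elim (hr _ _) (hs _ _))
  exact fun x y h h' => antisymm _ _ (key _ _ h) (key _ _ h')

/-- The union of the order of a game and of a relation, closed under transitivity. -/
abbrev Closure (A : Game) (s : A.Moves → A.Moves → Prop) : A.Moves → A.Moves → Prop :=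
  Relation.TransGen (fun a b => A.le a b ∨ s a b)

theorem polarized_trans {A : Game} {le : A.Moves → A.Moves → Prop}
    (polarized : ∀ m n, le m n → m ≠ n → A.pol m = .O ∧ A.pol n = .P) :
    ∀ m n p, le m n → le n p → le m p := by
  intro m n p h h'
  by_cases e : m = n
  · rwa [e]
  by_cases e' : n = p
  · rwa [← e']
  have h1 := (polarized _ _ h e).2
  rw [(polarized _ _ h' e').1] at h1
  cases h1

theorem polarized_antisymm {A : Game} {le : A.Moves → A.Moves → Prop}
    (polarized : ∀ m n, le m n → m ≠ n → A.pol m = .O ∧ A.pol n = .P) :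
    ∀ m n, le m n → le n m → m = n := by
  intro m n h h'
  by_contra e
  have h1 := (polarized _ _ h e).2
  rw [(polarized _ _ h' (Ne.symm e)).1] at h1
  cases h1

/-! ### Composition of strategies -/

section Comp

variable {A B C D : FiliformGame}

/-- The union of (the partial orders of) two strategies `σ : A ⊸ B` and `τ : B ⊸ C`, as a relation
on the moves of `A`, `B` and `C`. -/
inductive CompStep (σ : Strategy (A.arrow B.toGame)) (τ : Strategy (B.arrow C.toGame)) :
    A.Moves ⊕ (B.Moves ⊕ C.Moves) → A.Moves ⊕ (B.Moves ⊕ C.Moves) → Prop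
  | left (x y : A.Moves ⊕ B.Moves) (h : σ.le x y) :
      CompStep σ τ (Sum.map id Sum.inl x) (Sum.map id Sum.inl y)
  | right (x y : B.Moves ⊕ C.Moves) (h : τ.le x y) : CompStep σ τ (Sum.inr x) (Sum.inr y)

/-- The restriction to the moves of `A ⊸ C` of the transitive closure of the union of two
strategies `σ : A ⊸ B` and `τ : B ⊸ C`. -/
def CompLe (σ : Strategy (A.arrow B.toGame)) (τ : Strategy (B.arrow C.toGame))
    (x y : A.Moves ⊕ C.Moves) : Prop :=
  Relation.TransGen (CompStep σ τ) (Sum.map id Sum.inr x) (Sum.map id Sum.inr y)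

theorem closure_middle_right (σ : Strategy (A.arrow B.toGame)) {b b' : B.Moves}
    (h : Closure (A.arrow B.toGame) σ.le (.inr b) (.inr b')) : B.le b b' := by
  rcases B.le_total b b' with h' | h'
  · exact h'
  · have e := σ.compatible _ _ h (.single (.inl (.inr h')))
    cases e
    exact B.le_refl _

theorem closure_middle_left (σ : Strategy (A.arrow B.toGame)) {b b' : A.Moves}
    (h : Closure (A.arrow B.toGame) σ.le (.inl b) (.inl b')) : A.le b b' := by
  rcases A.le_total b b' with h' | h'
  · exact h'
  · have e := σ.compatible _ _ h (.single (.inl (.inl h')))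
    cases e
    exact A.le_refl _

/-- The amalgamation over `B` of the orders generated on `A`, `B` and on `B`, `C`. -/
def Amalgam (σ : Strategy (A.arrow B.toGame)) (τ : Strategy (B.arrow C.toGame)) :
    A.Moves ⊕ (B.Moves ⊕ C.Moves) → A.Moves ⊕ (B.Moves ⊕ C.Moves) → Prop
  | .inl a, .inl a' => A.le a a'
  | .inl a, .inr (.inl b) => Closure (A.arrow B.toGame) σ.le (.inl a) (.inr b)
  | .inl a, .inr (.inr c) => ∃ b, Closure (A.arrow B.toGame) σ.le (.inl a) (.inr b) ∧
      Closure (B.arrow C.toGame) τ.le (.inl b) (.inr c)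
  | .inr (.inl b), .inl a => Closure (A.arrow B.toGame) σ.le (.inr b) (.inl a)
  | .inr (.inl b), .inr (.inl b') => B.le b b'
  | .inr (.inl b), .inr (.inr c) => Closure (B.arrow C.toGame) τ.le (.inl b) (.inr c)
  | .inr (.inr c), .inl a => ∃ b, Closure (B.arrow C.toGame) τ.le (.inr c) (.inl b) ∧
      Closure (A.arrow B.toGame) σ.le (.inr b) (.inl a)
  | .inr (.inr c), .inr (.inl b) => Closure (B.arrow C.toGame) τ.le (.inr c) (.inl b)
  | .inr (.inr c), .inr (.inr c') => C.le c c'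

theorem amalgam_aux {M N L : Type} (r : M → M → Prop) (s : N → N → Prop) (q : L → L → Prop)
    (P : M → N → Prop) (P' : N → M → Prop) (Q : N → L → Prop) (Q' : L → N → Prop)
    (hr : ∀ x y z, r x y → r y z → r x z) (hs : ∀ x y z, s x y → s y z → s x z)
    (hq : ∀ x y z, q x y → q y z → q x z)
    (h1 : ∀ x y z, r x y → P y z → P x z) (h2 : ∀ x y z, P x y → s y z → P x z)
    (h3 : ∀ x y z, P x y → P' y z → r x z) (h4 : ∀ x y z, P' x y → P y z → s x z)
    (h5 : ∀ x y z, s x y → P' y z → P' x z) (h6 : ∀ x y z, P' x y → r y z → P' x z)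
    (k1 : ∀ x y z, s x y → Q y z → Q x z) (k2 : ∀ x y z, Q x y → q y z → Q x z)
    (k3 : ∀ x y z, Q x y → Q' y z → s x z) (k4 : ∀ x y z, Q' x y → Q y z → q x z)
    (k5 : ∀ x y z, q x y → Q' y z → Q' x z) (k6 : ∀ x y z, Q' x y → s y z → Q' x z)
    (K : M ⊕ (N ⊕ L) → M ⊕ (N ⊕ L) → Prop)
    (e1 : ∀ x y, K (.inl x) (.inl y) ↔ r x y) (e2 : ∀ x y, K (.inl x) (.inr (.inl y)) ↔ P x y)
    (e3 : ∀ x y, K (.inl x) (.inr (.inr y)) ↔ ∃ b, P x b ∧ Q b y)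
    (e4 : ∀ x y, K (.inr (.inl x)) (.inl y) ↔ P' x y)
    (e5 : ∀ x y, K (.inr (.inl x)) (.inr (.inl y)) ↔ s x y)
    (e6 : ∀ x y, K (.inr (.inl x)) (.inr (.inr y)) ↔ Q x y)
    (e7 : ∀ x y, K (.inr (.inr x)) (.inl y) ↔ ∃ b, Q' x b ∧ P' b y)
    (e8 : ∀ x y, K (.inr (.inr x)) (.inr (.inl y)) ↔ Q' x y)
    (e9 : ∀ x y, K (.inr (.inr x)) (.inr (.inr y)) ↔ q x y) :
    ∀ x y z, K x y → K y z → K x z := by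
  rintro (x | x | x) (y | y | y) (z | z | z) <;> simp only [e1, e2, e3, e4, e5, e6, e7, e8, e9] <;>
    grind

theorem amalgam_trans (σ : Strategy (A.arrow B.toGame)) (τ : Strategy (B.arrow C.toGame)) :
    ∀ x y z, Amalgam σ τ x y → Amalgam σ τ y z → Amalgam σ τ x z := by
  have ba : ∀ b b', B.le b b' → Closure (A.arrow B.toGame) σ.le (.inr b) (.inr b') :=
    fun b b' h => .single (.inl (.inr h))
  have aa : ∀ b b', A.le b b' → Closure (A.arrow B.toGame) σ.le (.inl b) (.inl b') :=
    fun b b' h => .single (.inl (.inl h))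
  have bc : ∀ b b', B.le b b' → Closure (B.arrow C.toGame) τ.le (.inl b) (.inl b') :=
    fun b b' h => .single (.inl (.inl h))
  have cc : ∀ b b', C.le b b' → Closure (B.arrow C.toGame) τ.le (.inr b) (.inr b') :=
    fun b b' h => .single (.inl (.inr h))
  apply amalgam_aux A.le B.le C.le (fun a b => Closure (A.arrow B.toGame) σ.le (.inl a) (.inr b))
    (fun b a => Closure (A.arrow B.toGame) σ.le (.inr b) (.inl a))
    (fun b c => Closure (B.arrow C.toGame) τ.le (.inl b) (.inr c))
    (fun c b => Closure (B.arrow C.toGame) τ.le (.inr c) (.inl b))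
  · exact A.le_trans
  · exact B.le_trans
  · exact C.le_trans
  · exact fun x y z h h' => (aa _ _ h).trans h'
  · exact fun x y z h h' => h.trans (ba _ _ h')
  · exact fun x y z h h' => closure_middle_left σ (h.trans h')
  · exact fun x y z h h' => closure_middle_right σ (h.trans h')
  · exact fun x y z h h' => (ba _ _ h).trans h'
  · exact fun x y z h h' => h.trans (aa _ _ h')
  · exact fun x y z h h' => (bc _ _ h).trans h'
  · exact fun x y z h h' => h.trans (cc _ _ h')
  · exact fun x y z h h' => closure_middle_left τ (h.trans h')
  · exact fun x y z h h' => closure_middle_right τ (h.trans h')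
  · exact fun x y z h h' => (cc _ _ h).trans h'
  · exact fun x y z h h' => h.trans (bc _ _ h')
  all_goals exact fun _ _ => Iff.rfl

theorem amalgam_antisymm (σ : Strategy (A.arrow B.toGame)) (τ : Strategy (B.arrow C.toGame)) :
    ∀ x y, Amalgam σ τ x y → Amalgam σ τ y x → x = y := by
  rintro (x | x | x) (y | y | y) h h'
  · rw [A.le_antisymm _ _ h h']
  · cases σ.compatible _ _ h h'
  · obtain ⟨b, h1, h2⟩ := h
    obtain ⟨b', h3, h4⟩ := h'
    have e := B.le_antisymm _ _ (closure_middle_left τ (h2.trans h3))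
      (closure_middle_right σ (h4.trans h1))
    subst e
    cases σ.compatible _ _ h1 h4
  · cases σ.compatible _ _ h h'
  · rw [B.le_antisymm _ _ h h']
  · cases τ.compatible _ _ h h'
  · obtain ⟨b, h1, h2⟩ := h
    obtain ⟨b', h3, h4⟩ := h'
    have e := B.le_antisymm _ _ (closure_middle_right σ (h2.trans h3))
      (closure_middle_left τ (h4.trans h1))
    subst e
    cases τ.compatible _ _ h1 h4
  · cases τ.compatible _ _ h h'
  · rw [C.le_antisymm _ _ h h']

theorem amalgam_of_compStep (σ : Strategy (A.arrow B.toGame)) (τ : Strategy (B.arrow C.toGame))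
    (x y) (h : CompStep σ τ x y) : Amalgam σ τ x y := by
  cases h with
  | left x y h =>
    have h' : Closure (A.arrow B.toGame) σ.le x y := .single (.inr h)
    rcases x with x | x <;> rcases y with y | y
    · exact closure_middle_left σ h'
    · exact h'
    · exact h'
    · exact closure_middle_right σ h'
  | right x y h =>
    have h' : Closure (B.arrow C.toGame) τ.le x y := .single (.inr h)
    rcases x with x | x <;> rcases y with y | y
    · exact closure_middle_left τ h'
    · exact h'
    · exact h'
    · exact closure_middle_right τ h'

theorem amalgam_of_compLe (σ : Strategy (A.arrow B.toGame)) (τ : Strategy (B.arrow C.toGame))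
    (x y) (h : CompLe σ τ x y) : Amalgam σ τ (Sum.map id Sum.inr x) (Sum.map id Sum.inr y) := by
  unfold CompLe at h
  generalize (Sum.map id Sum.inr y : A.Moves ⊕ (B.Moves ⊕ C.Moves)) = v at h
  induction h with
  | single h => exact amalgam_of_compStep _ _ _ _ h
  | tail _ h ih => exact amalgam_trans _ _ _ _ _ ih (amalgam_of_compStep _ _ _ _ h)

theorem transGen_ne_head {X : Type} {r : X → X → Prop} {x y : X} (h : Relation.TransGen r x y)
    (e : x ≠ y) : ∃ z, r x z ∧ x ≠ z := by
  induction h with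
  | single h => exact ⟨_, h, e⟩
  | @tail b c _ h ih =>
    by_cases e' : x = b
    · subst e'
      exact ⟨_, h, e⟩
    · exact ih e'

theorem transGen_ne_tail {X : Type} {r : X → X → Prop} {x y : X} (h : Relation.TransGen r x y)
    (e : x ≠ y) : ∃ z, r z y ∧ z ≠ y := by
  induction h with
  | single h => exact ⟨_, h, e⟩
  | @tail b c _ h ih =>
    by_cases e' : b = c
    · subst e'
      exact ih e
    · exact ⟨_, h, e'⟩

theorem sum_map_inr_injective :
    Function.Injective (Sum.map id Sum.inr : A.Moves ⊕ C.Moves → A.Moves ⊕ (B.Moves ⊕ C.Moves)) :=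
  Sum.map_injective.2 ⟨Function.injective_id, Sum.inr_injective⟩

theorem compLe_polarized (σ : Strategy (A.arrow B.toGame)) (τ : Strategy (B.arrow C.toGame))
    (x y) (h : CompLe σ τ x y) (e : x ≠ y) :
    (A.arrow C.toGame).pol x = .O ∧ (A.arrow C.toGame).pol y = .P := by
  have e' := (sum_map_inr_injective (B := B)).ne e
  constructor
  · obtain ⟨z, hz, ne⟩ := transGen_ne_head h e'
    generalize hu : (Sum.map id Sum.inr x : A.Moves ⊕ (B.Moves ⊕ C.Moves)) = u at hz ne
    cases hz with
    | left x' y' h =>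
      have p := (σ.polarized x' y' h (fun e => ne (by rw [e]))).1
      rcases x with x | x <;> rcases x' with x' | x' <;> cases hu
      exact p
    | right x' y' h =>
      have p := (τ.polarized x' y' h (fun e => ne (by rw [e]))).1
      rcases x with x | x <;> rcases x' with x' | x' <;> cases hu
      exact p
  · obtain ⟨z, hz, ne⟩ := transGen_ne_tail h e'
    generalize hu : (Sum.map id Sum.inr y : A.Moves ⊕ (B.Moves ⊕ C.Moves)) = u at hz ne
    cases hz with
    | left x' y' h =>
      have p := (σ.polarized x' y' h (fun e => ne (by rw [e]))).2
      rcases y with x | x <;> rcases y' with x' | x' <;> cases hu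
      exact p
    | right x' y' h =>
      have p := (τ.polarized x' y' h (fun e => ne (by rw [e]))).2
      rcases y with x | x <;> rcases y' with x' | x' <;> cases hu
      exact p

theorem compLe_refl (σ : Strategy (A.arrow B.toGame)) (τ : Strategy (B.arrow C.toGame))
    (x) : CompLe σ τ x x := by
  rcases x with x | x
  · exact .single (.left (.inl x) (.inl x) (σ.le_refl _))
  · exact .single (.right (.inr x) (.inr x) (τ.le_refl _))

theorem compLe_compatible (σ : Strategy (A.arrow B.toGame)) (τ : Strategy (B.arrow C.toGame)) :
    Compatible (A.arrow C.toGame).le (CompLe σ τ) := by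
  apply compatible_of_le
    (fun x y => Amalgam σ τ (Sum.map id Sum.inr x) (Sum.map id Sum.inr y))
  · exact fun _ _ _ h h' => amalgam_trans _ _ _ _ _ h h'
  · exact fun _ _ h h' => sum_map_inr_injective (amalgam_antisymm _ _ _ _ h h')
  · rintro _ _ (⟨h⟩ | ⟨h⟩)
    · exact h
    · exact h
  · exact amalgam_of_compLe _ _

/-- The composite `τ ∘ σ : A ⊸ C` of two strategies `σ : A ⊸ B` and `τ : B ⊸ C`. -/
def Strategy.comp (σ : Strategy (A.arrow B.toGame)) (τ : Strategy (B.arrow C.toGame)) :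
    Strategy (A.arrow C.toGame) where
  le := CompLe σ τ
  le_refl := compLe_refl σ τ
  le_trans := fun _ _ _ h h' => Relation.TransGen.trans h h'
  le_antisymm := fun _ _ h h' => sum_map_inr_injective
    (amalgam_antisymm _ _ _ _ (amalgam_of_compLe _ _ _ _ h) (amalgam_of_compLe _ _ _ _ h'))
  compatible := compLe_compatible σ τ
  polarized := compLe_polarized σ τ

end Comp

/-! ### Isomorphisms of games and identities -/

/-- An isomorphism of games: a bijection on moves preserving polarities and orders. -/
structure GameIso (A B : FiliformGame) where
  equiv : A.Moves ≃ B.Moves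
  pol_eq : ∀ m, B.pol (equiv m) = A.pol m
  le_iff : ∀ m n, B.le (equiv m) (equiv n) ↔ A.le m n

/-- The identity isomorphism of games. -/
def GameIso.refl (A : FiliformGame) : GameIso A A := ⟨Equiv.refl _, fun _ => rfl, fun _ _ => Iff.rfl⟩

/-- The inverse isomorphism of games. -/
def GameIso.symm {A B : FiliformGame} (e : GameIso A B) : GameIso B A where
  equiv := e.equiv.symm
  pol_eq := fun m => by rw [← e.pol_eq, Equiv.apply_symm_apply]
  le_iff := fun m n => by rw [← e.le_iff, Equiv.apply_symm_apply, Equiv.apply_symm_apply]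

/-- The composite of two isomorphisms of games. -/
def GameIso.trans {A B C : FiliformGame} (e : GameIso A B) (f : GameIso B C) : GameIso A C where
  equiv := e.equiv.trans f.equiv
  pol_eq := fun m => by rw [Equiv.trans_apply, f.pol_eq, e.pol_eq]
  le_iff := fun m n => by rw [Equiv.trans_apply, Equiv.trans_apply, f.le_iff, e.le_iff]

/-- The copycat relation on `A ⊸ B` along an isomorphism of games `e`: the two copies `m` (on the
left) and `e m` (on the right) of every move are related, from the left to the right when `m` is a
Proponent move of `A` (so that its left copy is an Opponent move of `A ⊸ B`), and from the right to
the left when `m` is an Opponent move of `A`. -/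
inductive CopycatLe {A B : FiliformGame} (e : GameIso A B) :
    A.Moves ⊕ B.Moves → A.Moves ⊕ B.Moves → Prop
  | refl (x) : CopycatLe e x x
  | leftRight (m) (h : A.pol m = .P) : CopycatLe e (.inl m) (.inr (e.equiv m))
  | rightLeft (m) (h : A.pol m = .O) : CopycatLe e (.inr (e.equiv m)) (.inl m)

theorem copycatLe_polarized {A B : FiliformGame} (e : GameIso A B) (x y) (h : CopycatLe e x y)
    (ne : x ≠ y) : (A.arrow B.toGame).pol x = .O ∧ (A.arrow B.toGame).pol y = .P := by
  cases h with
  | refl => exact absurd rfl ne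
  | leftRight m h => exact ⟨congrArg Polarity.neg h, (e.pol_eq m).trans h⟩
  | rightLeft m h => exact ⟨(e.pol_eq m).trans h, congrArg Polarity.neg h⟩

/-- The map identifying the two copies of every move. -/
def GameIso.fold {A B : FiliformGame} (e : GameIso A B) : A.Moves ⊕ B.Moves → B.Moves :=
  Sum.elim e.equiv id

theorem copycatLe_fold {A B : FiliformGame} (e : GameIso A B) (x y) (h : CopycatLe e x y) :
    e.fold x = e.fold y := by
  cases h <;> rfl

/-- The copycat strategy along an isomorphism of games. The identity strategy is the case of the
identity isomorphism. -/
def Strategy.copycat {A B : FiliformGame} (e : GameIso A B) : Strategy (A.arrow B.toGame) where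
  le := CopycatLe e
  le_refl := .refl
  le_trans := polarized_trans (copycatLe_polarized e)
  le_antisymm := polarized_antisymm (copycatLe_polarized e)
  compatible := by
    apply compatible_of_le
      (fun x y => B.le (e.fold x) (e.fold y) ∧ (e.fold x = e.fold y → CopycatLe e x y))
    · rintro x y z ⟨h, k⟩ ⟨h', k'⟩
      refine ⟨B.le_trans _ _ _ h h', fun eq => ?_⟩
      have eq' : e.fold x = e.fold y := B.le_antisymm _ _ h (eq ▸ h')
      exact polarized_trans (A := A.arrow B.toGame) (copycatLe_polarized e) _ _ _ (k eq') (k' (eq'.symm.trans eq))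
    · rintro x y ⟨h, k⟩ ⟨h', k'⟩
      have eq' : e.fold x = e.fold y := B.le_antisymm _ _ h h'
      exact polarized_antisymm (A := A.arrow B.toGame) (copycatLe_polarized e) _ _ (k eq') (k' eq'.symm)
    · rintro (x | x) (y | y) h <;> cases h with | _ h
      · refine ⟨(e.le_iff _ _).2 h, fun eq => ?_⟩
        rw [e.equiv.injective eq]
        exact .refl _
      · refine ⟨h, fun eq => ?_⟩
        change x = y at eq
        rw [eq]
        exact .refl _
    · intro x y h
      refine ⟨?_, fun _ => h⟩
      rw [copycatLe_fold e x y h]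
      exact B.le_refl _
  polarized := copycatLe_polarized e

section CopycatComp

variable {A B C D : FiliformGame}

theorem copycat_comp_le (e : GameIso A B) (τ : Strategy (B.arrow C.toGame)) (x y : A.Moves ⊕ C.Moves) :
    ((Strategy.copycat e).comp τ).le x y ↔
      τ.le (Sum.map e.equiv id x) (Sum.map e.equiv id y) := by
  let φ : A.Moves ⊕ (B.Moves ⊕ C.Moves) → B.Moves ⊕ C.Moves := Sum.elim (Sum.inl ∘ e.equiv) id
  have hφ : ∀ x : A.Moves ⊕ C.Moves, φ (Sum.map id Sum.inr x) = Sum.map e.equiv id x := by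
    rintro (x | x) <;> rfl
  constructor
  · intro h
    have key : ∀ u v, Relation.TransGen (CompStep (Strategy.copycat e) τ) u v →
        τ.le (φ u) (φ v) := by
      intro u v h
      have step : ∀ u v, CompStep (Strategy.copycat e) τ u v → τ.le (φ u) (φ v) := by
        intro u v h
        cases h with
        | left x y h =>
          have : φ (Sum.map id Sum.inl x) = φ (Sum.map id Sum.inl y) := by
            cases h <;> rfl
          rw [this]
          exact τ.le_refl _
        | right x y h => exact h
      induction h with
      | single h => exact step _ _ h
      | tail _ h ih => exact τ.le_trans _ _ _ ih (step _ _ h)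
    have := key _ _ h
    rwa [hφ, hφ] at this
  · intro h
    by_cases eq : x = y
    · rw [eq]
      exact Strategy.le_refl _ _
    have inj : Function.Injective (Sum.map e.equiv id : A.Moves ⊕ C.Moves → B.Moves ⊕ C.Moves) :=
      Sum.map_injective.2 ⟨e.equiv.injective, Function.injective_id⟩
    obtain ⟨p, q⟩ := τ.polarized _ _ h (inj.ne eq)
    have h1 : Relation.TransGen (CompStep (Strategy.copycat e) τ) (Sum.map id Sum.inr x)
        (Sum.inr (Sum.map e.equiv id x)) := by
      rcases x with x | x
      · refine .single (.left (.inl x) (.inr (e.equiv x)) (.leftRight x ?_))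
        have p : (B.pol (e.equiv x)).neg = .O := p
        rw [e.pol_eq] at p
        cases h : A.pol x <;> first | rfl | (rw [h] at p; cases p)
      · exact .single (.right (.inr x) (.inr x) (τ.le_refl _))
    have h3 : Relation.TransGen (CompStep (Strategy.copycat e) τ)
        (Sum.inr (Sum.map e.equiv id y)) (Sum.map id Sum.inr y) := by
      rcases y with x | x
      · refine .single (.left (.inr (e.equiv x)) (.inl x) (.rightLeft x ?_))
        have p : (B.pol (e.equiv x)).neg = .P := q
        rw [e.pol_eq] at p
        cases h : A.pol x <;> first | rfl | (rw [h] at p; cases p)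
      · exact .single (.right (.inr x) (.inr x) (τ.le_refl _))
    exact (h1.tail (.right _ _ h)).trans h3

theorem comp_copycat_le (σ : Strategy (A.arrow B.toGame)) (e : GameIso B C)
    (x y : A.Moves ⊕ C.Moves) :
    (σ.comp (Strategy.copycat e)).le x y ↔
      σ.le (Sum.map id e.equiv.symm x) (Sum.map id e.equiv.symm y) := by
  let φ : A.Moves ⊕ (B.Moves ⊕ C.Moves) → A.Moves ⊕ B.Moves :=
    Sum.elim Sum.inl (Sum.inr ∘ Sum.elim id e.equiv.symm)
  have hφ : ∀ x : A.Moves ⊕ C.Moves, φ (Sum.map id Sum.inr x) = Sum.map id e.equiv.symm x := by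
    rintro (x | x) <;> rfl
  have hφ' : ∀ x : A.Moves ⊕ B.Moves, φ (Sum.map id Sum.inl x) = x := by
    rintro (x | x) <;> rfl
  constructor
  · intro h
    have key : ∀ u v, Relation.TransGen (CompStep σ (Strategy.copycat e)) u v →
        σ.le (φ u) (φ v) := by
      intro u v h
      have step : ∀ u v, CompStep σ (Strategy.copycat e) u v → σ.le (φ u) (φ v) := by
        intro u v h
        cases h with
        | left x y h => rwa [hφ', hφ']
        | right x y h =>
          have : φ (Sum.inr x) = φ (Sum.inr y) := by
            cases h <;> simp [φ]
          rw [this]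
          exact σ.le_refl _
      induction h with
      | single h => exact step _ _ h
      | tail _ h ih => exact σ.le_trans _ _ _ ih (step _ _ h)
    have := key _ _ h
    rwa [hφ, hφ] at this
  · intro h
    by_cases eq : x = y
    · rw [eq]
      exact Strategy.le_refl _ _
    have inj : Function.Injective
        (Sum.map id e.equiv.symm : A.Moves ⊕ C.Moves → A.Moves ⊕ B.Moves) :=
      Sum.map_injective.2 ⟨Function.injective_id, e.equiv.symm.injective⟩
    obtain ⟨p, q⟩ := σ.polarized _ _ h (inj.ne eq)
    have h1 : Relation.TransGen (CompStep σ (Strategy.copycat e)) (Sum.map id Sum.inr x)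
        (Sum.map id Sum.inl (Sum.map id e.equiv.symm x)) := by
      rcases x with x | x
      · exact .single (.left (.inl x) (.inl x) (σ.le_refl _))
      · have k : CopycatLe e (.inr (e.equiv (e.equiv.symm x))) (.inl (e.equiv.symm x)) :=
          .rightLeft _ p
        rw [Equiv.apply_symm_apply] at k
        exact .single (.right (.inr x) (.inl (e.equiv.symm x)) k)
    have h3 : Relation.TransGen (CompStep σ (Strategy.copycat e))
        (Sum.map id Sum.inl (Sum.map id e.equiv.symm y)) (Sum.map id Sum.inr y) := by
      rcases y with x | x
      · exact .single (.left (.inl x) (.inl x) (σ.le_refl _))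
      · have k : CopycatLe e (.inl (e.equiv.symm x)) (.inr (e.equiv (e.equiv.symm x))) :=
          .leftRight _ q
        rw [Equiv.apply_symm_apply] at k
        exact .single (.right (.inl (e.equiv.symm x)) (.inr x) k)
    exact (h1.tail (.left _ _ h)).trans h3

theorem transGen_restrict {X Y : Type} (i : Y → X) (hi : Function.Injective i)
    (R R₁ : X → X → Prop) (R' : Y → Y → Prop) (refl : ∀ u, R' u u)
    (hR : ∀ x y, R x y → R₁ x y ∨ ∃ u v, i u = x ∧ i v = y ∧ R' u v)
    (h₁ : ∀ u v, Relation.TransGen R₁ (i u) (i v) → R' u v)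
    (h' : ∀ u v, R' u v → Relation.TransGen R (i u) (i v)) (u v : Y) :
    Relation.TransGen R' u v ↔ Relation.TransGen R (i u) (i v) := by
  constructor
  · intro h
    induction h with
    | single h => exact h' _ _ h
    | tail _ h ih => exact ih.trans (h' _ _ h)
  · intro h
    have aux : ∀ w a, Relation.ReflTransGen R₁ (i w) (i a) → R' w a := by
      intro w a h
      rcases Relation.reflTransGen_iff_eq_or_transGen.1 h with h | h
      · rw [hi h]
        exact refl _
      · exact h₁ _ _ h
    have key : ∀ z, Relation.TransGen R (i u) z →
        ∃ w, Relation.TransGen R' u w ∧ Relation.ReflTransGen R₁ (i w) z := by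
      intro z h
      have step : ∀ z z', (∃ w, Relation.TransGen R' u w ∧ Relation.ReflTransGen R₁ (i w) z) →
          R z z' → ∃ w, Relation.TransGen R' u w ∧ Relation.ReflTransGen R₁ (i w) z' := by
        rintro z z' ⟨w, hw, hz⟩ h
        rcases hR _ _ h with h2 | ⟨a, b, rfl, rfl, h2⟩
        · exact ⟨w, hw, hz.tail h2⟩
        · exact ⟨b, (hw.tail (aux _ _ hz)).tail h2, .refl⟩
      induction h with
      | single h => exact step _ _ ⟨u, .single (refl u), .refl⟩ h
      | tail _ h ih => exact step _ _ ih h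
    obtain ⟨w, hw, hz⟩ := key _ h
    exact hw.tail (aux _ _ hz)

theorem transGen_map {X Y : Type} (k : Y → X) (hk : Function.Injective k) (r : Y → Y → Prop)
    (x y : X) (h : Relation.TransGen (Relation.Map r k k) x y) :
    ∃ a b, k a = x ∧ k b = y ∧ Relation.TransGen r a b := by
  induction h with
  | single h =>
    obtain ⟨a, b, h, e, e'⟩ := h
    exact ⟨a, b, e, e', .single h⟩
  | tail _ h ih =>
    obtain ⟨a, b, e, e', h'⟩ := ih
    obtain ⟨c, d, h, ec, ed⟩ := h
    rw [← e'] at ec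
    cases hk ec
    exact ⟨a, d, e, ed, h'.tail h⟩

/-- The union of three composable strategies. -/
inductive CompStep₃ (σ : Strategy (A.arrow B.toGame)) (τ : Strategy (B.arrow C.toGame))
    (υ : Strategy (C.arrow D.toGame)) : A.Moves ⊕ (B.Moves ⊕ (C.Moves ⊕ D.Moves)) →
      A.Moves ⊕ (B.Moves ⊕ (C.Moves ⊕ D.Moves)) → Prop
  | left (x y : A.Moves ⊕ B.Moves) (h : σ.le x y) :
      CompStep₃ σ τ υ (Sum.map id Sum.inl x) (Sum.map id Sum.inl y)
  | middle (x y : B.Moves ⊕ C.Moves) (h : τ.le x y) :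
      CompStep₃ σ τ υ (Sum.inr (Sum.map id Sum.inl x)) (Sum.inr (Sum.map id Sum.inl y))
  | right (x y : C.Moves ⊕ D.Moves) (h : υ.le x y) :
      CompStep₃ σ τ υ (Sum.inr (Sum.inr x)) (Sum.inr (Sum.inr y))

theorem compLe_assoc_left (σ : Strategy (A.arrow B.toGame)) (τ : Strategy (B.arrow C.toGame))
    (υ : Strategy (C.arrow D.toGame)) (x y : A.Moves ⊕ D.Moves) :
    ((σ.comp τ).comp υ).le x y ↔ Relation.TransGen (CompStep₃ σ τ υ)
      (Sum.map id (Sum.inr ∘ Sum.inr) x) (Sum.map id (Sum.inr ∘ Sum.inr) y) := by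
  let i : A.Moves ⊕ (C.Moves ⊕ D.Moves) → A.Moves ⊕ (B.Moves ⊕ (C.Moves ⊕ D.Moves)) :=
    Sum.map id Sum.inr
  let k : A.Moves ⊕ (B.Moves ⊕ C.Moves) → A.Moves ⊕ (B.Moves ⊕ (C.Moves ⊕ D.Moves)) :=
    Sum.map id (Sum.map id Sum.inl)
  have hi : Function.Injective i := Sum.map_injective.2 ⟨Function.injective_id, Sum.inr_injective⟩
  have hk : Function.Injective k := Sum.map_injective.2
    ⟨Function.injective_id, Sum.map_injective.2 ⟨Function.injective_id, Sum.inl_injective⟩⟩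
  have hki : ∀ z : A.Moves ⊕ C.Moves, k (Sum.map id Sum.inr z) = i (Sum.map id Sum.inl z) := by
    rintro (z | z) <;> rfl
  have hkl : ∀ z : A.Moves ⊕ B.Moves, k (Sum.map id Sum.inl z) = Sum.map id Sum.inl z := by
    rintro (z | z) <;> rfl
  have main := transGen_restrict i hi (CompStep₃ σ τ υ) (Relation.Map (CompStep σ τ) k k)
    (CompStep (σ.comp τ) υ)
    (by
      rintro (u | u)
      · exact .left (.inl u) (.inl u) (Strategy.le_refl _ _)
      · exact .right u u (Strategy.le_refl _ _))
    (by
      intro x y h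
      cases h with
      | left x y h => exact .inl ⟨_, _, .left x y h, hkl x, hkl y⟩
      | middle x y h => exact .inl ⟨_, _, .right x y h, rfl, rfl⟩
      | right x y h => exact .inr ⟨.inr x, .inr y, rfl, rfl, .right x y h⟩)
    (by
      intro u v h
      obtain ⟨a, b, ha, hb, h2⟩ := transGen_map k hk _ _ _ h
      have lem : ∀ a u, k a = i u → ∃ w : A.Moves ⊕ C.Moves,
          a = Sum.map id Sum.inr w ∧ u = Sum.map id Sum.inl w := by
        rintro (a | a | a) (u | u | u) e <;> cases e
        · exact ⟨.inl _, rfl, rfl⟩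
        · exact ⟨.inr _, rfl, rfl⟩
      obtain ⟨w, rfl, rfl⟩ := lem _ _ ha
      obtain ⟨w', rfl, rfl⟩ := lem _ _ hb
      exact .left w w' h2)
    (by
      intro u v h
      cases h with
      | left x y h =>
        rw [← hki, ← hki]
        refine Relation.TransGen.lift k ?_ _ _ (show Relation.TransGen _ _ _ from h)
        intro a b h
        cases h with
        | left x y h =>
          change CompStep₃ σ τ υ (k _) (k _)
          rw [hkl, hkl]
          exact .left _ _ h
        | right x y h => exact .middle _ _ h
      | right x y h => exact .single (.right x y h))
  have e : ∀ z : A.Moves ⊕ D.Moves,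
      i (Sum.map id Sum.inr z) = Sum.map id (Sum.inr ∘ Sum.inr) z := by
    rintro (z | z) <;> rfl
  rw [← e, ← e]
  exact main _ _

theorem compLe_assoc_right (σ : Strategy (A.arrow B.toGame)) (τ : Strategy (B.arrow C.toGame))
    (υ : Strategy (C.arrow D.toGame)) (x y : A.Moves ⊕ D.Moves) :
    (σ.comp (τ.comp υ)).le x y ↔ Relation.TransGen (CompStep₃ σ τ υ)
      (Sum.map id (Sum.inr ∘ Sum.inr) x) (Sum.map id (Sum.inr ∘ Sum.inr) y) := by
  let i : A.Moves ⊕ (B.Moves ⊕ D.Moves) → A.Moves ⊕ (B.Moves ⊕ (C.Moves ⊕ D.Moves)) :=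
    Sum.map id (Sum.map id Sum.inr)
  let k : B.Moves ⊕ (C.Moves ⊕ D.Moves) → A.Moves ⊕ (B.Moves ⊕ (C.Moves ⊕ D.Moves)) := Sum.inr
  have hi : Function.Injective i := Sum.map_injective.2
    ⟨Function.injective_id, Sum.map_injective.2 ⟨Function.injective_id, Sum.inr_injective⟩⟩
  have hk : Function.Injective k := Sum.inr_injective
  have hki : ∀ z : B.Moves ⊕ D.Moves, k (Sum.map id Sum.inr z) = i (Sum.inr z) := by
    rintro (z | z) <;> rfl
  have hil : ∀ z : A.Moves ⊕ B.Moves, i (Sum.map id Sum.inl z) = Sum.map id Sum.inl z := by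
    rintro (z | z) <;> rfl
  have main := transGen_restrict i hi (CompStep₃ σ τ υ) (Relation.Map (CompStep τ υ) k k)
    (CompStep σ (τ.comp υ))
    (by
      rintro (u | u)
      · exact .left (.inl u) (.inl u) (Strategy.le_refl _ _)
      · exact .right u u (Strategy.le_refl _ _))
    (by
      intro x y h
      cases h with
      | left x y h => exact .inr ⟨_, _, hil x, hil y, .left x y h⟩
      | middle x y h => exact .inl ⟨_, _, .left x y h, rfl, rfl⟩
      | right x y h => exact .inl ⟨_, _, .right x y h, rfl, rfl⟩)
    (by
      intro u v h
      obtain ⟨a, b, ha, hb, h2⟩ := transGen_map k hk _ _ _ h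
      have lem : ∀ a u, k a = i u → ∃ w : B.Moves ⊕ D.Moves,
          a = Sum.map id Sum.inr w ∧ u = Sum.inr w := by
        rintro (a | a | a) (u | u | u) e <;> cases e
        · exact ⟨.inl _, rfl, rfl⟩
        · exact ⟨.inr _, rfl, rfl⟩
      obtain ⟨w, rfl, rfl⟩ := lem _ _ ha
      obtain ⟨w', rfl, rfl⟩ := lem _ _ hb
      exact .right w w' h2)
    (by
      intro u v h
      cases h with
      | left x y h =>
        rw [hil, hil]
        exact .single (.left x y h)
      | right x y h =>
        rw [← hki, ← hki]
        refine Relation.TransGen.lift k ?_ _ _ (show Relation.TransGen _ _ _ from h)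
        intro a b h
        cases h with
        | left x y h => exact .middle _ _ h
        | right x y h => exact .right _ _ h)
  have e : ∀ z : A.Moves ⊕ D.Moves,
      i (Sum.map id Sum.inr z) = Sum.map id (Sum.inr ∘ Sum.inr) z := by
    rintro (z | z) <;> rfl
  rw [← e, ← e]
  exact main _ _

theorem Strategy.ext_le {A : Game} {σ τ : Strategy A} (h : ∀ x y, σ.le x y ↔ τ.le x y) : σ = τ :=
  Strategy.ext (funext fun x => funext fun y => propext (h x y))

end CopycatComp

/-- The category of filiform games and strategies: a morphism from `A` to `B` is a strategy
on `A ⊸ B`. -/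
instance : Category FiliformGame where
  Hom A B := Strategy (A.arrow B.toGame)
  id A := .copycat (.refl A)
  comp σ τ := σ.comp τ
  id_comp {A B} σ := Strategy.ext_le (by
    rintro (x | x) (y | y) <;> exact copycat_comp_le _ σ _ _)
  comp_id {A B} σ := Strategy.ext_le (by
    rintro (x | x) (y | y) <;> exact comp_copycat_le σ _ _ _)
  assoc σ τ υ := Strategy.ext_le fun x y =>
    (compLe_assoc_left σ τ υ x y).trans (compLe_assoc_right σ τ υ x y).symm

/-! ### The monoidal structure -/

section Tensor

variable {A B C D E F : FiliformGame}

/-- The bijection between the moves of `(A ◁ C) ⊸ (B ◁ D)` and those of `A ⊸ B` and `C ⊸ D`. -/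
def shuffle {α β γ δ : Type} : (α ⊕ γ) ⊕ (β ⊕ δ) → (α ⊕ β) ⊕ (γ ⊕ δ) :=
  Sum.elim (Sum.map Sum.inl Sum.inl) (Sum.map Sum.inr Sum.inr)

theorem shuffle_shuffle {α β γ δ : Type} (x : (α ⊕ γ) ⊕ (β ⊕ δ)) : shuffle (shuffle x) = x := by
  rcases x with (x | x) | (x | x) <;> rfl

theorem shuffle_injective {α β γ δ : Type} :
    Function.Injective (shuffle : (α ⊕ γ) ⊕ (β ⊕ δ) → (α ⊕ β) ⊕ (γ ⊕ δ)) :=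
  Function.LeftInverse.injective shuffle_shuffle

/-- The union of the partial orders of `σ : A ⊸ B` and `τ : C ⊸ D`, as a relation on the moves of
`(A ◁ C) ⊸ (B ◁ D)`. This is already transitive. -/
def TensorLe (σ : Strategy (A.arrow B.toGame)) (τ : Strategy (C.arrow D.toGame))
    (x y : (A.Moves ⊕ C.Moves) ⊕ (B.Moves ⊕ D.Moves)) : Prop :=
  Sum.LiftRel σ.le τ.le (shuffle x) (shuffle y)

theorem tensorLe_polarized (σ : Strategy (A.arrow B.toGame)) (τ : Strategy (C.arrow D.toGame))
    (x y) (h : TensorLe σ τ x y) (ne : x ≠ y) :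
    ((A.before C).arrow (B.before D).toGame).pol x = .O ∧
      ((A.before C).arrow (B.before D).toGame).pol y = .P := by
  have hp : ∀ z, ((A.before C).arrow (B.before D).toGame).pol z =
      Sum.elim (A.arrow B.toGame).pol (C.arrow D.toGame).pol (shuffle z) := by
    rintro ((z | z) | (z | z)) <;> rfl
  have ne := (shuffle_injective).ne ne
  rw [hp, hp]
  unfold TensorLe at h
  generalize shuffle x = u at *
  generalize shuffle y = v at *
  cases h with
  | inl h => exact σ.polarized _ _ h (fun e => ne (by rw [e]))
  | inr h => exact τ.polarized _ _ h (fun e => ne (by rw [e]))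

/-- The strategy `σ ◁ τ : (A ◁ C) ⊸ (B ◁ D)`. -/
def Strategy.tensor (σ : Strategy (A.arrow B.toGame)) (τ : Strategy (C.arrow D.toGame)) :
    Strategy ((A.before C).arrow (B.before D).toGame) where
  le := TensorLe σ τ
  le_refl := by
    intro x
    unfold TensorLe
    rcases shuffle x with z | z
    · exact .inl (σ.le_refl _)
    · exact .inr (τ.le_refl _)
  le_trans := polarized_trans (A := (A.before C).arrow (B.before D).toGame)
    (tensorLe_polarized σ τ)
  le_antisymm := polarized_antisymm (A := (A.before C).arrow (B.before D).toGame)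
    (tensorLe_polarized σ τ)
  compatible := by
    apply compatible_of_le (fun x y => Sum.Lex (Closure (A.arrow B.toGame) σ.le)
      (Closure (C.arrow D.toGame) τ.le) (shuffle x) (shuffle y))
    · intro x y z h h'
      generalize shuffle x = u at *
      generalize shuffle y = v at *
      generalize shuffle z = w at *
      cases h <;> cases h'
      · exact .inl (Relation.TransGen.trans ‹_› ‹_›)
      · exact .sep _ _
      · exact .inr (Relation.TransGen.trans ‹_› ‹_›)
      · exact .sep _ _
    · intro x y h h'
      apply shuffle_injective
      generalize shuffle x = u at *
      generalize shuffle y = v at *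
      cases h <;> cases h'
      · exact congrArg _ (σ.compatible _ _ ‹_› ‹_›)
      · exact congrArg _ (τ.compatible _ _ ‹_› ‹_›)
    · intro x y h
      cases h with
      | inl h =>
        cases h with
        | inl h => exact .inl (.single (.inl (.inl h)))
        | inr h => exact .inr (.single (.inl (.inl h)))
        | sep => exact .sep _ _
      | inr h =>
        cases h with
        | inl h => exact .inl (.single (.inl (.inr h)))
        | inr h => exact .inr (.single (.inl (.inr h)))
        | sep => exact .sep _ _
    · intro x y h
      unfold TensorLe at h
      generalize shuffle x = u at *
      generalize shuffle y = v at *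
      cases h with
      | inl h => exact .inl (.single (.inr h))
      | inr h => exact .inr (.single (.inr h))
  polarized := tensorLe_polarized σ τ

theorem transGen_liftRel {X Y : Type} {r : X → X → Prop} {s : Y → Y → Prop} (x y : X ⊕ Y) :
    Relation.TransGen (Sum.LiftRel r s) x y ↔
      Sum.LiftRel (Relation.TransGen r) (Relation.TransGen s) x y := by
  constructor
  · intro h
    induction h with
    | single h => exact h.mono (fun _ _ h => .single h) (fun _ _ h => .single h)
    | tail _ h ih =>
      cases h with
      | inl h =>
        cases ih with
        | inl h' => exact .inl (h'.tail h)
      | inr h =>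
        cases ih with
        | inr h' => exact .inr (h'.tail h)
  · rintro (⟨h⟩ | ⟨h⟩)
    · exact Relation.TransGen.lift Sum.inl (fun _ _ h => Sum.LiftRel.inl h) _ _ h
    · exact Relation.TransGen.lift Sum.inr (fun _ _ h => Sum.LiftRel.inr h) _ _ h

/-- Separation of the moves of two copies of a composition. -/
def split {α α' β β' γ γ' : Type} :
    (α ⊕ α') ⊕ ((β ⊕ β') ⊕ (γ ⊕ γ')) → (α ⊕ (β ⊕ γ)) ⊕ (α' ⊕ (β' ⊕ γ')) :=
  Sum.elim (Sum.map Sum.inl Sum.inl)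
    (Sum.elim (Sum.map (Sum.inr ∘ Sum.inl) (Sum.inr ∘ Sum.inl))
      (Sum.map (Sum.inr ∘ Sum.inr) (Sum.inr ∘ Sum.inr)))

theorem compStep_tensor (σ : Strategy (A.arrow B.toGame)) (σ' : Strategy (B.arrow C.toGame))
    (τ : Strategy (D.arrow E.toGame)) (τ' : Strategy (E.arrow F.toGame)) (x y) :
    CompStep (σ.tensor τ) (σ'.tensor τ') x y ↔
      Sum.LiftRel (CompStep σ σ') (CompStep τ τ') (split x) (split y) := by
  constructor
  · intro h
    cases h with
    | left x y h =>
      have h : TensorLe σ τ x y := h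
      unfold TensorLe at h
      have e : ∀ z : (A.Moves ⊕ D.Moves) ⊕ (B.Moves ⊕ E.Moves),
          split (Sum.map id Sum.inl z : (A.Moves ⊕ D.Moves) ⊕
            ((B.Moves ⊕ E.Moves) ⊕ (C.Moves ⊕ F.Moves))) =
          Sum.map (Sum.map id Sum.inl) (Sum.map id Sum.inl) (shuffle z) := by
        rintro ((z | z) | (z | z)) <;> rfl
      rw [e, e]
      generalize shuffle x = u at *
      generalize shuffle y = v at *
      cases h with
      | inl h => exact .inl (.left _ _ h)
      | inr h => exact .inr (.left _ _ h)
    | right x y h =>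
      have h : TensorLe σ' τ' x y := h
      unfold TensorLe at h
      have e : ∀ z : (B.Moves ⊕ E.Moves) ⊕ (C.Moves ⊕ F.Moves),
          split (Sum.inr z : (A.Moves ⊕ D.Moves) ⊕
            ((B.Moves ⊕ E.Moves) ⊕ (C.Moves ⊕ F.Moves))) =
          Sum.map Sum.inr Sum.inr (shuffle z) := by
        rintro ((z | z) | (z | z)) <;> rfl
      rw [e, e]
      generalize shuffle x = u at *
      generalize shuffle y = v at *
      cases h with
      | inl h => exact .inl (.right _ _ h)
      | inr h => exact .inr (.right _ _ h)
  · have inj : Function.Injective (split : (A.Moves ⊕ D.Moves) ⊕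
        ((B.Moves ⊕ E.Moves) ⊕ (C.Moves ⊕ F.Moves)) → _) := by
      rintro ((x | x) | (x | x) | (x | x)) ((y | y) | (y | y) | (y | y)) h <;> cases h <;> rfl
    have key : ∀ u v, Sum.LiftRel (CompStep σ σ') (CompStep τ τ') u v →
        ∃ x y, split x = u ∧ split y = v ∧ CompStep (σ.tensor τ) (σ'.tensor τ') x y := by
      rintro _ _ (⟨h⟩ | ⟨h⟩)
      · cases h with
        | left x y h =>
          refine ⟨_, _, ?_, ?_, .left (shuffle (Sum.inl x)) (shuffle (Sum.inl y)) ?_⟩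
          · rcases x with x | x <;> rfl
          · rcases y with x | x <;> rfl
          · change Sum.LiftRel _ _ (shuffle (shuffle _)) (shuffle (shuffle _))
            rw [shuffle_shuffle, shuffle_shuffle]
            exact .inl h
        | right x y h =>
          refine ⟨_, _, ?_, ?_, .right (shuffle (Sum.inl x)) (shuffle (Sum.inl y)) ?_⟩
          · rcases x with x | x <;> rfl
          · rcases y with x | x <;> rfl
          · change Sum.LiftRel _ _ (shuffle (shuffle _)) (shuffle (shuffle _))
            rw [shuffle_shuffle, shuffle_shuffle]
            exact .inl h
      · cases h with
        | left x y h =>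
          refine ⟨_, _, ?_, ?_, .left (shuffle (Sum.inr x)) (shuffle (Sum.inr y)) ?_⟩
          · rcases x with x | x <;> rfl
          · rcases y with x | x <;> rfl
          · change Sum.LiftRel _ _ (shuffle (shuffle _)) (shuffle (shuffle _))
            rw [shuffle_shuffle, shuffle_shuffle]
            exact .inr h
        | right x y h =>
          refine ⟨_, _, ?_, ?_, .right (shuffle (Sum.inr x)) (shuffle (Sum.inr y)) ?_⟩
          · rcases x with x | x <;> rfl
          · rcases y with x | x <;> rfl
          · change Sum.LiftRel _ _ (shuffle (shuffle _)) (shuffle (shuffle _))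
            rw [shuffle_shuffle, shuffle_shuffle]
            exact .inr h
    intro h
    obtain ⟨x', y', hx, hy, h⟩ := key _ _ h
    rwa [← inj hx, ← inj hy]

theorem split_surjective {α α' β β' γ γ' : Type} : Function.Surjective
    (split : (α ⊕ α') ⊕ ((β ⊕ β') ⊕ (γ ⊕ γ')) → (α ⊕ (β ⊕ γ)) ⊕ (α' ⊕ (β' ⊕ γ'))) := by
  rintro ((x | x | x) | (x | x | x))
  · exact ⟨.inl (.inl x), rfl⟩
  · exact ⟨.inr (.inl (.inl x)), rfl⟩
  · exact ⟨.inr (.inr (.inl x)), rfl⟩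
  · exact ⟨.inl (.inr x), rfl⟩
  · exact ⟨.inr (.inl (.inr x)), rfl⟩
  · exact ⟨.inr (.inr (.inr x)), rfl⟩

theorem tensor_comp (σ : Strategy (A.arrow B.toGame)) (σ' : Strategy (B.arrow C.toGame))
    (τ : Strategy (D.arrow E.toGame)) (τ' : Strategy (E.arrow F.toGame)) :
    (σ.tensor τ).comp (σ'.tensor τ') = (σ.comp σ').tensor (τ.comp τ') := by
  apply Strategy.ext_le
  intro x y
  have e : ∀ z : (A.Moves ⊕ D.Moves) ⊕ (C.Moves ⊕ F.Moves),
      split (Sum.map id Sum.inr z : (A.Moves ⊕ D.Moves) ⊕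
        ((B.Moves ⊕ E.Moves) ⊕ (C.Moves ⊕ F.Moves))) =
      Sum.map (Sum.map id Sum.inr) (Sum.map id Sum.inr) (shuffle z) := by
    rintro ((z | z) | (z | z)) <;> rfl
  have h1 : ((σ.tensor τ).comp (σ'.tensor τ')).le x y ↔
      Relation.TransGen (Sum.LiftRel (CompStep σ σ') (CompStep τ τ'))
        (split (Sum.map id Sum.inr x)) (split (Sum.map id Sum.inr y)) := by
    constructor
    · exact fun h => Relation.TransGen.lift split
        (fun _ _ h => (compStep_tensor _ _ _ _ _ _).1 h) _ _ h
    · intro h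
      have h := Relation.TransGen.lift (Function.surjInv split_surjective)
        (p := CompStep (σ.tensor τ) (σ'.tensor τ'))
        (fun a b h => (compStep_tensor _ _ _ _ _ _).2 (by
          rwa [Function.surjInv_eq split_surjective, Function.surjInv_eq split_surjective]))
        _ _ h
      have inj : Function.Injective (split : (A.Moves ⊕ D.Moves) ⊕
          ((B.Moves ⊕ E.Moves) ⊕ (C.Moves ⊕ F.Moves)) → _) := by
        rintro ((x | x) | (x | x) | (x | x)) ((y | y) | (y | y) | (y | y)) h <;> cases h <;> rfl
      have li := Function.leftInverse_surjInv ⟨inj, split_surjective⟩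
      change Relation.TransGen _ (Function.surjInv split_surjective (split _))
        (Function.surjInv split_surjective (split _)) at h
      rw [li, li] at h
      exact h
  rw [h1, transGen_liftRel, e, e]
  change _ ↔ Sum.LiftRel (CompLe σ σ') (CompLe τ τ') (shuffle x) (shuffle y)
  generalize shuffle x = u
  generalize shuffle y = v
  rcases u with u | u <;> rcases v with v | v <;> simp [CompLe]

/-- The isomorphism of games `A ◁ C ≅ B ◁ D` induced by isomorphisms `A ≅ B` and `C ≅ D`. -/
def GameIso.before (e : GameIso A B) (f : GameIso C D) : GameIso (A.before C) (B.before D) where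
  equiv := Equiv.sumCongr e.equiv f.equiv
  pol_eq := by
    rintro (m | m)
    · exact e.pol_eq m
    · exact f.pol_eq m
  le_iff := by
    rintro (m | m) (n | n) <;> simp [e.le_iff, f.le_iff]

theorem copycatLe_tensor (e : GameIso A B) (f : GameIso C D)
    (x y : (A.Moves ⊕ C.Moves) ⊕ (B.Moves ⊕ D.Moves)) :
    Sum.LiftRel (CopycatLe e) (CopycatLe f) (shuffle x) (shuffle y) ↔
      CopycatLe (e.before f) x y := by
  constructor
  · intro h
    rw [← shuffle_shuffle x, ← shuffle_shuffle y]
    generalize shuffle x = u at *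
    generalize shuffle y = v at *
    rcases h with ⟨h⟩ | ⟨h⟩
    · cases h with
      | refl => exact .refl _
      | leftRight m h => exact .leftRight (e := e.before f) (.inl m) h
      | rightLeft m h => exact .rightLeft (e := e.before f) (.inl m) h
    · cases h with
      | refl => exact .refl _
      | leftRight m h => exact .leftRight (e := e.before f) (.inr m) h
      | rightLeft m h => exact .rightLeft (e := e.before f) (.inr m) h
  · intro h
    rcases h with _ | ⟨m, h⟩ | ⟨m, h⟩
    · rcases shuffle x with z | z
      · exact .inl (.refl _)
      · exact .inr (.refl _)
    · rcases m with m | m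
      · exact .inl (.leftRight m h)
      · exact .inr (.leftRight m h)
    · rcases m with m | m
      · exact .inl (.rightLeft m h)
      · exact .inr (.rightLeft m h)

theorem copycat_tensor (e : GameIso A B) (f : GameIso C D) :
    (Strategy.copycat e).tensor (Strategy.copycat f) = Strategy.copycat (e.before f) :=
  Strategy.ext_le (copycatLe_tensor e f)

theorem copycatLe_trans_iff (e : GameIso A B) (f : GameIso B C) (x y : A.Moves ⊕ C.Moves) :
    CopycatLe f (Sum.map e.equiv id x) (Sum.map e.equiv id y) ↔ CopycatLe (e.trans f) x y := by
  constructor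
  · intro h
    have inj : Function.Injective (Sum.map e.equiv id : A.Moves ⊕ C.Moves → B.Moves ⊕ C.Moves) :=
      Sum.map_injective.2 ⟨e.equiv.injective, Function.injective_id⟩
    generalize hu : Sum.map e.equiv id x = u at h
    generalize hv : Sum.map e.equiv id y = v at h
    cases h with
    | refl =>
      rw [inj (hu.trans hv.symm)]
      exact .refl _
    | leftRight m h =>
      rcases x with x | x <;> rcases y with y | y <;> cases hu <;> cases hv
      exact .leftRight (e := e.trans f) x ((e.pol_eq x).symm.trans h)
    | rightLeft m h =>
      rcases x with x | x <;> rcases y with y | y <;> cases hu <;> cases hv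
      exact .rightLeft (e := e.trans f) y ((e.pol_eq y).symm.trans h)
  · intro h
    cases h with
    | refl => exact .refl _
    | leftRight m h => exact .leftRight (e := f) (e.equiv m) ((e.pol_eq m).trans h)
    | rightLeft m h => exact .rightLeft (e := f) (e.equiv m) ((e.pol_eq m).trans h)

theorem copycat_comp_copycat (e : GameIso A B) (f : GameIso B C) :
    (Strategy.copycat e).comp (Strategy.copycat f) = Strategy.copycat (e.trans f) := by
  apply Strategy.ext_le
  intro x y
  rw [copycat_comp_le]
  exact copycatLe_trans_iff e f x y

theorem copycat_congr {e f : GameIso A B} (h : ∀ m, e.equiv m = f.equiv m) :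
    Strategy.copycat e = Strategy.copycat f := by
  have : e = f := by
    rcases e with ⟨e, _, _⟩
    rcases f with ⟨f, _, _⟩
    have : e = f := Equiv.ext h
    subst this
    rfl
  rw [this]

end Tensor

/-- The isomorphism in the category of games given by the copycat strategies along an isomorphism
of games. -/
def GameIso.toIso {A B : FiliformGame} (e : GameIso A B) : A ≅ B where
  hom := Strategy.copycat e
  inv := Strategy.copycat e.symm
  hom_inv_id := (copycat_comp_copycat e e.symm).trans
    (copycat_congr (f := .refl A) fun m => e.equiv.symm_apply_apply m)
  inv_hom_id := (copycat_comp_copycat e.symm e).trans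
    (copycat_congr (f := .refl B) fun m => e.equiv.apply_symm_apply m)

/-- The associativity isomorphism `(A ◁ B) ◁ C ≅ A ◁ (B ◁ C)`. -/
def GameIso.assoc (A B C : FiliformGame) :
    GameIso ((A.before B).before C) (A.before (B.before C)) where
  equiv := Equiv.sumAssoc _ _ _
  pol_eq := by rintro ((m | m) | m) <;> rfl
  le_iff := by rintro ((m | m) | m) ((n | n) | n) <;> simp

/-- The left unit isomorphism `I ◁ A ≅ A`. -/
def GameIso.leftUnit (A : FiliformGame) : GameIso (FiliformGame.empty.before A) A where
  equiv := Equiv.emptySum Empty _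
  pol_eq := by rintro (⟨⟨⟩⟩ | m); rfl
  le_iff := by rintro (⟨⟨⟩⟩ | m) (⟨⟨⟩⟩ | n); simp

/-- The right unit isomorphism `A ◁ I ≅ A`. -/
def GameIso.rightUnit (A : FiliformGame) : GameIso (A.before FiliformGame.empty) A where
  equiv := Equiv.sumEmpty _ Empty
  pol_eq := by rintro (m | ⟨⟨⟩⟩); rfl
  le_iff := by rintro (m | ⟨⟨⟩⟩) (n | ⟨⟨⟩⟩); simp

section Naturality

variable {A A' A'' B B' B'' : FiliformGame}

theorem assoc_naturality (f : Strategy (A.arrow B.toGame)) (g : Strategy (A'.arrow B'.toGame))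
    (h : Strategy (A''.arrow B''.toGame)) :
    ((f.tensor g).tensor h).comp (.copycat (.assoc B B' B'')) =
      (Strategy.copycat (.assoc A A' A'')).comp (f.tensor (g.tensor h)) := by
  apply Strategy.ext_le
  intro x y
  rw [comp_copycat_le, copycat_comp_le]
  change TensorLe (f.tensor g) h _ _ ↔ TensorLe f (g.tensor h) _ _
  unfold TensorLe
  rcases x with ((x | x) | x) | (x | (x | x)) <;> rcases y with ((y | y) | y) | (y | (y | y)) <;>
    simp [GameIso.assoc, shuffle, Strategy.tensor, TensorLe]

theorem leftUnit_naturality (f : Strategy (A.arrow B.toGame)) :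
    (Strategy.tensor (.copycat (.refl .empty)) f).comp (.copycat (.leftUnit B)) =
      (Strategy.copycat (.leftUnit A)).comp f := by
  apply Strategy.ext_le
  intro x y
  rw [comp_copycat_le, copycat_comp_le]
  change TensorLe _ f _ _ ↔ _
  unfold TensorLe
  rcases x with (x | x) | x <;> rcases y with (y | y) | y <;> try (exact Empty.elim ‹_›)
  all_goals simp [GameIso.leftUnit, shuffle]

theorem rightUnit_naturality (f : Strategy (A.arrow B.toGame)) :
    (Strategy.tensor f (.copycat (.refl .empty))).comp (.copycat (.rightUnit B)) =
      (Strategy.copycat (.rightUnit A)).comp f := by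
  apply Strategy.ext_le
  intro x y
  rw [comp_copycat_le, copycat_comp_le]
  change TensorLe f _ _ _ ↔ _
  unfold TensorLe
  rcases x with (x | x) | x <;> rcases y with (y | y) | y <;> try (exact Empty.elim ‹_›)
  all_goals simp [GameIso.rightUnit, shuffle]

theorem games_pentagon (A B C D : FiliformGame) :
    (Strategy.tensor (.copycat (.assoc A B C)) (.copycat (.refl D))).comp
      ((Strategy.copycat (.assoc A (B.before C) D)).comp
        (Strategy.tensor (.copycat (.refl A)) (.copycat (.assoc B C D)))) =
    (Strategy.copycat (.assoc (A.before B) C D)).comp (.copycat (.assoc A B (C.before D))) := by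
  rw [copycat_tensor, copycat_tensor, copycat_comp_copycat, copycat_comp_copycat,
    copycat_comp_copycat]
  apply copycat_congr
  rintro (((m | m) | m) | m) <;> rfl

theorem games_triangle (A B : FiliformGame) :
    (Strategy.copycat (.assoc A .empty B)).comp
      (Strategy.tensor (.copycat (.refl A)) (.copycat (.leftUnit B))) =
    Strategy.tensor (.copycat (.rightUnit A)) (.copycat (.refl B)) := by
  rw [copycat_tensor, copycat_tensor, copycat_comp_copycat]
  apply copycat_congr
  rintro ((m | ⟨⟨⟩⟩) | m) <;> rfl

end Naturality

/-- The monoidal structure on games: the tensor product is "before", the unit is the empty game,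
and the structural isomorphisms are the copycat strategies. -/
instance : MonoidalCategoryStruct FiliformGame where
  tensorObj A B := A.before B
  tensorHom σ τ := σ.tensor τ
  whiskerLeft A _ _ σ := Strategy.tensor (𝟙 A : A ⟶ A) σ
  whiskerRight σ A := Strategy.tensor σ (𝟙 A : A ⟶ A)
  tensorUnit := FiliformGame.empty
  associator A B C := (GameIso.assoc A B C).toIso
  leftUnitor A := (GameIso.leftUnit A).toIso
  rightUnitor A := (GameIso.rightUnit A).toIso

instance : MonoidalCategory FiliformGame := MonoidalCategory.ofTensorHom
  (id_tensorHom_id := fun A B => (copycat_tensor (.refl A) (.refl B)).trans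
    (copycat_congr (f := .refl _) (by rintro (m | m) <;> rfl)))
  (id_tensorHom := fun _ _ _ _ => rfl)
  (tensorHom_id := fun _ _ => rfl)
  (tensorHom_comp_tensorHom := fun f g h k => tensor_comp f h g k)
  (associator_naturality := fun f g h => assoc_naturality f g h)
  (leftUnitor_naturality := fun f => leftUnit_naturality f)
  (rightUnitor_naturality := fun f => rightUnit_naturality f)
  (pentagon := games_pentagon)
  (triangle := games_triangle)

/-! ### Presentations of monoidal categories -/

/-- A signature: atomic types, generators, and the source and target of every generator, which are
types, i.e. elements of the free monoid of lists of atomic types. -/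
structure Signature where
  Atom : Type
  Gen : Type
  src : Gen → List Atom
  tgt : Gen → List Atom

/-- Formal morphisms built from the generators of a signature by identities, composition (in
diagrammatic order) and tensor product. -/
inductive Signature.Expr (S : Signature) : List S.Atom → List S.Atom → Type
  | gen (g : S.Gen) : Expr S (S.src g) (S.tgt g)
  | id (A : List S.Atom) : Expr S A A
  | comp {A B C : List S.Atom} (f : Expr S A B) (g : Expr S B C) : Expr S A C
  | tensor {A B C D : List S.Atom} (f : Expr S A B) (g : Expr S C D) : Expr S (A ++ C) (B ++ D)

/-- A monoidal equational theory: a signature together with a set of equations between parallel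
formal morphisms. -/
structure MonoidalTheory extends Signature where
  eqn : ∀ {A B : List Atom}, toSignature.Expr A B → toSignature.Expr A B → Prop

namespace MonoidalTheory

/-- The congruence on formal morphisms generated by the axioms of strict monoidal categories and by
the equations of the theory. It relates formal morphisms whose types are a priori only
propositionally equal, since `(A ++ B) ++ C = A ++ (B ++ C)` is not a definitional equality. -/
inductive Cong (T : MonoidalTheory) : ∀ {A B A' B' : List T.Atom},
    T.Expr A B → T.Expr A' B' → Prop
  | eqn {A B} {f g : T.Expr A B} (h : T.eqn f g) : Cong T f g
  | refl {A B} (f : T.Expr A B) : Cong T f f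
  | symm {A B A' B'} {f : T.Expr A B} {g : T.Expr A' B'} (h : Cong T f g) : Cong T g f
  | trans {A B A' B' A'' B''} {f : T.Expr A B} {g : T.Expr A' B'} {h : T.Expr A'' B''}
      (h₁ : Cong T f g) (h₂ : Cong T g h) : Cong T f h
  | comp {A B C A' B' C'} {f : T.Expr A B} {g : T.Expr B C} {f' : T.Expr A' B'}
      {g' : T.Expr B' C'} (h₁ : Cong T f f') (h₂ : Cong T g g') :
      Cong T (f.comp g) (f'.comp g')
  | tensor {A B C D A' B' C' D'} {f : T.Expr A B} {g : T.Expr C D} {f' : T.Expr A' B'}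
      {g' : T.Expr C' D'} (h₁ : Cong T f f') (h₂ : Cong T g g') :
      Cong T (f.tensor g) (f'.tensor g')
  | id_comp {A B} (f : T.Expr A B) : Cong T ((Signature.Expr.id A).comp f) f
  | comp_id {A B} (f : T.Expr A B) : Cong T (f.comp (.id B)) f
  | assoc {A B C D} (f : T.Expr A B) (g : T.Expr B C) (h : T.Expr C D) :
      Cong T ((f.comp g).comp h) (f.comp (g.comp h))
  | unit_tensor {A B} (f : T.Expr A B) : Cong T ((Signature.Expr.id []).tensor f) f
  | tensor_unit {A B} (f : T.Expr A B) : Cong T (f.tensor (.id [])) f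
  | tensor_assoc {A B C D E F} (f : T.Expr A B) (g : T.Expr C D) (h : T.Expr E F) :
      Cong T ((f.tensor g).tensor h) (f.tensor (g.tensor h))
  | id_tensor_id (A B : List T.Atom) :
      Cong T ((Signature.Expr.id A).tensor (.id B)) (.id (A ++ B))
  | interchange {A B C D E F} (f : T.Expr A B) (g : T.Expr B C) (f' : T.Expr D E)
      (g' : T.Expr E F) :
      Cong T ((f.comp g).tensor (f'.comp g')) ((f.tensor f').comp (g.tensor g'))

/-- The objects of the category generated by a theory: the types. -/
structure Generated (T : MonoidalTheory) where
  word : List T.Atom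

variable (T : MonoidalTheory)

/-- Equivalence of parallel formal morphisms. -/
def homSetoid (A B : List T.Atom) : Setoid (T.Expr A B) where
  r f g := T.Cong f g
  iseqv := ⟨.refl, .symm, .trans⟩

/-- The category generated by a theory: its morphisms are the formal morphisms up to the congruence
generated by the equations. -/
instance : Category T.Generated where
  Hom A B := Quotient (T.homSetoid A.word B.word)
  id A := ⟦.id A.word⟧
  comp := Quotient.map₂ Signature.Expr.comp fun _ _ h _ _ h' => .comp h h'
  id_comp := by
    rintro _ _ ⟨f⟩
    exact Quotient.sound (.id_comp f)
  comp_id := by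
    rintro _ _ ⟨f⟩
    exact Quotient.sound (.comp_id f)
  assoc := by
    rintro _ _ _ _ ⟨f⟩ ⟨g⟩ ⟨h⟩
    exact Quotient.sound (.assoc f g h)

variable {T}

/-- The morphism represented by a formal morphism. -/
def homMk {A B : List T.Atom} (f : T.Expr A B) : (⟨A⟩ : T.Generated) ⟶ ⟨B⟩ :=
  Quotient.mk (T.homSetoid A B) f

/-- The tensor product of morphisms. -/
def homTensor {A B C D : T.Generated} : (A ⟶ B) → (C ⟶ D) →
    ((⟨A.word ++ C.word⟩ : T.Generated) ⟶ ⟨B.word ++ D.word⟩) :=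
  Quotient.map₂ Signature.Expr.tensor fun _ _ h _ _ h' => .tensor h h'

theorem homMk_eqToHom {A B A' B' : List T.Atom} {f : T.Expr A B} {g : T.Expr A' B'}
    (h : T.Cong f g) (hA : (⟨A⟩ : T.Generated) = ⟨A'⟩) (hB : (⟨B⟩ : T.Generated) = ⟨B'⟩) :
    homMk f ≫ eqToHom hB = eqToHom hA ≫ homMk g := by
  cases hA
  cases hB
  simp only [eqToHom_refl, Category.comp_id, Category.id_comp]
  exact Quotient.sound h

theorem homTensor_eqToHom {A B C D : T.Generated} (h : A = B) (h' : C = D) :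
    homTensor (eqToHom h) (eqToHom h') = eqToHom (by rw [h, h']) := by
  cases h
  cases h'
  exact Quotient.sound (.id_tensor_id _ _)

theorem assoc_eq (A B C : T.Generated) : (⟨(A.word ++ B.word) ++ C.word⟩ : T.Generated) =
    ⟨A.word ++ (B.word ++ C.word)⟩ :=
  congrArg Generated.mk (List.append_assoc _ _ _)

theorem unit_eq (A : T.Generated) : (⟨A.word ++ []⟩ : T.Generated) = A :=
  congrArg Generated.mk (List.append_nil _)

/-- The (strict) monoidal structure of the category generated by a theory: the tensor product of
types is concatenation, and the structural isomorphisms are identities (up to the equalities of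
types which express that concatenation is associative and unital). -/
instance : MonoidalCategoryStruct T.Generated where
  tensorObj A B := ⟨A.word ++ B.word⟩
  tensorHom f g := homTensor f g
  whiskerLeft A _ _ f := homTensor (𝟙 A) f
  whiskerRight f A := homTensor f (𝟙 A)
  tensorUnit := ⟨[]⟩
  associator A B C := eqToIso (assoc_eq A B C)
  leftUnitor _ := eqToIso rfl
  rightUnitor A := eqToIso (unit_eq A)

instance : MonoidalCategory T.Generated := MonoidalCategory.ofTensorHom
  (id_tensorHom_id := fun _ _ => Quotient.sound (.id_tensor_id _ _))
  (id_tensorHom := fun _ _ _ _ => rfl)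
  (tensorHom_id := fun _ _ => rfl)
  (tensorHom_comp_tensorHom := by
    rintro _ _ _ _ _ _ ⟨f⟩ ⟨f'⟩ ⟨g⟩ ⟨g'⟩
    exact Quotient.sound (.symm (.interchange f g f' g')))
  (associator_naturality := by
    rintro A B C A' B' C' ⟨f⟩ ⟨g⟩ ⟨h⟩
    exact homMk_eqToHom (.tensor_assoc f g h) (assoc_eq A B C) (assoc_eq A' B' C'))
  (leftUnitor_naturality := by
    rintro _ _ ⟨f⟩
    exact homMk_eqToHom (.unit_tensor f) rfl rfl)
  (rightUnitor_naturality := by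
    rintro A B ⟨f⟩
    exact homMk_eqToHom (.tensor_unit f) (unit_eq A) (unit_eq B))
  (pentagon := fun A B C D => by
    have h1 := homTensor_eqToHom (assoc_eq A B C) (Eq.refl D)
    have h2 := homTensor_eqToHom (Eq.refl A) (assoc_eq B C D)
    refine (congrArg₂ (fun f g => f ≫ eqToHom (assoc_eq A ⟨B.word ++ C.word⟩ D) ≫ g) h1 h2).trans
      ?_
    rw [eqToHom_trans, eqToHom_trans]
    exact (eqToHom_trans (assoc_eq ⟨A.word ++ B.word⟩ C D)
      (assoc_eq A B ⟨C.word ++ D.word⟩)).symm)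
  (triangle := fun A B => by
    have h1 := homTensor_eqToHom (unit_eq A) (Eq.refl B)
    have h2 := homTensor_eqToHom (Eq.refl A) (Eq.refl B)
    refine (congrArg (fun f => eqToHom (assoc_eq A ⟨[]⟩ B) ≫ f) h2).trans (Eq.trans ?_ h1.symm)
    exact eqToHom_trans _ _)

end MonoidalTheory

/-! ### The equational theory of strategies -/

/-- The thirteen generators. -/
inductive StratGen : Type
  | muO | etaO | deltaO | epsO | gammaO
  | muP | etaP | deltaP | epsP | gammaP
  | etaOP | epsOP | gammaOP

namespace StratGen

/-- The source of a generator. -/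
def src : StratGen → List Polarity
  | muO => [.O, .O]
  | etaO => []
  | deltaO => [.O]
  | epsO => [.O]
  | gammaO => [.O, .O]
  | muP => [.P, .P]
  | etaP => []
  | deltaP => [.P]
  | epsP => [.P]
  | gammaP => [.P, .P]
  | etaOP => []
  | epsOP => [.P, .O]
  | gammaOP => [.P, .O]

/-- The target of a generator. -/
def tgt : StratGen → List Polarity
  | muO => [.O]
  | etaO => [.O]
  | deltaO => [.O, .O]
  | epsO => []
  | gammaO => [.O, .O]
  | muP => [.P]
  | etaP => [.P]
  | deltaP => [.P, .P]
  | epsP => []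
  | gammaP => [.P, .P]
  | etaOP => [.O, .P]
  | epsOP => []
  | gammaOP => [.O, .P]

end StratGen

/-- The signature of the theory of strategies: two atomic types `O` and `P`, and thirteen
generators. -/
def stratSignature : Signature := ⟨Polarity, StratGen, StratGen.src, StratGen.tgt⟩

namespace StratGen

/-- Formal morphisms of the theory of strategies. -/
abbrev E (A B : List Polarity) : Type := stratSignature.Expr A B

/-- The type `O`. -/
abbrev O : List Polarity := [.O]

/-- The type `P`. -/
abbrev P : List Polarity := [.P]

local notation:65 f:65 " ⨾ " g:66 => (Signature.Expr.comp f g :)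
local notation:70 f:70 " ⊠ " g:71 => (Signature.Expr.tensor f g :)

/-- Identities. -/
abbrev i (A : List Polarity) : E A A := .id (S := stratSignature) A

abbrev μO : E (O ++ O) O := .gen (S := stratSignature) muO
abbrev ηO : E [] O := .gen (S := stratSignature) etaO
abbrev δO : E O (O ++ O) := .gen (S := stratSignature) deltaO
abbrev εO : E O [] := .gen (S := stratSignature) epsO
abbrev γO : E (O ++ O) (O ++ O) := .gen (S := stratSignature) gammaO
abbrev μP : E (P ++ P) P := .gen (S := stratSignature) muP
abbrev ηP : E [] P := .gen (S := stratSignature) etaP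
abbrev δP : E P (P ++ P) := .gen (S := stratSignature) deltaP
abbrev εP : E P [] := .gen (S := stratSignature) epsP
abbrev γP : E (P ++ P) (P ++ P) := .gen (S := stratSignature) gammaP
abbrev ηOP : E [] (O ++ P) := .gen (S := stratSignature) etaOP
abbrev εOP : E (P ++ O) [] := .gen (S := stratSignature) epsOP
abbrev γOP : E (P ++ O) (O ++ P) := .gen (S := stratSignature) gammaOP

/-- The nested unit `I → O ⊗ O ⊗ P ⊗ P`. -/
abbrev ηηOP : E [] (O ++ O ++ P ++ P) := ηOP ⨾ (i O ⊠ ηOP ⊠ i P)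

/-- The nested counit `P ⊗ P ⊗ O ⊗ O → I`. -/
abbrev εεOP : E (P ++ P ++ O ++ O) [] := (i P ⊠ εOP ⊠ i O) ⨾ εOP

/-- The equations of the theory of strategies (`⨾` is composition in diagrammatic order, `⊠` is the
tensor product, `i` denotes identities). -/
inductive Eqn : ∀ {A B : List Polarity}, E A B → E A B → Prop
  -- `γO` is a symmetry for `O`
  | yangBaxter : Eqn ((γO ⊠ i O) ⨾ (i O ⊠ γO) ⨾ (γO ⊠ i O)) ((i O ⊠ γO) ⨾ (γO ⊠ i O) ⨾ (i O ⊠ γO))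
  | gamma_gamma : Eqn (γO ⨾ γO) (i (O ++ O))
  -- `O` is a commutative monoid
  | mu_assoc : Eqn ((μO ⊠ i O) ⨾ μO) ((i O ⊠ μO) ⨾ μO)
  | eta_mu : Eqn ((ηO ⊠ i O) ⨾ μO) (i O)
  | mu_eta : Eqn ((i O ⊠ ηO) ⨾ μO) (i O)
  | mu_gamma_left : Eqn ((μO ⊠ i O) ⨾ γO) ((i O ⊠ γO) ⨾ (γO ⊠ i O) ⨾ (i O ⊠ μO))
  | mu_gamma_right : Eqn ((i O ⊠ μO) ⨾ γO) ((γO ⊠ i O) ⨾ (i O ⊠ γO) ⨾ (μO ⊠ i O))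
  | eta_gamma_left : Eqn ((ηO ⊠ i O) ⨾ γO) (i O ⊠ ηO)
  | eta_gamma_right : Eqn ((i O ⊠ ηO) ⨾ γO) (ηO ⊠ i O)
  | mu_comm : Eqn (γO ⨾ μO) μO
  -- `O` is a cocommutative comonoid
  | delta_assoc : Eqn (δO ⨾ (δO ⊠ i O)) (δO ⨾ (i O ⊠ δO))
  | delta_eps_left : Eqn (δO ⨾ (εO ⊠ i O)) (i O)
  | delta_eps_right : Eqn (δO ⨾ (i O ⊠ εO)) (i O)
  | gamma_delta_left : Eqn (γO ⨾ (δO ⊠ i O)) ((i O ⊠ δO) ⨾ (γO ⊠ i O) ⨾ (i O ⊠ γO))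
  | gamma_delta_right : Eqn (γO ⨾ (i O ⊠ δO)) ((δO ⊠ i O) ⨾ (i O ⊠ γO) ⨾ (γO ⊠ i O))
  | gamma_eps_left : Eqn (γO ⨾ (εO ⊠ i O)) (i O ⊠ εO)
  | gamma_eps_right : Eqn (γO ⨾ (i O ⊠ εO)) (εO ⊠ i O)
  | delta_comm : Eqn (δO ⨾ γO) δO
  -- `O` is a qualitative bialgebra
  | mu_delta : Eqn (μO ⨾ δO) ((δO ⊠ δO) ⨾ (i O ⊠ γO ⊠ i O) ⨾ (μO ⊠ μO))
  | eta_eps : Eqn (ηO ⨾ εO) (i [])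
  | mu_eps : Eqn (μO ⨾ εO) (εO ⊠ εO)
  | eta_delta : Eqn (ηO ⨾ δO) (ηO ⊠ ηO)
  | delta_mu : Eqn (δO ⨾ μO) (i O)
  -- `P` is left dual to `O`
  | zigzag_P : Eqn ((i P ⊠ ηOP) ⨾ (εOP ⊠ i P)) (i P)
  | zigzag_O : Eqn ((ηOP ⊠ i O) ⨾ (i O ⊠ εOP)) (i O)
  -- the Proponent structure is dual to the Opponent structure
  | mu_P : Eqn μP ((i P ⊠ i P ⊠ ηOP) ⨾ (i P ⊠ i P ⊠ δO ⊠ i P) ⨾ (εεOP ⊠ i P))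
  | delta_P : Eqn δP ((i P ⊠ ηηOP) ⨾ (i P ⊠ μO ⊠ i P ⊠ i P) ⨾ (εOP ⊠ i P ⊠ i P))
  | eta_P : Eqn ηP (ηOP ⨾ (εO ⊠ i P))
  | eps_P : Eqn εP ((i P ⊠ ηO) ⨾ εOP)
  | gamma_P : Eqn γP
      ((i P ⊠ i P ⊠ ηηOP) ⨾ (i P ⊠ i P ⊠ γO ⊠ i P ⊠ i P) ⨾ (εεOP ⊠ i P ⊠ i P))
  | gamma_OP : Eqn γOP ((i P ⊠ i O ⊠ ηOP) ⨾ (i P ⊠ γO ⊠ i P) ⨾ (εOP ⊠ i O ⊠ i P))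

end StratGen

/-- The equational theory of strategies. -/
def stratTheory : MonoidalTheory := { stratSignature with eqn := StratGen.Eqn }

/-! ### The strategies interpreting the generators -/

/-- The game `X₁ ◁ (⋯ ◁ (Xₙ ◁ I))` associated to a type. -/
def wordGame : List Polarity → FiliformGame
  | [] => .empty
  | X :: w => (FiliformGame.single X).before (wordGame w)

/-- The position of a move in a word. -/
def position : (w : List Polarity) → (wordGame w).Moves → ℕ
  | [], m => Empty.elim m
  | _ :: _, .inl _ => 0
  | _ :: w, .inr m => position w m + 1

namespace StratGen

/-- The three symmetries. -/
def IsSymmetry (g : StratGen) : Prop := g = gammaO ∨ g = gammaP ∨ g = gammaOP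

/-- Whether a generator relates two moves, regardless of the direction: a symmetry relates the moves
of its source with the moves of its target at a different position; the other generators relate any
two moves. -/
def Linked (g : StratGen) : (wordGame g.src).Moves ⊕ (wordGame g.tgt).Moves →
    (wordGame g.src).Moves ⊕ (wordGame g.tgt).Moves → Prop
  | .inl m, .inr n => g.IsSymmetry → position _ m ≠ position _ n
  | .inr m, .inl n => g.IsSymmetry → position _ m ≠ position _ n
  | .inl _, .inl _ => ¬ g.IsSymmetry
  | .inr _, .inr _ => ¬ g.IsSymmetry

/-- The partial order of the strategy associated to a generator. -/
def StratLe (g : StratGen) (x y : (wordGame g.src).Moves ⊕ (wordGame g.tgt).Moves) : Prop :=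
  x = y ∨ (((wordGame g.src).arrow (wordGame g.tgt).toGame).pol x = .O ∧
    ((wordGame g.src).arrow (wordGame g.tgt).toGame).pol y = .P ∧ g.Linked x y)

theorem stratLe_polarized (g : StratGen) (x y) (h : g.StratLe x y) (ne : x ≠ y) :
    ((wordGame g.src).arrow (wordGame g.tgt).toGame).pol x = .O ∧
      ((wordGame g.src).arrow (wordGame g.tgt).toGame).pol y = .P :=
  h.elim (fun e => absurd e ne) (fun h => ⟨h.1, h.2.1⟩)

theorem position_injective : ∀ (w : List Polarity) (m n : (wordGame w).Moves),
    position w m = position w n → m = n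
  | [], m, _, _ => Empty.elim m
  | _ :: _, .inl _, .inl _, _ => rfl
  | _ :: _, .inl _, .inr _, h => by simp [position] at h
  | _ :: _, .inr _, .inl _, h => by simp [position] at h
  | _ :: w, .inr m, .inr n, h =>
    congrArg Sum.inr (position_injective w m n (Nat.succ.inj h))

theorem position_le : ∀ (w : List Polarity) (m n : (wordGame w).Moves),
    (wordGame w).le m n → position w m ≤ position w n
  | [], m, _, _ => Empty.elim m
  | _ :: _, .inl _, .inl _, _ => le_rfl
  | _ :: _, .inl _, .inr _, _ => Nat.zero_le _
  | _ :: _, .inr _, .inl _, h => by cases h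
  | _ :: w, .inr m, .inr n, h => by
    cases h with
    | inr h => exact Nat.succ_le_succ (position_le w m n h)

theorem position_lt : ∀ (w : List Polarity) (m : (wordGame w).Moves), position w m < w.length
  | [], m => Empty.elim m
  | _ :: _, .inl _ => Nat.succ_pos _
  | _ :: w, .inr m => Nat.succ_lt_succ (position_lt w m)

theorem getElem_position : ∀ (w : List Polarity) (m : (wordGame w).Moves),
    w[position w m]? = some ((wordGame w).pol m)
  | [], m => Empty.elim m
  | _ :: _, .inl _ => rfl
  | _ :: w, .inr m => getElem_position w m

/-- A numbering of the moves witnessing the acyclicity of the strategies interpreting the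
generators. -/
def rank : StratGen → ℕ ⊕ ℕ → ℕ
  | muO | etaO | deltaO | epsO | gammaO => Sum.elim (fun m => m + 2) (fun n => n)
  | gammaOP => Sum.elim (fun m => 2 * m) (fun n => 2 * n + 1)
  | _ => Sum.elim (fun m => m) (fun n => n + 2)

theorem stratLe_compatible (g : StratGen) :
    Compatible ((wordGame g.src).arrow (wordGame g.tgt).toGame).le g.StratLe := by
  let p : (wordGame g.src).Moves ⊕ (wordGame g.tgt).Moves → ℕ ⊕ ℕ :=
    Sum.map (position g.src) (position g.tgt)
  have hp : Function.Injective p := Sum.map_injective.2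
    ⟨fun _ _ h => position_injective _ _ _ h, fun _ _ h => position_injective _ _ _ h⟩
  have hs : g.src.length ≤ 2 := by cases g <;> decide
  have ht : g.tgt.length ≤ 2 := by cases g <;> decide
  apply compatible_of_le (fun x y => g.rank (p x) ≤ g.rank (p y))
  · exact fun _ _ _ h h' => le_trans h h'
  · intro x y h h'
    have e := le_antisymm h h'
    apply hp
    rcases x with x | x <;> rcases y with y | y
    all_goals
      first | have hx := position_lt g.src x | have hx := position_lt g.tgt x
      first | have hy := position_lt g.src y | have hy := position_lt g.tgt y
      simp only [p, Sum.map_inl, Sum.map_inr] at e ⊢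
      generalize position _ x = a at *
      generalize position _ y = b at *
      cases g <;> simp [rank] at e ⊢ <;> omega
  · rintro _ _ (⟨h⟩ | ⟨h⟩)
    · have := position_le _ _ _ h
      simp only [p, Sum.map_inl]
      cases g <;> simpa [rank] using this
    · have := position_le _ _ _ h
      simp only [p, Sum.map_inr]
      cases g <;> simpa [rank] using this
  · rintro x y (rfl | ⟨hx, hy, hl⟩)
    · exact le_rfl
    · rcases x with x | x <;> rcases y with y | y
      all_goals
        first | have hx' := position_lt g.src x | have hx' := position_lt g.tgt x
        first | have hy' := position_lt g.src y | have hy' := position_lt g.tgt y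
        first | have gx := getElem_position g.src x | have gx := getElem_position g.tgt x
        first | have gy := getElem_position g.src y | have gy := getElem_position g.tgt y
        simp only [p, Sum.map_inl, Sum.map_inr, Linked, IsSymmetry] at hl ⊢
        simp only [Sum.elim_inl, Sum.elim_inr] at hx hy
        generalize position _ x = a at *
        generalize position _ y = b at *
        generalize (wordGame _).pol x = u at *
        generalize (wordGame _).pol y = v at *
        clear ht hs hp
        cases g <;> cases u <;> cases v <;> simp [Polarity.neg] at hx hy <;>
          simp only [src, tgt, List.length_cons, List.length_nil] at hx' hy' <;> simp [rank] <;>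
          try omega
        all_goals
          interval_cases a <;> interval_cases b <;> simp [src, tgt] at gx gy hl ⊢

/-- The strategy associated to a generator. -/
def strategy (g : StratGen) : wordGame g.src ⟶ wordGame g.tgt where
  le := g.StratLe
  le_refl := fun _ => .inl rfl
  le_trans := polarized_trans (A := (wordGame g.src).arrow (wordGame g.tgt).toGame)
    (stratLe_polarized g)
  le_antisymm := polarized_antisymm (A := (wordGame g.src).arrow (wordGame g.tgt).toGame)
    (stratLe_polarized g)
  compatible := stratLe_compatible g
  polarized := stratLe_polarized g

end StratGen

/-- For a monoidal functor `F` and isomorphisms `ι X : F(X) ≅ X` for `X = O` and `X = P`, the induced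
isomorphism between `F(X₁ ⊗ ⋯ ⊗ Xₙ)` and the game `X₁ ◁ (⋯ ◁ (Xₙ ◁ I))`. -/
noncomputable def wordIso (F : stratTheory.Generated ⥤ FiliformGame) [F.Monoidal]
    (ι : ∀ X : Polarity, F.obj ⟨[X]⟩ ≅ FiliformGame.single X) :
    ∀ w : List Polarity, F.obj ⟨w⟩ ≅ wordGame w
  | [] => (Functor.Monoidal.εIso F).symm
  | X :: w => (Functor.Monoidal.μIso F ⟨[X]⟩ ⟨w⟩).symm ≪≫ (ι X ⊗ᵢ wordIso F ι w)

end FOC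

open FOC

/-!
The interpretation of formal morphisms as strategies is a monoidal functor, which is shown to be
faithful, full and essentially surjective.

Games enter through two facts. Finite filiform games are rigid (`copycat_eq`), so that all diagrams of
structural isomorphisms commute; this settles the coherence conditions. Every such game is, up to
isomorphism, a word of polarities (`exists_wordGame_iso`), and a strategy between words is determined
by its edges (`edge`), a relation between the positions of the moves, counted from the end, which is
easily followed through composition and tensor product. The equations of the theory hold because the
edges of both sides can be computed (`interp_eqn`, `edge_of_cong`).

Completeness rests on normal forms, which are studied in an arbitrary strict monoidal category with a
bicommutative qualitative bialgebra `o` and a left dual `p` (`DualBialgebra`). The bialgebra gives a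
calculus of Boolean matrices: `wiring R` sums, in each of its outputs, the inputs selected by `R`, and
matrices are multiplied by composition (`wiring_comp`). Given a relation `R` from the Opponent moves
to the Proponent moves of `A ⊸ B`, a morphism can be built by adding the moves one by one, from the
end of both words, while keeping a wire for each Proponent move already added, to which the Opponent
moves below it are connected when they are added (`Rep`). Such a schedule exists exactly because `R`
and the orders of `A` and `B` generate an acyclic relation (`Acyclic.exists_rep`), and the morphism
does not depend on the schedule (`Rep.unique`). Discarding the remaining wires gives the normal form
of `R` (`Normal`).

Normal forms are closed under composition: the acyclicity which makes the composition of strategies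
well behaved also allows the moves of three words to be added one by one to two composable schedules
and to that of the composite simultaneously, the wires of the former being a function, by
reachability, of those of the latter (`exists_rep_comp`). They are closed under tensor products
(`exists_rep_tensor`), and contain the generators. Hence every formal morphism is the normal form of
the strategy which it denotes (`normal_value`), and the functor is faithful (`cong_of_interp_eq`).

For fullness, the normal form of a strategy is a formal morphism; it remains to see that it denotes
this strategy, that is, that two strategies with the same normal form are equal. Composing with
`drop` and `restore`, which consist of identities, units and counits, forgets all the moves but two,
and there soundness separates the strategy with an edge from the strategy without edges
(`edge_of_normal`, `exists_interp_eq`).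
-/

namespace FOC

/-! ### Rigidity of filiform games -/

/-- Filiform games are rigid: two isomorphisms between the same games are equal. -/
theorem GameIso.equiv_eq {A B : FiliformGame} (e f : GameIso A B) (m : A.Moves) :
    e.equiv m = f.equiv m := by
  have := A.finite
  have := B.finite
  let _ : LinearOrder A.Moves :=
    { le := A.le, le_refl := A.le_refl, le_trans := A.le_trans, le_antisymm := A.le_antisymm,
      le_total := A.le_total, toDecidableLE := Classical.decRel _ }
  let _ : LinearOrder B.Moves :=
    { le := B.le, le_refl := B.le_refl, le_trans := B.le_trans, le_antisymm := B.le_antisymm,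
      le_total := B.le_total, toDecidableLE := Classical.decRel _ }
  let e' : A.Moves ≃o B.Moves := ⟨e.equiv, fun {a b} => e.le_iff a b⟩
  let f' : A.Moves ≃o B.Moves := ⟨f.equiv, fun {a b} => f.le_iff a b⟩
  exact congrArg (fun g : A.Moves ≃o B.Moves => g m) (Subsingleton.elim e' f')

/-- By rigidity, the copycat strategy of an isomorphism of games depends on the two games only; this
is what makes all the diagrams of structural isomorphisms commute. -/
theorem copycat_eq {A B : FiliformGame} (e f : GameIso A B) :
    Strategy.copycat e = Strategy.copycat f :=
  copycat_congr (e.equiv_eq f)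

/-! ### Words of moves -/

/-- The isomorphism between the juxtaposition of two word games and the game of the concatenated
word. -/
def appendIso : ∀ A B : List Polarity,
    GameIso ((wordGame A).before (wordGame B)) (wordGame (A ++ B))
  | [], B => .leftUnit (wordGame B)
  | X :: A, B => (GameIso.assoc (.single X) (wordGame A) (wordGame B)).trans
      ((GameIso.refl (.single X)).before (appendIso A B))

/-- The position of a move in a word, counted from the end, so that the moves of a suffix of a word
have the same positions in the suffix and in the word. -/
def idx : (w : List Polarity) → (wordGame w).Moves → ℕ
  | [], m => Empty.elim m
  | _ :: w, .inl _ => w.length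
  | _ :: w, .inr m => idx w m

theorem idx_lt : ∀ (w : List Polarity) (m : (wordGame w).Moves), idx w m < w.length
  | [], m => Empty.elim m
  | _ :: _, .inl _ => Nat.lt_succ_self _
  | _ :: w, .inr m => (idx_lt w m).trans (Nat.lt_succ_self _)

theorem idx_injective : ∀ w : List Polarity, Function.Injective (idx w)
  | [], m, _, _ => Empty.elim m
  | _ :: _, .inl _, .inl _, _ => rfl
  | _ :: w, .inl _, .inr m, h => absurd h.symm (idx_lt w m).ne
  | _ :: w, .inr m, .inl _, h => absurd h (idx_lt w m).ne
  | _ :: w, .inr _, .inr _, h => congrArg Sum.inr (idx_injective w h)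

theorem idx_appendIso_inl : ∀ (A B : List Polarity) (m : (wordGame A).Moves),
    idx (A ++ B) ((appendIso A B).equiv (.inl m)) = idx A m + B.length
  | [], _, m => Empty.elim m
  | _ :: A, B, .inl _ => List.length_append (as := A) (bs := B)
  | _ :: A, B, .inr m => idx_appendIso_inl A B m

theorem idx_appendIso_inr : ∀ (A B : List Polarity) (m : (wordGame B).Moves),
    idx (A ++ B) ((appendIso A B).equiv (.inr m)) = idx B m
  | [], _, _ => rfl
  | _ :: A, B, m => idx_appendIso_inr A B m

/-- The word `w` has a move of polarity `X` at position `i`, counted from the end. -/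
def At : List Polarity → Polarity → ℕ → Prop
  | [], _, _ => False
  | Y :: w, X, i => (i = w.length ∧ Y = X) ∨ At w X i

theorem at_iff : ∀ (w : List Polarity) (X : Polarity) (i : ℕ),
    At w X i ↔ ∃ m, idx w m = i ∧ (wordGame w).pol m = X
  | [], _, _ => ⟨False.elim, fun ⟨m, _⟩ => Empty.elim m⟩
  | Y :: w, X, i => by
    rw [At, at_iff w X i]
    constructor
    · rintro (⟨rfl, rfl⟩ | ⟨m, rfl, rfl⟩)
      · exact ⟨.inl (), rfl, rfl⟩
      · exact ⟨.inr m, rfl, rfl⟩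
    · rintro ⟨m | m, rfl, rfl⟩
      · exact .inl ⟨rfl, rfl⟩
      · exact .inr ⟨m, rfl, rfl⟩

theorem At.lt : ∀ {w : List Polarity} {X : Polarity} {i : ℕ}, At w X i → i < w.length
  | _ :: _, _, _, .inl ⟨h, _⟩ => h ▸ Nat.lt_succ_self _
  | _ :: _, _, _, .inr h => h.lt.trans (Nat.lt_succ_self _)

theorem At.unique : ∀ {w : List Polarity} {X Y : Polarity} {i : ℕ}, At w X i → At w Y i → X = Y
  | _ :: _, _, _, _, .inl ⟨_, h⟩, .inl ⟨_, h'⟩ => h ▸ h'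
  | _ :: _, _, _, _, .inl ⟨h, _⟩, .inr h' => absurd h h'.lt.ne
  | _ :: _, _, _, _, .inr h', .inl ⟨h, _⟩ => absurd h h'.lt.ne
  | _ :: _, _, _, _, .inr h, .inr h' => h.unique h'

/-! ### The edges of a strategy between words -/

/-- Moves of `A ⊸ B`, for words `A` and `B`, seen as numbers. -/
abbrev Lab : Type := ℕ ⊕ ℕ

/-- Moves of `A`, `B` and `C`, for words `A`, `B` and `C`, seen as numbers. -/
abbrev Lab₃ : Type := ℕ ⊕ (ℕ ⊕ ℕ)

/-- The inclusion of the moves of `A` and `B`. -/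
def inAB : Lab → Lab₃ := Sum.map id Sum.inl

/-- The inclusion of the moves of `B` and `C`. -/
def inBC : Lab → Lab₃ := Sum.inr

/-- The inclusion of the moves of `A` and `C`. -/
def inAC : Lab → Lab₃ := Sum.map id Sum.inr

/-- The union of two relations, one on the moves of `A` and `B`, the other on those of
`B` and `C`. -/
def Join (R S : Lab → Lab → Prop) (u v : Lab₃) : Prop :=
  (∃ x y, R x y ∧ inAB x = u ∧ inAB y = v) ∨ ∃ x y, S x y ∧ inBC x = u ∧ inBC y = v

/-- The juxtaposition of two relations, the moves of the second one coming after those of the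
first one; `c` and `d` are the numbers of moves of the second one. -/
def Juxt (R S : Lab → Lab → Prop) (c d : ℕ) (x y : Lab) : Prop :=
  (∃ x' y', R x' y' ∧ Sum.map (· + c) (· + d) x' = x ∧ Sum.map (· + c) (· + d) y' = y) ∨ S x y

/-- The number of a move. -/
def lab {A B : List Polarity} : (wordGame A).Moves ⊕ (wordGame B).Moves → Lab :=
  Sum.map (idx A) (idx B)

theorem lab_injective {A B : List Polarity} : Function.Injective (lab (A := A) (B := B)) :=
  Sum.map_injective.2 ⟨idx_injective A, idx_injective B⟩

/-- The strategies between two word games. -/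
abbrev WordStrategy (A B : List Polarity) : Type :=
  Strategy ((wordGame A).arrow (wordGame B).toGame)

/-- The strict order of a strategy between word games, as a relation between numbers. -/
def edge {A B : List Polarity} (σ : WordStrategy A B) (x y : Lab) : Prop :=
  ∃ m n, σ.le m n ∧ m ≠ n ∧ lab m = x ∧ lab n = y

theorem edge_lab {A B : List Polarity} (σ : WordStrategy A B)
    (m n : (wordGame A).Moves ⊕ (wordGame B).Moves) :
    edge σ (lab m) (lab n) ↔ σ.le m n ∧ m ≠ n := by
  constructor
  · rintro ⟨m', n', h, ne, hm, hn⟩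
    cases lab_injective hm
    cases lab_injective hn
    exact ⟨h, ne⟩
  · rintro ⟨h, ne⟩
    exact ⟨m, n, h, ne, rfl, rfl⟩

/-- A strategy between word games is determined by its edges. -/
theorem eq_of_edge {A B : List Polarity} {σ τ : WordStrategy A B}
    (h : ∀ x y, edge σ x y ↔ edge τ x y) : σ = τ := by
  apply Strategy.ext_le
  intro m n
  by_cases e : m = n
  · rw [e]
    exact ⟨fun _ => τ.le_refl _, fun _ => σ.le_refl _⟩
  · have := h (lab m) (lab n)
    rw [edge_lab, edge_lab] at this
    simpa [e] using this

/-- The numbers of the Opponent moves of `A ⊸ B`, where the edges of strategies start. -/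
def Producer (A B : List Polarity) : Lab → Prop := Sum.elim (At A .P) (At B .O)

/-- The numbers of the Proponent moves of `A ⊸ B`, where the edges of strategies end. -/
def Consumer (A B : List Polarity) : Lab → Prop := Sum.elim (At A .O) (At B .P)

theorem producer_lab {A B : List Polarity} (m : (wordGame A).Moves ⊕ (wordGame B).Moves) :
    Producer A B (lab m) ↔ ((wordGame A).arrow (wordGame B).toGame).pol m = .O := by
  rcases m with m | m
  · change At A .P (idx A m) ↔ ((wordGame A).pol m).neg = .O
    rw [at_iff]
    constructor
    · rintro ⟨m', h, h'⟩
      rw [← idx_injective A h, h']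
      rfl
    · intro h
      refine ⟨m, rfl, ?_⟩
      cases h' : (wordGame A).pol m <;> simp_all [Polarity.neg]
  · change At B .O (idx B m) ↔ (wordGame B).pol m = .O
    rw [at_iff]
    constructor
    · rintro ⟨m', h, h'⟩
      rw [← idx_injective B h, h']
    · intro h
      exact ⟨m, rfl, h⟩

theorem consumer_lab {A B : List Polarity} (m : (wordGame A).Moves ⊕ (wordGame B).Moves) :
    Consumer A B (lab m) ↔ ((wordGame A).arrow (wordGame B).toGame).pol m = .P := by
  rcases m with m | m
  · change At A .O (idx A m) ↔ ((wordGame A).pol m).neg = .P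
    rw [at_iff]
    constructor
    · rintro ⟨m', h, h'⟩
      rw [← idx_injective A h, h']
      rfl
    · intro h
      refine ⟨m, rfl, ?_⟩
      cases h' : (wordGame A).pol m <;> simp_all [Polarity.neg]
  · change At B .P (idx B m) ↔ (wordGame B).pol m = .P
    rw [at_iff]
    constructor
    · rintro ⟨m', h, h'⟩
      rw [← idx_injective B h, h']
    · intro h
      exact ⟨m, rfl, h⟩

theorem edge_producer {A B : List Polarity} {σ : WordStrategy A B} {x y : Lab} (h : edge σ x y) :
    Producer A B x := by
  obtain ⟨m, n, h, ne, rfl, rfl⟩ := h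
  exact (producer_lab m).2 (σ.polarized _ _ h ne).1

theorem edge_consumer {A B : List Polarity} {σ : WordStrategy A B} {x y : Lab} (h : edge σ x y) :
    Consumer A B y := by
  obtain ⟨m, n, h, ne, rfl, rfl⟩ := h
  exact (consumer_lab n).2 (σ.polarized _ _ h ne).2

/-- The number of a move of `A`, `B` or `C`. -/
def lab₃ {A B C : List Polarity} :
    (wordGame A).Moves ⊕ ((wordGame B).Moves ⊕ (wordGame C).Moves) → Lab₃ :=
  Sum.map (idx A) (Sum.map (idx B) (idx C))

theorem lab₃_injective {A B C : List Polarity} :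
    Function.Injective (lab₃ (A := A) (B := B) (C := C)) :=
  Sum.map_injective.2 ⟨idx_injective A, Sum.map_injective.2 ⟨idx_injective B, idx_injective C⟩⟩

theorem lab₃_inAB {A B C : List Polarity} (x : (wordGame A).Moves ⊕ (wordGame B).Moves) :
    lab₃ (C := C) (Sum.map id Sum.inl x) = inAB (lab x) := by
  rcases x with x | x <;> rfl

theorem lab₃_inAC {A B C : List Polarity} (x : (wordGame A).Moves ⊕ (wordGame C).Moves) :
    lab₃ (B := B) (Sum.map id Sum.inr x) = inAC (lab x) := by
  rcases x with x | x <;> rfl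

/-- The relation generated by two composable strategies, on the numbers of the moves, is the image
of the strict part of the one on moves. -/
theorem join_edge {A B C : List Polarity} (σ : WordStrategy A B) (τ : WordStrategy B C) :
    Join (edge σ) (edge τ) =
      Relation.Map (fun u v => CompStep σ τ u v ∧ u ≠ v) lab₃ lab₃ := by
  have inj : Function.Injective (Sum.map id Sum.inl : (wordGame A).Moves ⊕ (wordGame B).Moves →
      (wordGame A).Moves ⊕ ((wordGame B).Moves ⊕ (wordGame C).Moves)) :=
    Sum.map_injective.2 ⟨Function.injective_id, Sum.inl_injective⟩
  ext u v
  constructor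
  · rintro (⟨_, _, ⟨m, n, h, ne, rfl, rfl⟩, rfl, rfl⟩ | ⟨_, _, ⟨m, n, h, ne, rfl, rfl⟩, rfl, rfl⟩)
    · exact ⟨_, _, ⟨.left m n h, inj.ne ne⟩, lab₃_inAB m, lab₃_inAB n⟩
    · exact ⟨_, _, ⟨.right m n h, Sum.inr_injective.ne ne⟩, rfl, rfl⟩
  · rintro ⟨_, _, ⟨h, ne⟩, rfl, rfl⟩
    cases h with
    | left x y h =>
      exact .inl ⟨_, _, ⟨x, y, h, fun e => ne (by rw [e]), rfl, rfl⟩, (lab₃_inAB x).symm,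
        (lab₃_inAB y).symm⟩
    | right x y h => exact .inr ⟨_, _, ⟨x, y, h, fun e => ne (by rw [e]), rfl, rfl⟩, rfl, rfl⟩

/-- Between distinct points, the transitive closure of a relation is that of its strict part. -/
theorem transGen_ne {X : Type} {r : X → X → Prop} {x y : X} (h : Relation.TransGen r x y)
    (e : x ≠ y) : Relation.TransGen (fun u v => r u v ∧ u ≠ v) x y := by
  have : Relation.ReflTransGen (fun u v => r u v ∧ u ≠ v) x y := by
    clear e
    induction h with
    | @single b h =>
      by_cases e : x = b
      · rw [e]
      · exact .single ⟨h, e⟩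
    | @tail b c _ h ih =>
      by_cases e : b = c
      · rwa [← e]
      · exact ih.tail ⟨h, e⟩
  exact (Relation.reflTransGen_iff_eq_or_transGen.1 this).resolve_left (Ne.symm e)

/-- Composition on edges: two moves are related by the composite when a nonempty path of edges of the
two strategies leads from the first one to the second one. -/
theorem edge_comp {A B C : List Polarity} (σ : WordStrategy A B) (τ : WordStrategy B C)
    (x y : Lab) : edge (σ.comp τ) x y ↔
      Relation.TransGen (Join (edge σ) (edge τ)) (inAC x) (inAC y) := by
  rw [join_edge]
  constructor
  · rintro ⟨m, n, h, ne, rfl, rfl⟩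
    have h := transGen_ne (show Relation.TransGen _ _ _ from h) (sum_map_inr_injective.ne ne)
    rw [← lab₃_inAC, ← lab₃_inAC]
    exact Relation.TransGen.lift lab₃ (fun u v h => ⟨u, v, h, rfl, rfl⟩) _ _ h
  · intro h
    obtain ⟨u, v, hu, hv, h'⟩ := transGen_map _ lab₃_injective _ _ _ h
    have lift : ∀ (u : (wordGame A).Moves ⊕ ((wordGame B).Moves ⊕ (wordGame C).Moves)) x,
        lab₃ u = inAC x → ∃ m, u = Sum.map id Sum.inr m ∧ lab m = x := by
      rintro (u | u | u) (x | x) e <;> cases e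
      · exact ⟨.inl u, rfl, rfl⟩
      · exact ⟨.inr u, rfl, rfl⟩
    obtain ⟨m, rfl, rfl⟩ := lift _ _ hu
    obtain ⟨n, rfl, rfl⟩ := lift _ _ hv
    refine ⟨m, n, Relation.TransGen.mono (fun _ _ h => h.1) _ _ h', ?_, rfl, rfl⟩
    rintro rfl
    -- a nontrivial cycle would contradict the antisymmetry of the amalgamated order
    have key : ∀ {u v}, Relation.TransGen (fun u v => CompStep σ τ u v ∧ u ≠ v) u v →
        Amalgam σ τ u v := by
      intro u v h
      induction h with
      | single h => exact amalgam_of_compStep _ _ _ _ h.1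
      | tail _ h ih => exact amalgam_trans _ _ _ _ _ ih (amalgam_of_compStep _ _ _ _ h.1)
    rcases (Relation.TransGen.head'_iff.1 h') with ⟨w, hw, hr⟩
    rcases Relation.reflTransGen_iff_eq_or_transGen.1 hr with e | hr
    · exact hw.2 e
    · exact hw.2 (amalgam_antisymm _ _ _ _ (amalgam_of_compStep _ _ _ _ hw.1) (key hr))

/-- The tensor product of two strategies between words, as a strategy between the concatenated
words. -/
def wordTensor {A B C D : List Polarity} (σ : WordStrategy A B) (τ : WordStrategy C D) :
    WordStrategy (A ++ C) (B ++ D) :=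
  (Strategy.copycat (appendIso A C).symm).comp
    ((σ.tensor τ).comp (Strategy.copycat (appendIso B D)))

/-- Tensor product on edges: with positions counted from the end, the right factor keeps its labels
and those of the left factor are shifted. -/
theorem edge_wordTensor {A B C D : List Polarity} (σ : WordStrategy A B) (τ : WordStrategy C D)
    (x y : Lab) : edge (wordTensor σ τ) x y ↔ Juxt (edge σ) (edge τ) C.length D.length x y := by
  -- every move of the concatenated words is the image by `φ` of a move of one of the four words
  let φ : ((wordGame A).Moves ⊕ (wordGame C).Moves) ⊕ ((wordGame B).Moves ⊕ (wordGame D).Moves) →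
      (wordGame (A ++ C)).Moves ⊕ (wordGame (B ++ D)).Moves :=
    Sum.map (appendIso A C).equiv (appendIso B D).equiv
  have hφ : Function.Injective φ :=
    Sum.map_injective.2 ⟨(appendIso A C).equiv.injective, (appendIso B D).equiv.injective⟩
  have hs : Function.Surjective φ :=
    Sum.map_surjective.2 ⟨(appendIso A C).equiv.surjective, (appendIso B D).equiv.surjective⟩
  have le : ∀ u v, (wordTensor σ τ).le (φ u) (φ v) ↔ TensorLe σ τ u v := by
    intro u v
    unfold wordTensor
    rw [copycat_comp_le, comp_copycat_le]
    change TensorLe σ τ _ _ ↔ _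
    have : ∀ u, Sum.map id (appendIso B D).equiv.symm (Sum.map (appendIso A C).symm.equiv id (φ u))
        = u := by
      rintro (u | u) <;> simp [φ, GameIso.symm]
    rw [this, this]
  have l1 : ∀ z, lab (φ (shuffle (.inl z))) = Sum.map (· + C.length) (· + D.length) (lab z) := by
    rintro (z | z)
    · exact congrArg Sum.inl (idx_appendIso_inl _ _ _)
    · exact congrArg Sum.inr (idx_appendIso_inl _ _ _)
  have l2 : ∀ z, lab (φ (shuffle (.inr z))) = lab z := by
    rintro (z | z)
    · exact congrArg Sum.inl (idx_appendIso_inr _ _ _)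
    · exact congrArg Sum.inr (idx_appendIso_inr _ _ _)
  constructor
  · rintro ⟨m, n, h, ne, rfl, rfl⟩
    obtain ⟨u, rfl⟩ := hs m
    obtain ⟨v, rfl⟩ := hs n
    rw [le] at h
    have ne := hφ.ne_iff.1 ne
    obtain ⟨u, rfl⟩ : ∃ u', u = shuffle u' := ⟨_, (shuffle_shuffle u).symm⟩
    obtain ⟨v, rfl⟩ : ∃ u', v = shuffle u' := ⟨_, (shuffle_shuffle v).symm⟩
    unfold TensorLe at h
    rw [shuffle_shuffle, shuffle_shuffle] at h
    cases h with
    | inl h => exact .inl ⟨_, _, ⟨_, _, h, fun e => ne (by rw [e]), rfl, rfl⟩, (l1 _).symm, (l1 _).symm⟩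
    | inr h => exact .inr ⟨_, _, h, fun e => ne (by rw [e]), (l2 _).symm, (l2 _).symm⟩
  · rintro (⟨_, _, ⟨m, n, h, ne, rfl, rfl⟩, rfl, rfl⟩ | ⟨m, n, h, ne, rfl, rfl⟩)
    · refine ⟨φ (shuffle (.inl m)), φ (shuffle (.inl n)), (le _ _).2 ?_, ?_, l1 _, l1 _⟩
      · unfold TensorLe
        rw [shuffle_shuffle, shuffle_shuffle]
        exact .inl h
      · exact hφ.ne (shuffle_injective.ne (Sum.inl_injective.ne ne))
    · refine ⟨φ (shuffle (.inr m)), φ (shuffle (.inr n)), (le _ _).2 ?_, ?_, l2 _, l2 _⟩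
      · unfold TensorLe
        rw [shuffle_shuffle, shuffle_shuffle]
        exact .inr h
      · exact hφ.ne (shuffle_injective.ne (Sum.inr_injective.ne ne))

/-- The edges of an identity, as a relation between numbers. -/
def Copy (A : List Polarity) (x y : Lab) : Prop :=
  ∃ i, (At A .P i ∧ x = .inl i ∧ y = .inr i) ∨ (At A .O i ∧ x = .inr i ∧ y = .inl i)

theorem edge_copycat {A : List Polarity} (e : GameIso (wordGame A) (wordGame A)) (x y : Lab) :
    edge (Strategy.copycat e) x y ↔ Copy A x y := by
  rw [copycat_eq e (.refl _)]
  constructor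
  · rintro ⟨m, n, h, ne, rfl, rfl⟩
    cases h with
    | refl => exact absurd rfl ne
    | leftRight m h => exact ⟨idx A m, .inl ⟨(at_iff _ _ _).2 ⟨m, rfl, h⟩, rfl, rfl⟩⟩
    | rightLeft m h => exact ⟨idx A m, .inr ⟨(at_iff _ _ _).2 ⟨m, rfl, h⟩, rfl, rfl⟩⟩
  · rintro ⟨i, ⟨h, rfl, rfl⟩ | ⟨h, rfl, rfl⟩⟩
    · obtain ⟨m, rfl, h'⟩ := (at_iff _ _ _).1 h
      exact ⟨.inl m, .inr m, .leftRight (e := .refl _) m h', by simp, rfl, rfl⟩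
    · obtain ⟨m, rfl, h'⟩ := (at_iff _ _ _).1 h
      exact ⟨.inr m, .inl m, .rightLeft (e := .refl _) m h', by simp, rfl, rfl⟩

/-! ### The interpretation of formal morphisms -/

/-- The strategy denoted by a formal morphism. -/
def interp {A B : List Polarity} : stratSignature.Expr A B → WordStrategy A B
  | .gen g => g.strategy
  | .id A => Strategy.copycat (.refl (wordGame A))
  | .comp f g => (interp f).comp (interp g)
  | .tensor f g => wordTensor (interp f) (interp g)

end FOC

namespace FOC

/-! ### Computation of strategies -/

/-- The edges of the strategies interpreting the generators, with positions counted from the end. -/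
def genEdges : StratGen → List (Lab × Lab)
  | .muO => [(.inr 0, .inl 1), (.inr 0, .inl 0)]
  | .deltaO => [(.inr 1, .inl 0), (.inr 0, .inl 0)]
  | .gammaO => [(.inr 1, .inl 0), (.inr 0, .inl 1)]
  | .muP => [(.inl 1, .inr 0), (.inl 0, .inr 0)]
  | .deltaP => [(.inl 0, .inr 1), (.inl 0, .inr 0)]
  | .gammaP => [(.inl 1, .inr 0), (.inl 0, .inr 1)]
  | .etaOP => [(.inr 1, .inr 0)]
  | .epsOP => [(.inl 1, .inl 0)]
  | .gammaOP => [(.inl 1, .inr 0), (.inr 1, .inl 0)]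
  | .etaO | .epsO | .etaP | .epsP => []

instance (p : Lab × Lab) (l : List (Lab × Lab)) : Decidable (p ∈ l) :=
  @List.instDecidableMemOfLawfulBEq _ instBEqOfDecidableEq _ p l

theorem position_add_idx : ∀ (w : List Polarity) (m : (wordGame w).Moves),
    position w m + idx w m + 1 = w.length
  | [], m => Empty.elim m
  | _ :: w, .inl _ => congrArg (· + 1) (Nat.zero_add w.length)
  | _ :: w, .inr m => by
    rw [List.length_cons, ← position_add_idx w m]
    simp only [position, idx]
    omega

/-- The relation `StratGen.Linked` on the numbers of the moves. Counting the positions from the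
end makes no difference, since both sides of a symmetry have the same length. -/
def LinkedLab (g : StratGen) : Lab → Lab → Prop
  | .inl i, .inr j => g.IsSymmetry → i ≠ j
  | .inr i, .inl j => g.IsSymmetry → i ≠ j
  | .inl _, .inl _ => ¬ g.IsSymmetry
  | .inr _, .inr _ => ¬ g.IsSymmetry

theorem linkedLab_iff (g : StratGen) (m n : (wordGame g.src).Moves ⊕ (wordGame g.tgt).Moves) :
    LinkedLab g (lab m) (lab n) ↔ g.Linked m n := by
  have len : g.IsSymmetry → g.src.length = g.tgt.length := by
    rintro (rfl | rfl | rfl) <;> rfl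
  rcases m with m | m <;> rcases n with n | n
  · exact Iff.rfl
  · have h1 := position_add_idx _ m
    have h2 := position_add_idx _ n
    refine forall_congr' fun h => ?_
    have := len h
    change ¬ idx _ m = idx _ n ↔ ¬ position _ m = position _ n
    omega
  · have h1 := position_add_idx _ m
    have h2 := position_add_idx _ n
    refine forall_congr' fun h => ?_
    have := len h
    change ¬ idx _ m = idx _ n ↔ ¬ position _ m = position _ n
    omega
  · exact Iff.rfl

theorem edge_strategy (g : StratGen) (x y : Lab) :
    edge (A := g.src) (B := g.tgt) g.strategy x y ↔ (x, y) ∈ genEdges g := by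
  have h1 : edge (A := g.src) (B := g.tgt) g.strategy x y ↔
      Producer g.src g.tgt x ∧ Consumer g.src g.tgt y ∧ LinkedLab g x y := by
    constructor
    · rintro ⟨m, n, h, ne, rfl, rfl⟩
      obtain ⟨hm, hn, h⟩ := (show g.StratLe m n from h).resolve_left ne
      exact ⟨(producer_lab m).2 hm, (consumer_lab n).2 hn, (linkedLab_iff g m n).2 h⟩
    · rintro ⟨hx, hy, h⟩
      obtain ⟨m, rfl⟩ : ∃ m : (wordGame g.src).Moves ⊕ (wordGame g.tgt).Moves, lab m = x := by
        rcases x with x | x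
        · obtain ⟨m, rfl, _⟩ := (at_iff _ _ _).1 hx
          exact ⟨.inl m, rfl⟩
        · obtain ⟨m, rfl, _⟩ := (at_iff _ _ _).1 hx
          exact ⟨.inr m, rfl⟩
      obtain ⟨n, rfl⟩ : ∃ m : (wordGame g.src).Moves ⊕ (wordGame g.tgt).Moves, lab m = y := by
        rcases y with x | x
        · obtain ⟨m, rfl, _⟩ := (at_iff _ _ _).1 hy
          exact ⟨.inl m, rfl⟩
        · obtain ⟨m, rfl, _⟩ := (at_iff _ _ _).1 hy
          exact ⟨.inr m, rfl⟩
      rw [producer_lab] at hx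
      rw [consumer_lab] at hy
      refine ⟨m, n, .inr ⟨hx, hy, (linkedLab_iff g m n).1 h⟩, ?_, rfl, rfl⟩
      rintro rfl
      cases hx.symm.trans hy
  rw [h1]
  rcases x with x | x <;> rcases y with y | y <;> cases g <;>
    simp [Producer, Consumer, LinkedLab, At, StratGen.IsSymmetry, StratGen.src, StratGen.tgt,
      genEdges] <;> omega

/-- One step of transitive closure of a finite relation. -/
def tcStep {X : Type} [DecidableEq X] (l : List (X × X)) : List (X × X) :=
  l.foldr (fun p acc => (l.filterMap fun q => if p.2 = q.1 then some (p.1, q.2) else none).foldr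
    List.insert acc) l

/-- Whether a finite relation is transitive. -/
def tcClosed {X : Type} [DecidableEq X] (l : List (X × X)) : Bool :=
  l.all fun p => l.all fun q => decide (p.2 = q.1 → (p.1, q.2) ∈ l)

theorem mem_tcStep {X : Type} [DecidableEq X] (l : List (X × X)) (r : X × X) :
    r ∈ tcStep l ↔ r ∈ l ∨ ∃ p ∈ l, ∃ q ∈ l, p.2 = q.1 ∧ r = (p.1, q.2) := by
  have ins : ∀ (k acc : List (X × X)), r ∈ k.foldr List.insert acc ↔ r ∈ k ∨ r ∈ acc := by
    intro k acc
    induction k with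
    | nil => simp
    | cons a k ih => simp [ih, or_assoc]
  unfold tcStep
  have : ∀ k : List (X × X), r ∈ k.foldr (fun p acc => (l.filterMap fun q =>
      if p.2 = q.1 then some (p.1, q.2) else none).foldr List.insert acc) l ↔
      r ∈ l ∨ ∃ p ∈ k, ∃ q ∈ l, p.2 = q.1 ∧ r = (p.1, q.2) := by
    intro k
    induction k with
    | nil => simp
    | cons a k ih =>
      rw [List.foldr_cons, ins, ih]
      simp only [List.mem_filterMap, List.mem_cons, Option.ite_none_right_eq_some, Option.some.injEq,
        exists_eq_or_imp]
      grind
  exact this l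

/-- Once the iteration of `tcStep` has reached a transitive relation, it has computed the transitive
closure. -/
theorem transGen_iff_of_tcClosed {X : Type} [DecidableEq X] (l : List (X × X)) (n : ℕ)
    (h : tcClosed (tcStep^[n] l) = true) (x y : X) :
    Relation.TransGen (fun x y => (x, y) ∈ l) x y ↔ (x, y) ∈ tcStep^[n] l := by
  have sub : ∀ n, ∀ p ∈ l, p ∈ tcStep^[n] l := by
    intro n
    induction n with
    | zero => exact fun _ h => h
    | succ n ih =>
      intro p hp
      rw [Function.iterate_succ_apply', mem_tcStep]
      exact .inl (ih p hp)
  have sup : ∀ n, ∀ p ∈ tcStep^[n] l, Relation.TransGen (fun x y => (x, y) ∈ l) p.1 p.2 := by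
    intro n
    induction n with
    | zero => exact fun _ h => .single h
    | succ n ih =>
      intro p hp
      rw [Function.iterate_succ_apply', mem_tcStep] at hp
      rcases hp with hp | ⟨q, hq, r, hr, e, rfl⟩
      · exact ih p hp
      · have h1 := ih q hq
        rw [e] at h1
        exact h1.trans (ih r hr)
  constructor
  · intro h'
    simp only [tcClosed, List.all_eq_true, decide_eq_true_eq] at h
    induction h' with
    | single h' => exact sub _ _ h'
    | tail _ h' ih => exact h _ ih _ (sub _ _ h') rfl
  · exact sup n _

/-- The edges of the union of two finite relations, before transitive closure. -/
def joinList (l k : List (Lab × Lab)) : List (Lab₃ × Lab₃) :=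
  l.map (Prod.map inAB inAB) ++ k.map (Prod.map inBC inBC)

/-- The part of a relation which concerns the moves of `A` and `C`. -/
def hide (l : List (Lab₃ × Lab₃)) : List (Lab × Lab) :=
  l.filterMap fun
    | (.inl i, .inl j) => some (.inl i, .inl j)
    | (.inl i, .inr (.inr j)) => some (.inl i, .inr j)
    | (.inr (.inr i), .inl j) => some (.inr i, .inl j)
    | (.inr (.inr i), .inr (.inr j)) => some (.inr i, .inr j)
    | _ => none

theorem mem_hide (l : List (Lab₃ × Lab₃)) (x y : Lab) :
    (x, y) ∈ hide l ↔ (inAC x, inAC y) ∈ l := by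
  unfold hide
  rw [List.mem_filterMap]
  constructor
  · rintro ⟨⟨u | u | u, v | v | v⟩, h, e⟩ <;> cases e <;> exact h
  · intro h
    rcases x with x | x <;> rcases y with y | y <;> exact ⟨_, h, rfl⟩

/-- The edges of an identity, as a list. -/
def copyEdges (A : List Polarity) : List (Lab × Lab) :=
  (List.range A.length).map fun i =>
    match A.reverse[i]? with
    | some Polarity.O => (.inr i, .inl i)
    | _ => (.inl i, .inr i)

/-- The edges of the strategy denoted by a formal morphism, computed by a fixed number of steps of
transitive closure. Four steps double the length of paths four times, which suffices for the
equations of the theory; `edgesOk` checks it. -/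
def edges {A B : List Polarity} : stratSignature.Expr A B → List (Lab × Lab)
  | .gen g => genEdges g
  | .id A => copyEdges A
  | .comp f g => hide (tcStep^[4] (joinList (edges f) (edges g)))
  | @Signature.Expr.tensor _ _ _ C D f g =>
      (edges f).map (Prod.map (Sum.map (· + C.length) (· + D.length))
        (Sum.map (· + C.length) (· + D.length))) ++ edges g

/-- Whether the computation of the edges reaches the transitive closures. -/
def edgesOk {A B : List Polarity} : stratSignature.Expr A B → Bool
  | .gen _ => true
  | .id _ => true
  | .comp f g => edgesOk f && edgesOk g && tcClosed (tcStep^[4] (joinList (edges f) (edges g)))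
  | .tensor f g => edgesOk f && edgesOk g

theorem at_iff_getElem : ∀ (A : List Polarity) (X : Polarity) (i : ℕ),
    At A X i ↔ A.reverse[i]? = some X
  | [], X, i => by simp [At]
  | Y :: A, X, i => by
    rw [At, at_iff_getElem A, List.reverse_cons, List.getElem?_append, List.length_reverse]
    split
    · rename_i h
      simp [h.ne]
    · rcases Nat.lt_trichotomy i A.length with h | h | h
      · omega
      · simp [h]
      · simp [List.getElem?_eq_none, h.ne', h.le, (by omega : 1 ≤ i - A.length)]

theorem join_congr {R R' S S' : Lab → Lab → Prop} (hR : ∀ x y, R x y ↔ R' x y)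
    (hS : ∀ x y, S x y ↔ S' x y) : Join R S = Join R' S' := by
  ext u v
  simp only [Join, hR, hS]

theorem edge_interp_comp {A B C : List Polarity} (f : stratSignature.Expr A B)
    (g : stratSignature.Expr B C) (x y : Lab) : edge (interp (f.comp g)) x y ↔
      Relation.TransGen (Join (edge (interp f)) (edge (interp g))) (inAC x) (inAC y) :=
  edge_comp (interp f) (interp g) x y

theorem edge_interp_tensor {A B C D : List Polarity} (f : stratSignature.Expr A B)
    (g : stratSignature.Expr C D) (x y : Lab) : edge (interp (f.tensor g)) x y ↔
      Juxt (edge (interp f)) (edge (interp g)) C.length D.length x y :=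
  edge_wordTensor (interp f) (interp g) x y

theorem edge_interp_id (A : List Polarity) (x y : Lab) :
    edge (interp (.id (S := stratSignature) A)) x y ↔ Copy A x y :=
  edge_copycat (.refl _) x y

theorem mem_copyEdges (A : List Polarity) (x y : Lab) : Copy A x y ↔ (x, y) ∈ copyEdges A := by
  simp only [copyEdges, List.mem_map, List.mem_range, Copy]
  constructor
  · rintro ⟨i, ⟨h, rfl, rfl⟩ | ⟨h, rfl, rfl⟩⟩
    · exact ⟨i, h.lt, by rw [(at_iff_getElem _ _ _).1 h]⟩
    · exact ⟨i, h.lt, by rw [(at_iff_getElem _ _ _).1 h]⟩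
  · rintro ⟨i, hi, e⟩
    refine ⟨i, ?_⟩
    rw [at_iff_getElem, at_iff_getElem]
    have hi' : i < A.reverse.length := by rwa [List.length_reverse]
    rw [List.getElem?_eq_getElem hi'] at e ⊢
    cases h : A.reverse[i] <;> rw [h] at e <;> cases e <;> simp

theorem mem_edges : ∀ {A B : List Polarity} (f : stratSignature.Expr A B), edgesOk f = true →
    ∀ x y : Lab, edge (interp f) x y ↔ (x, y) ∈ edges f
  | _, _, .gen g, _, x, y => edge_strategy g x y
  | _, _, .id A, _, x, y => (edge_interp_id A x y).trans (mem_copyEdges A x y)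
  | _, _, .comp f g, h, x, y => by
    simp only [edgesOk, Bool.and_eq_true] at h
    refine (edge_interp_comp f g x y).trans (Iff.trans ?_ (mem_hide _ x y).symm)
    rw [← transGen_iff_of_tcClosed _ _ h.2]
    have : Join (edge (interp f)) (edge (interp g)) =
        fun u v => (u, v) ∈ joinList (edges f) (edges g) := by
      rw [join_congr (mem_edges f h.1.1) (mem_edges g h.1.2)]
      ext u v
      simp only [Join, joinList, List.mem_append, List.mem_map, Prod.exists, Prod.map_apply,
        Prod.mk.injEq]
    rw [this]
  | _, _, @Signature.Expr.tensor _ _ _ C D f g, h, x, y => by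
    simp only [edgesOk, Bool.and_eq_true] at h
    refine (edge_interp_tensor f g x y).trans ?_
    change _ ↔ (x, y) ∈ (edges f).map (Prod.map (Sum.map (· + C.length) (· + D.length))
        (Sum.map (· + C.length) (· + D.length))) ++ edges g
    simp only [Juxt, List.mem_append, List.mem_map, Prod.exists, Prod.map_apply,
        Prod.mk.injEq, mem_edges f h.1, mem_edges g h.2]
    exact Iff.rfl

theorem interp_eq_of_edges {A B : List Polarity} (f g : stratSignature.Expr A B)
    (h : (edgesOk f && edgesOk g && (edges f).all (fun p => decide (p ∈ edges g)) &&
      (edges g).all (fun p => decide (p ∈ edges f))) = true) : interp f = interp g := by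
  simp only [Bool.and_eq_true, List.all_eq_true, decide_eq_true_eq] at h
  apply eq_of_edge
  intro x y
  rw [mem_edges f h.1.1.1, mem_edges g h.1.1.2]
  exact ⟨h.1.2 _, h.2 _⟩

/-- The equations of the theory hold in the category of games: both sides are closed formal
morphisms, whose edges are computed and compared. -/
theorem interp_eqn {A B : List Polarity} {f g : StratGen.E A B} (h : StratGen.Eqn f g) :
    interp f = interp g := by
  cases h <;> exact interp_eq_of_edges _ _ (by decide +kernel)

theorem juxt_congr {R R' S S' : Lab → Lab → Prop} (hR : ∀ x y, R x y ↔ R' x y)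
    (hS : ∀ x y, S x y ↔ S' x y) {c d : ℕ} {x y : Lab} :
    Juxt R S c d x y ↔ Juxt R' S' c d x y := by
  simp only [Juxt, hR, hS]

theorem not_copy_nil (x y : Lab) : ¬ Copy [] x y := by
  rintro ⟨i, ⟨h, _⟩ | ⟨h, _⟩⟩ <;> exact h

/-- The juxtaposition of two identities is an identity. -/
theorem copy_append (A B : List Polarity) (x y : Lab) :
    Juxt (Copy A) (Copy B) B.length B.length x y ↔ Copy (A ++ B) x y := by
  rw [← edge_copycat (.refl _), ← juxt_congr (edge_copycat (.refl _)) (edge_copycat (.refl _)),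
    ← edge_wordTensor]
  unfold wordTensor
  rw [copycat_tensor, copycat_comp_copycat, copycat_comp_copycat, edge_copycat, edge_copycat]

theorem wordTensor_comp {A B C D E F : List Polarity} (σ : WordStrategy A B)
    (σ' : WordStrategy B C) (τ : WordStrategy D E) (τ' : WordStrategy E F) :
    wordTensor (σ.comp σ') (τ.comp τ') = (wordTensor σ τ).comp (wordTensor σ' τ') := by
  unfold wordTensor
  rw [← tensor_comp]
  have := (appendIso B E).toIso.hom_inv_id_assoc
    (Strategy.comp (σ'.tensor τ') (.copycat (appendIso C F)))
  change ((Strategy.copycat (appendIso A D).symm : _ ⟶ _) ≫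
      ((σ.tensor τ : _ ⟶ _) ≫ (σ'.tensor τ' : _ ⟶ _)) ≫ (Strategy.copycat (appendIso C F) : _ ⟶ _)) =
    (((Strategy.copycat (appendIso A D).symm : _ ⟶ _) ≫ (σ.tensor τ : _ ⟶ _) ≫
      (appendIso B E).toIso.hom) ≫ (appendIso B E).toIso.inv ≫
      (σ'.tensor τ' : _ ⟶ _) ≫ (Strategy.copycat (appendIso C F) : _ ⟶ _))
  simp only [Category.assoc, Iso.hom_inv_id_assoc]

/-- Congruent formal morphisms have the same source and the same target. -/
theorem word_eq_of_cong {T : MonoidalTheory} {A B A' B' : List T.Atom} {f : T.Expr A B}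
    {g : T.Expr A' B'} (h : T.Cong f g) : A = A' ∧ B = B' := by
  induction h with
  | eqn | refl | id_comp | comp_id | assoc | id_tensor_id | interchange | unit_tensor =>
    exact ⟨rfl, rfl⟩
  | symm _ ih => exact ⟨ih.1.symm, ih.2.symm⟩
  | trans _ _ ih ih' => exact ⟨ih.1.trans ih'.1, ih.2.trans ih'.2⟩
  | comp _ _ ih ih' => exact ⟨ih.1, ih'.2⟩
  | tensor _ _ ih ih' => exact ⟨by rw [ih.1, ih'.1], by rw [ih.2, ih'.2]⟩
  | tensor_unit => exact ⟨List.append_nil _, List.append_nil _⟩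
  | tensor_assoc => exact ⟨List.append_assoc _ _ _, List.append_assoc _ _ _⟩

/-! ### Soundness of the interpretation -/

section StructuralRules

variable {A B C D E F : List Polarity}

theorem id_comp_edge (σ : WordStrategy A B) :
    (Strategy.copycat (.refl (wordGame A))).comp σ = σ :=
  Category.id_comp (X := wordGame A) (Y := wordGame B) σ

theorem comp_id_edge (σ : WordStrategy A B) :
    σ.comp (Strategy.copycat (.refl (wordGame B))) = σ :=
  Category.comp_id (X := wordGame A) (Y := wordGame B) σ

theorem assoc_edge (σ : WordStrategy A B) (τ : WordStrategy B C) (υ : WordStrategy C D) :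
    (σ.comp τ).comp υ = σ.comp (τ.comp υ) :=
  Category.assoc (W := wordGame A) (X := wordGame B) (Y := wordGame C) (Z := wordGame D) σ τ υ

theorem unit_tensor_edge (σ : WordStrategy A B) (x y : Lab) :
    edge (wordTensor (Strategy.copycat (.refl (wordGame []))) σ) x y ↔ edge σ x y := by
  rw [edge_wordTensor, juxt_congr (edge_copycat (A := []) (.refl _)) (fun _ _ => Iff.rfl)]
  simp [Juxt, not_copy_nil]

theorem tensor_unit_edge (σ : WordStrategy A B) (x y : Lab) :
    edge (wordTensor σ (Strategy.copycat (.refl (wordGame [])))) x y ↔ edge σ x y := by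
  rw [edge_wordTensor, juxt_congr (fun _ _ => Iff.rfl) (edge_copycat (A := []) (.refl _))]
  have e : ∀ z : Lab, Sum.map (· + ([] : List Polarity).length) (· + ([] : List Polarity).length) z
      = z := by
    rintro (z | z) <;> rfl
  simp only [Juxt, not_copy_nil, or_false, e]
  exact ⟨fun ⟨_, _, h, h1, h2⟩ => h1 ▸ h2 ▸ h, fun h => ⟨_, _, h, rfl, rfl⟩⟩

theorem tensor_assoc_edge (σ : WordStrategy A B) (τ : WordStrategy C D) (υ : WordStrategy E F)
    (x y : Lab) : edge (wordTensor (wordTensor σ τ) υ) x y ↔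
      edge (wordTensor σ (wordTensor τ υ)) x y := by
  rw [edge_wordTensor, edge_wordTensor, juxt_congr (edge_wordTensor σ τ) (fun _ _ => Iff.rfl),
    juxt_congr (fun _ _ => Iff.rfl) (edge_wordTensor τ υ)]
  have e : ∀ z : Lab, Sum.map (· + (C ++ E).length) (· + (D ++ F).length) z =
      Sum.map (· + E.length) (· + F.length) (Sum.map (· + C.length) (· + D.length) z) := by
    rintro (z | z) <;> simp [add_assoc]
  constructor
  · rintro (⟨_, _, ⟨u, v, h, rfl, rfl⟩ | h, rfl, rfl⟩ | h)
    · exact .inl ⟨u, v, h, e u, e v⟩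
    · exact .inr (.inl ⟨_, _, h, rfl, rfl⟩)
    · exact .inr (.inr h)
  · rintro (⟨u, v, h, rfl, rfl⟩ | ⟨u, v, h, rfl, rfl⟩ | h)
    · exact .inl ⟨_, _, .inl ⟨u, v, h, rfl, rfl⟩, (e u).symm, (e v).symm⟩
    · exact .inl ⟨_, _, .inr h, rfl, rfl⟩
    · exact .inr h

theorem id_tensor_id_edge (x y : Lab) :
    edge (wordTensor (Strategy.copycat (.refl (wordGame A))) (Strategy.copycat (.refl (wordGame B))))
      x y ↔ edge (Strategy.copycat (.refl (wordGame (A ++ B)))) x y := by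
  rw [edge_wordTensor, edge_copycat, juxt_congr (edge_copycat (.refl _)) (edge_copycat (.refl _))]
  exact copy_append A B x y

end StructuralRules

/-- Congruent formal morphisms denote strategies with the same edges. The statement in terms of
edges makes sense although the types of the formal morphisms are only propositionally equal. -/
theorem edge_of_cong {A B A' B' : List stratTheory.Atom} {f : stratTheory.Expr A B}
    {g : stratTheory.Expr A' B'} (h : stratTheory.Cong f g) (x y : Lab) :
    edge (interp f) x y ↔ edge (interp g) x y := by
  induction h generalizing x y with
  | eqn h => rw [interp_eqn h]
  | refl => exact Iff.rfl
  | symm _ ih => exact (ih x y).symm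
  | trans _ _ ih ih' => exact (ih x y).trans (ih' x y)
  | comp _ _ ih ih' =>
    refine (edge_interp_comp _ _ x y).trans (Iff.trans ?_ (edge_interp_comp _ _ x y).symm)
    rw [join_congr ih ih']
  | tensor h h' ih ih' =>
    refine (edge_interp_tensor _ _ x y).trans (Iff.trans ?_ (edge_interp_tensor _ _ x y).symm)
    obtain ⟨rfl, rfl⟩ := word_eq_of_cong h'
    exact juxt_congr ih ih'
  | id_comp f => exact iff_of_eq (congrArg (edge · x y) (id_comp_edge (interp f)))
  | comp_id f => exact iff_of_eq (congrArg (edge · x y) (comp_id_edge (interp f)))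
  | assoc f g h =>
    exact iff_of_eq (congrArg (edge · x y) (assoc_edge (interp f) (interp g) (interp h)))
  | unit_tensor f => exact unit_tensor_edge (interp f) x y
  | tensor_unit f => exact tensor_unit_edge (interp f) x y
  | tensor_assoc f g h => exact tensor_assoc_edge (interp f) (interp g) (interp h) x y
  | id_tensor_id A B => exact id_tensor_id_edge x y
  | interchange f g f' g' =>
    exact iff_of_eq (congrArg (edge · x y)
      (wordTensor_comp (interp f) (interp g) (interp f') (interp g')))

end FOC

namespace FOC

/-! ### Strict monoidal categories without objects -/

/-- A strict monoidal category described by its morphisms only: the tensor product is the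
multiplication of a monoid, objects are identified with identities (so that `src f` and `tgt f` are
identities), and the composition `f ⨟ g`, in diagrammatic order, is a total operation, which is
meaningful only when `tgt f = src g`; the axioms which are stated without such a condition hold
when non-composable morphisms are given an absorbing composite. -/
class StrictMonoidal (Q : Type) extends Monoid Q where
  src : Q → Q
  tgt : Q → Q
  comp : Q → Q → Q
  tgt_src (f : Q) : tgt (src f) = src f
  src_tgt (f : Q) : src (tgt f) = tgt f
  src_one : src 1 = 1
  src_mul (f g : Q) : src (f * g) = src f * src g
  tgt_mul (f g : Q) : tgt (f * g) = tgt f * tgt g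
  src_comp (f g : Q) (h : tgt f = src g) : src (comp f g) = src f
  tgt_comp (f g : Q) (h : tgt f = src g) : tgt (comp f g) = tgt g
  src_id_comp (f : Q) : comp (src f) f = f
  comp_tgt_id (f : Q) : comp f (tgt f) = f
  comp_assoc (f g h : Q) : comp (comp f g) h = comp f (comp g h)
  whisker_left (U f g : Q) (hU : src U = U) : U * comp f g = comp (U * f) (U * g)
  whisker_right (U f g : Q) (hU : src U = U) : comp f g * U = comp (f * U) (g * U)
  left_right (f g : Q) : comp (f * src g) (tgt f * g) = f * g
  right_left (f g : Q) : comp (src f * g) (f * tgt g) = f * g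

namespace StrictMonoidal

infixr:65 " ⨟ " => StrictMonoidal.comp

attribute [simp] tgt_src src_tgt src_one src_mul tgt_mul

variable {Q : Type} [StrictMonoidal Q]

theorem tgt_of_src {U : Q} (h : src U = U) : tgt U = U := by
  rw [← h, tgt_src]

@[simp] theorem tgt_one : tgt (1 : Q) = 1 := tgt_of_src src_one

@[simp] theorem src_src (f : Q) : src (src f) = src f := by
  rw [← tgt_src f, src_tgt]

@[simp] theorem src_pow (f : Q) (n : ℕ) : src (f ^ n) = src f ^ n := by
  induction n with
  | zero => simp
  | succ n ih => rw [pow_succ, pow_succ, src_mul, ih]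

@[simp] theorem tgt_pow (f : Q) (n : ℕ) : tgt (f ^ n) = tgt f ^ n := by
  induction n with
  | zero => simp
  | succ n ih => rw [pow_succ, pow_succ, tgt_mul, ih]

theorem id_comp {U f : Q} (h : src f = U) : U ⨟ f = f := by
  rw [← h, src_id_comp]

theorem comp_id {U f : Q} (h : tgt f = U) : f ⨟ U = f := by
  rw [← h, comp_tgt_id]

/-- Two morphisms side by side can be performed in any order. -/
theorem exchange (f g : Q) : f * src g ⨟ tgt f * g = src f * g ⨟ f * tgt g := by
  rw [left_right, right_left]

theorem interchange {f g f' g' : Q} (h : tgt f = src g) (h' : tgt f' = src g') :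
    f * f' ⨟ g * g' = (f ⨟ g) * (f' ⨟ g') := by
  calc f * f' ⨟ g * g'
      = (f * src f' ⨟ tgt f * f') ⨟ (src g * g' ⨟ g * tgt g') := by rw [left_right, right_left]
    _ = f * src f' ⨟ (src g * (f' ⨟ g') ⨟ g * tgt (f' ⨟ g')) := by
      rw [whisker_left _ _ _ (src_src g), tgt_comp _ _ h', comp_assoc, comp_assoc, h]
    _ = (f ⨟ g) * src (f' ⨟ g') ⨟ tgt (f ⨟ g) * (f' ⨟ g') := by
      rw [right_left, ← left_right g, whisker_right _ _ _ (src_src _), tgt_comp _ _ h,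
        src_comp _ _ h', comp_assoc]
    _ = (f ⨟ g) * (f' ⨟ g') := left_right _ _

end StrictMonoidal

/-! ### Bicommutative qualitative bialgebras -/

open StrictMonoidal

/-- A bicommutative qualitative bialgebra `o` in a strict monoidal category, with a left dual `p`. The
laws which follow from the others by the symmetry `gamma`, such as the right unit law of `mu`, are
omitted; `unit` and `counit` are those of the duality, `eta` and `eps` those of the bialgebra. -/
class DualBialgebra (Q : Type) extends StrictMonoidal Q where
  o : Q
  p : Q
  mu : Q
  eta : Q
  delta : Q
  eps : Q
  gamma : Q
  unit : Q
  counit : Q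
  src_o : src o = o
  src_p : src p = p
  src_mu : src mu = o * o
  tgt_mu : tgt mu = o
  src_eta : src eta = 1
  tgt_eta : tgt eta = o
  src_delta : src delta = o
  tgt_delta : tgt delta = o * o
  src_eps : src eps = o
  tgt_eps : tgt eps = 1
  src_gamma : src gamma = o * o
  tgt_gamma : tgt gamma = o * o
  src_unit : src unit = 1
  tgt_unit : tgt unit = o * p
  src_counit : src counit = p * o
  tgt_counit : tgt counit = 1
  yangBaxter : gamma * o ⨟ o * gamma ⨟ gamma * o = o * gamma ⨟ gamma * o ⨟ o * gamma
  gamma_gamma : gamma ⨟ gamma = o * o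
  mu_assoc : mu * o ⨟ mu = o * mu ⨟ mu
  eta_mu : eta * o ⨟ mu = o
  mu_gamma_left : mu * o ⨟ gamma = o * gamma ⨟ gamma * o ⨟ o * mu
  mu_gamma_right : o * mu ⨟ gamma = gamma * o ⨟ o * gamma ⨟ mu * o
  eta_gamma_right : o * eta ⨟ gamma = eta * o
  mu_comm : gamma ⨟ mu = mu
  delta_assoc : delta ⨟ delta * o = delta ⨟ o * delta
  delta_eps_left : delta ⨟ eps * o = o
  delta_eps_right : delta ⨟ o * eps = o
  gamma_delta_left : gamma ⨟ delta * o = o * delta ⨟ gamma * o ⨟ o * gamma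
  gamma_delta_right : gamma ⨟ o * delta = delta * o ⨟ o * gamma ⨟ gamma * o
  gamma_eps_left : gamma ⨟ eps * o = o * eps
  delta_comm : delta ⨟ gamma = delta
  mu_delta : mu ⨟ delta = delta * delta ⨟ o * gamma * o ⨟ mu * mu
  eta_eps : eta ⨟ eps = 1
  mu_eps : mu ⨟ eps = eps * eps
  eta_delta : eta ⨟ delta = eta * eta
  delta_mu : delta ⨟ mu = o
  zigzag_p : p * unit ⨟ counit * p = p
  zigzag_o : unit * o ⨟ o * counit = o

namespace DualBialgebra

attribute [simp] src_o src_p src_mu tgt_mu src_eta tgt_eta src_delta tgt_delta src_eps tgt_eps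
  src_gamma tgt_gamma src_unit tgt_unit src_counit tgt_counit

/-! ### Rewriting of diagrams -/

/-- The operations of a bialgebra. -/
inductive Gate
  | mu
  | eta
  | delta
  | eps
  | gamma
  deriving DecidableEq

/-- The number of inputs of an operation. -/
def Gate.inp : Gate → ℕ
  | mu => 2
  | eta => 0
  | delta => 1
  | eps => 1
  | gamma => 2

/-- The number of outputs of an operation. -/
def Gate.out : Gate → ℕ
  | mu => 1
  | eta => 1
  | delta => 2
  | eps => 0
  | gamma => 2

/-- A diagram: a sequence of operations, each given with the number of wires on its left. -/
abbrev Diagram : Type := List (ℕ × Gate)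

namespace Diagram

/-- The number of outputs of a diagram with `n` inputs. -/
def width : ℕ → Diagram → ℕ
  | n, [] => n
  | n, (_, g) :: d => width (n - g.inp + g.out) d

/-- Whether a diagram makes sense with `n` inputs. -/
def valid : ℕ → Diagram → Bool
  | _, [] => true
  | n, (i, g) :: d => decide (i + g.inp ≤ n) && valid (n - g.inp + g.out) d

/-- A diagram with `k` more wires on the left. -/
def shift (k : ℕ) (d : Diagram) : Diagram := d.map fun a => (k + a.1, a.2)

end Diagram

variable {Q : Type} [DualBialgebra Q]

/-- The value of an operation. -/
def Gate.eval : Gate → Q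
  | mu => DualBialgebra.mu
  | eta => DualBialgebra.eta
  | delta => DualBialgebra.delta
  | eps => DualBialgebra.eps
  | gamma => DualBialgebra.gamma

@[simp] theorem Gate.src_eval (g : Gate) : src (g.eval : Q) = o ^ g.inp := by
  cases g <;> simp [Gate.eval, Gate.inp, pow_two]

@[simp] theorem Gate.tgt_eval (g : Gate) : tgt (g.eval : Q) = o ^ g.out := by
  cases g <;> simp [Gate.eval, Gate.out, pow_two]

@[simp] theorem tgt_o : tgt (o : Q) = o := tgt_of_src src_o

@[simp] theorem tgt_p : tgt (p : Q) = p := tgt_of_src src_p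

namespace Diagram

/-- The value of a diagram with `n` inputs; it is meaningful when the diagram is valid. -/
def eval : ℕ → Diagram → Q
  | n, [] => o ^ n
  | n, (i, g) :: d => o ^ i * g.eval * o ^ (n - i - g.inp) ⨟ eval (n - g.inp + g.out) d

theorem src_tgt_eval : ∀ (d : Diagram) (n : ℕ), valid n d = true →
    src (eval n d : Q) = o ^ n ∧ tgt (eval n d : Q) = o ^ width n d
  | [], n, _ => by simp [eval, width]
  | (i, g) :: d, n, h => by
    simp only [valid, Bool.and_eq_true, decide_eq_true_eq] at h
    obtain ⟨h1, h2⟩ := src_tgt_eval d _ h.2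
    have e : i + g.out + (n - i - g.inp) = n - g.inp + g.out := by omega
    have h3 : tgt (o ^ i * g.eval * o ^ (n - i - g.inp) : Q) = src (eval (n - g.inp + g.out) d) := by
      rw [h1, ← e]
      simp [pow_add, mul_assoc]
    refine ⟨?_, (tgt_comp _ _ h3).trans h2⟩
    rw [eval, src_comp _ _ h3]
    simp only [src_mul, src_pow, src_o, Gate.src_eval, ← pow_add]
    congr 1
    omega

theorem eval_append : ∀ (d d' : Diagram) (n : ℕ), valid n (d ++ d') = true →
    (eval n (d ++ d') : Q) = eval n d ⨟ eval (width n d) d'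
  | [], d', n, h => by
    rw [List.nil_append, eval, width, id_comp (src_tgt_eval d' n h).1]
  | (i, g) :: d, d', n, h => by
    simp only [List.cons_append, valid, Bool.and_eq_true, decide_eq_true_eq] at h
    rw [List.cons_append, eval, eval, eval_append d d' _ h.2, comp_assoc, width]

theorem valid_append : ∀ (d d' : Diagram) (n : ℕ),
    valid n (d ++ d') = (valid n d && valid (width n d) d')
  | [], d', n => by simp [valid, width]
  | (i, g) :: d, d', n => by simp [valid, width, valid_append d d', Bool.and_assoc]

/-- Shifting a diagram puts identity wires on both sides of its value. -/
theorem valid_shift : ∀ (d : Diagram) (k w m : ℕ), valid w d = true →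
    valid (k + w + m) (shift k d) = true ∧ width (k + w + m) (shift k d) = k + width w d + m ∧
      (eval (k + w + m) (shift k d) : Q) = o ^ k * eval w d * o ^ m
  | [], k, w, m, _ => by simp [shift, valid, width, eval, pow_add]
  | (i, g) :: d, k, w, m, h => by
    simp only [valid, Bool.and_eq_true, decide_eq_true_eq] at h
    obtain ⟨h1, h2, h3⟩ := valid_shift d k _ m h.2
    have e : k + w + m - g.inp + g.out = k + (w - g.inp + g.out) + m := by omega
    have e' : k + w + m - (k + i) - g.inp = (w - i - g.inp) + m := by omega
    change (decide _ && valid _ (shift k d)) = true ∧ width _ (shift k d) = k + width _ d + m ∧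
      _ ⨟ eval _ (shift k d) = _
    rw [e]
    refine ⟨by simpa [h1] using by omega, h2, ?_⟩
    dsimp only
    rw [h3, e', eval, whisker_left _ _ _ (by simp), whisker_right _ _ _ (by simp)]
    simp only [pow_add, mul_assoc]

/-- Equal diagrams can be exchanged inside a larger diagram. -/
theorem eval_congr {l r : Diagram} {w : ℕ} (hl : valid w l = true) (hr : valid w r = true)
    (hw : width w l = width w r) (h : (eval w l : Q) = eval w r) {n k : ℕ} {a b : Diagram}
    (ha : k + w ≤ width n a) (hv : valid n (a ++ (shift k l ++ b)) = true) :
    valid n (a ++ (shift k r ++ b)) = true ∧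
      (eval n (a ++ (shift k l ++ b)) : Q) = eval n (a ++ (shift k r ++ b)) := by
  obtain ⟨m, hm⟩ : ∃ m, width n a = k + w + m := ⟨width n a - (k + w), by omega⟩
  obtain ⟨l1, l2, l3⟩ := valid_shift (Q := Q) l k w m hl
  obtain ⟨r1, r2, r3⟩ := valid_shift (Q := Q) r k w m hr
  have hv' := hv
  rw [valid_append, valid_append, Bool.and_eq_true, Bool.and_eq_true, hm, l2, hw, ← r2] at hv
  have hr' : valid n (a ++ (shift k r ++ b)) = true := by
    rw [valid_append, valid_append, Bool.and_eq_true, Bool.and_eq_true, hm]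
    exact ⟨hv.1, r1, hv.2.2⟩
  refine ⟨hr', ?_⟩
  have hl'' := hv'
  rw [valid_append, Bool.and_eq_true] at hl''
  have hr'' := hr'
  rw [valid_append, Bool.and_eq_true] at hr''
  rw [eval_append _ _ _ hv', eval_append _ _ _ hr', eval_append _ _ _ hl''.2,
    eval_append _ _ _ hr''.2, hm, l3, r3, l2, r2, h, hw]

/-- The equations between diagrams used for rewriting. -/
inductive Rule
  | yangBaxter
  | gamma_gamma
  | mu_assoc
  | mu_gamma_left
  | mu_gamma_right
  | mu_comm
  | delta_assoc
  | delta_eps_left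
  | gamma_delta_left
  | gamma_delta_right
  | gamma_eps_left
  | delta_comm
  | mu_delta
  | mu_eps
  | delta_mu

/-- The number of inputs and the two sides of an equation. -/
def Rule.sides : Rule → ℕ × Diagram × Diagram
  | yangBaxter => (3, [(0, .gamma), (1, .gamma), (0, .gamma)], [(1, .gamma), (0, .gamma), (1, .gamma)])
  | gamma_gamma => (2, [(0, .gamma), (0, .gamma)], [])
  | mu_assoc => (3, [(0, .mu), (0, .mu)], [(1, .mu), (0, .mu)])
  | mu_gamma_left => (3, [(0, .mu), (0, .gamma)], [(1, .gamma), (0, .gamma), (1, .mu)])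
  | mu_gamma_right => (3, [(1, .mu), (0, .gamma)], [(0, .gamma), (1, .gamma), (0, .mu)])
  | mu_comm => (2, [(0, .gamma), (0, .mu)], [(0, .mu)])
  | delta_assoc => (1, [(0, .delta), (0, .delta)], [(0, .delta), (1, .delta)])
  | delta_eps_left => (1, [(0, .delta), (0, .eps)], [])
  | gamma_delta_left => (2, [(0, .gamma), (0, .delta)], [(1, .delta), (0, .gamma), (1, .gamma)])
  | gamma_delta_right => (2, [(0, .gamma), (1, .delta)], [(0, .delta), (1, .gamma), (0, .gamma)])
  | gamma_eps_left => (2, [(0, .gamma), (0, .eps)], [(1, .eps)])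
  | delta_comm => (1, [(0, .delta), (0, .gamma)], [(0, .delta)])
  | mu_delta => (2, [(0, .mu), (0, .delta)], [(0, .delta), (2, .delta), (1, .gamma), (0, .mu), (1, .mu)])
  | mu_eps => (2, [(0, .mu), (0, .eps)], [(0, .eps), (0, .eps)])
  | delta_mu => (1, [(0, .delta), (0, .mu)], [])

theorem Rule.sound (r : Rule) : (eval r.sides.1 r.sides.2.1 : Q) = eval r.sides.1 r.sides.2.2 := by
  have e1 : (delta * delta : Q) = delta * o ⨟ o * (o * delta) := by
    rw [← left_right]; simp [mul_assoc]
  have e2 : (mu * mu : Q) = mu * (o * o) ⨟ o * mu := by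
    rw [← left_right]; simp
  have e3 : (eps * eps : Q) = eps * o ⨟ eps := by
    rw [← left_right]; simp
  have m1 := DualBialgebra.mu_assoc (Q := Q)
  have m2 := DualBialgebra.mu_gamma_left (Q := Q)
  have m3 := DualBialgebra.mu_gamma_right (Q := Q)
  have m4 := DualBialgebra.yangBaxter (Q := Q)
  have m5 := DualBialgebra.delta_assoc (Q := Q)
  have m6 := DualBialgebra.gamma_delta_left (Q := Q)
  have m7 := DualBialgebra.gamma_delta_right (Q := Q)
  have m8 := DualBialgebra.mu_delta (Q := Q)
  have m9 := DualBialgebra.mu_eps (Q := Q)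
  rw [e1, e2] at m8
  rw [e3] at m9
  have key : ∀ (f U : Q), tgt f = U → f ⨟ U = f := fun f U h => comp_id h
  cases r <;> simp [Rule.sides, eval, Gate.eval, Gate.inp, Gate.out, pow_succ, mul_assoc, key,
    comp_assoc] at * <;> 
    first | assumption | simp [*] | skip
  exacts [DualBialgebra.gamma_gamma, DualBialgebra.mu_comm, DualBialgebra.delta_eps_left,
    DualBialgebra.gamma_eps_left, DualBialgebra.delta_comm, DualBialgebra.delta_mu]

/-- A step of rewriting, at a given place of a diagram. -/
inductive Move
  | swap (pos : ℕ)
  | fwd (r : Rule) (pos off : ℕ)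
  | bwd (r : Rule) (pos off : ℕ)

/-- The replacement of a side of an equation by the other one in a diagram. -/
def replace (n pos off w : ℕ) (l r d : Diagram) : Option Diagram :=
  if off + w ≤ width n (d.take pos) ∧ (d.drop pos).take l.length = shift off l then
    some (d.take pos ++ (shift off r ++ (d.drop pos).drop l.length))
  else none

/-- The exchange of two consecutive operations which involve distinct wires. -/
def swapAt (n pos : ℕ) (d : Diagram) : Option Diagram :=
  match d.drop pos with
  | (i, g) :: (j, h) :: _ =>
    if i + g.out ≤ j then
      replace n pos i (g.inp + (j - i - g.out) + h.inp) [(0, g), (g.out + (j - i - g.out), h)]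
        [(g.inp + (j - i - g.out), h), (0, g)] d
    else
      replace n pos j (h.inp + (i - j - h.inp) + g.inp) [(h.inp + (i - j - h.inp), g), (0, h)]
        [(0, h), (h.out + (i - j - h.inp), g)] d
  | _ => none

/-- The effect of a step of rewriting. -/
def Move.apply (n : ℕ) (d : Diagram) : Move → Option Diagram
  | swap pos => swapAt n pos d
  | fwd r pos off => replace n pos off r.sides.1 r.sides.2.1 r.sides.2.2 d
  | bwd r pos off => replace n pos off r.sides.1 r.sides.2.2 r.sides.2.1 d

/-- The effect of a sequence of steps of rewriting. -/
def rewrites (n : ℕ) : Diagram → List Move → Option Diagram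
  | d, [] => some d
  | d, m :: s => (m.apply n d).bind fun d' => rewrites n d' s

theorem replace_sound {n pos off w : ℕ} {l r d d' : Diagram}
    (hl : valid w l = true) (hr : valid w r = true)
    (hw : width w l = width w r) (h : (eval w l : Q) = eval w r) (hd : valid n d = true)
    (e : replace n pos off w l r d = some d') :
    valid n d' = true ∧ (eval n d : Q) = eval n d' := by
  unfold replace at e
  split at e
  · rename_i c
    cases e
    have split : d = d.take pos ++ (shift off l ++ (d.drop pos).drop l.length) := by
      rw [← c.2, List.take_append_drop, List.take_append_drop]
    have := eval_congr hl hr hw h (b := (d.drop pos).drop l.length) c.1 (split ▸ hd)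
    rwa [← split] at this
  · cases e

/-- The exchange of two consecutive operations which involve distinct wires, the first one on the
left, with `k` wires between them. -/
theorem swap_sound (g h : Gate) (k : ℕ) :
    valid (g.inp + k + h.inp) [(0, g), (g.out + k, h)] = true ∧
    valid (g.inp + k + h.inp) [(g.inp + k, h), (0, g)] = true ∧
    width (g.inp + k + h.inp) [(0, g), (g.out + k, h)] =
      width (g.inp + k + h.inp) [(g.inp + k, h), (0, g)] ∧
    (eval (g.inp + k + h.inp) [(0, g), (g.out + k, h)] : Q) =
      eval (g.inp + k + h.inp) [(g.inp + k, h), (0, g)] := by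
  have e1 : g.inp + k + h.inp - g.inp + g.out = g.out + k + h.inp := by omega
  have e2 : g.inp + k + h.inp - h.inp + h.out = g.inp + k + h.out := by omega
  have e3 : g.out + k + h.inp - h.inp + h.out = g.out + k + h.out := by omega
  have e4 : g.inp + k + h.out - g.inp + g.out = g.out + k + h.out := by omega
  refine ⟨?_, ?_, ?_, ?_⟩
  · simp only [valid, e1, Bool.and_true, Bool.and_eq_true, decide_eq_true_eq]
    omega
  · simp only [valid, e2, Bool.and_true, Bool.and_eq_true, decide_eq_true_eq]
    omega
  · simp only [width, e1, e2, e3, e4]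
  · have e5 : g.inp + k + h.inp - 0 - g.inp = k + h.inp := by omega
    have e6 : g.out + k + h.inp - (g.out + k) - h.inp = 0 := by omega
    have e7 : g.inp + k + h.inp - (g.inp + k) - h.inp = 0 := by omega
    have e8 : g.inp + k + h.out - 0 - g.inp = k + h.out := by omega
    simp only [eval, e1, e2, e3, e4, e5, e6, e7, e8]
    have := exchange (g.eval : Q) (o ^ k * h.eval)
    simp only [src_mul, tgt_mul, src_pow, tgt_pow, Gate.src_eval, Gate.tgt_eval, src_o, tgt_o,
      ← pow_add] at this
    rw [← comp_assoc, ← comp_assoc]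
    simp only [pow_zero, one_mul, mul_one]
    congr 1
    simpa only [pow_add, mul_assoc] using this

theorem rule_sides (r : Rule) : valid r.sides.1 r.sides.2.1 = true ∧
    valid r.sides.1 r.sides.2.2 = true ∧
    width r.sides.1 r.sides.2.1 = width r.sides.1 r.sides.2.2 := by
  cases r <;> exact ⟨rfl, rfl, rfl⟩

theorem Move.sound {n : ℕ} {d d' : Diagram} (m : Move) (hd : valid n d = true)
    (e : m.apply n d = some d') : valid n d' = true ∧ (eval n d : Q) = eval n d' := by
  cases m with
  | fwd r pos off =>
    obtain ⟨h1, h2, h3⟩ := rule_sides r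
    exact replace_sound h1 h2 h3 r.sound hd e
  | bwd r pos off =>
    obtain ⟨h1, h2, h3⟩ := rule_sides r
    exact replace_sound h2 h1 h3.symm r.sound.symm hd e
  | swap pos =>
    simp only [Move.apply, swapAt] at e
    split at e
    · split at e
      · obtain ⟨h1, h2, h3, h4⟩ := swap_sound (Q := Q) _ _ _
        exact replace_sound h1 h2 h3 h4 hd e
      · obtain ⟨h1, h2, h3, h4⟩ := swap_sound (Q := Q) _ _ _
        exact replace_sound h2 h1 h3.symm h4.symm hd e
    · cases e

/-- Equality of diagrams by reflection: it is enough to give the sequence of rewriting steps, which is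
run by evaluation. -/
theorem eval_eq_of_rewrites {n : ℕ} : ∀ (s : List Move) {d d' : Diagram}, valid n d = true →
    rewrites n d s = some d' → (eval n d : Q) = eval n d'
  | [], _, _, _, e => by cases e; rfl
  | m :: s, d, d', hd, e => by
    obtain ⟨d'', h1, h2⟩ := Option.bind_eq_some_iff.1 e
    obtain ⟨h3, h4⟩ := m.sound (Q := Q) hd h1
    exact h4.trans (eval_eq_of_rewrites s h3 h2)

/-- The diagram which crosses a wire over an accumulator, on its right, whose content is passed to
the left; the boolean tells whether the wire is added to the accumulator. -/
def cross : Bool → Diagram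
  | true => [(0, .delta), (1, .gamma), (0, .mu)]
  | false => [(0, .gamma)]

/-- An accumulator which is discarded after a crossing can be discarded before. -/
theorem cross_discard (s : Bool) :
    (eval 2 (cross s ++ [(0, .eps)]) : Q) = eval 2 [(1, .eps)] := by
  cases s
  · exact eval_eq_of_rewrites [.fwd .gamma_eps_left 0 0] rfl rfl
  · exact eval_eq_of_rewrites [.fwd .mu_eps 2 0, .swap 1, .fwd .delta_eps_left 0 0,
      .fwd .gamma_eps_left 0 0] rfl rfl

/-- An accumulator which is copied after a crossing can be copied before, both copies crossing the
wire. -/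
theorem cross_copy (s : Bool) :
    (eval 2 (cross s ++ [(0, .delta)]) : Q) =
      eval 2 ((1, .delta) :: (cross s ++ shift 1 (cross s))) := by
  cases s
  · exact eval_eq_of_rewrites (Q := Q)
      [.fwd .gamma_delta_left 0 0] rfl rfl
  · exact eval_eq_of_rewrites (Q := Q)
      [.fwd .mu_delta 2 0, .swap 1, .fwd .gamma_delta_left 2 2, .swap 4, .swap 5,
        .fwd .delta_assoc 0 0, .swap 1, .bwd .gamma_delta_right 2 1, .swap 3, .swap 0] rfl rfl

/-- Two accumulators which are added after crossing a wire can be added before: as the bialgebra is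
qualitative, the wire is added to the sum when it was added to one of them. -/
theorem cross_add (s t : Bool) :
    (eval 3 (cross s ++ (shift 1 (cross t) ++ [(0, .mu)])) : Q) =
      eval 3 ((1, .mu) :: cross (s || t)) := by
  rcases s with _ | _ <;> rcases t with _ | _
  · exact eval_eq_of_rewrites (Q := Q)
      [.bwd .mu_gamma_right 0 0] rfl rfl
  · exact eval_eq_of_rewrites (Q := Q)
      [.fwd .gamma_delta_right 0 0, .swap 2, .bwd .mu_assoc 4 0, .fwd .mu_comm 3 0,
        .fwd .mu_assoc 3 0, .bwd .mu_gamma_right 1 1, .swap 0] rfl rfl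
  · exact eval_eq_of_rewrites (Q := Q)
      [.swap 2, .fwd .mu_assoc 3 0, .bwd .mu_gamma_right 1 1, .swap 0] rfl rfl
  · exact eval_eq_of_rewrites (Q := Q)
      [.swap 2, .fwd .gamma_delta_right 1 1, .swap 4, .bwd .delta_assoc 0 0, .swap 3,
        .bwd .mu_assoc 6 0, .fwd .mu_assoc 5 0, .fwd .mu_comm 4 1, .bwd .mu_assoc 4 0, .swap 3,
        .swap 2, .fwd .delta_mu 1 0, .fwd .mu_assoc 3 0, .bwd .mu_gamma_right 1 1, .swap 0] rfl rfl

/-- The crossings of a wire over two accumulators commute with their exchange. -/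
theorem cross_comm (s t : Bool) :
    (eval 3 (cross s ++ (shift 1 (cross t) ++ [(0, .gamma)])) : Q) =
      eval 3 ((1, .gamma) :: (cross t ++ shift 1 (cross s))) := by
  rcases s with _ | _ <;> rcases t with _ | _
  · exact eval_eq_of_rewrites (Q := Q)
      [.fwd .yangBaxter 0 0] rfl rfl
  · exact eval_eq_of_rewrites (Q := Q)
      [.fwd .gamma_delta_right 0 0, .swap 2, .fwd .mu_gamma_right 4 0, .fwd .gamma_gamma 3 0,
        .fwd .yangBaxter 1 1, .swap 3, .swap 0] rfl rfl
  · exact eval_eq_of_rewrites (Q := Q)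
      [.swap 2, .fwd .mu_gamma_left 3 0, .fwd .yangBaxter 1 1, .swap 0, .swap 3,
        .bwd .gamma_delta_right 1 0] rfl rfl
  · exact eval_eq_of_rewrites (Q := Q)
      [.bwd .delta_comm 0 0, .bwd .mu_gamma_right 1 0, .fwd .gamma_delta_right 2 0, .swap 1,
        .fwd .delta_assoc 0 0, .swap 4, .fwd .mu_gamma_right 6 0, .fwd .gamma_gamma 5 0,
        .fwd .yangBaxter 3 1, .fwd .mu_gamma_left 2 2, .swap 1, .swap 4,
        .fwd .mu_gamma_right 5 2, .swap 7, .swap 6, .bwd .gamma_delta_right 2 1,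
        .fwd .delta_comm 3 2, .swap 3, .swap 0] rfl rfl

end Diagram

end DualBialgebra

end FOC

namespace FOC

open StrictMonoidal

namespace DualBialgebra

/-! ### Matrices -/

variable {Q : Type} [DualBialgebra Q]

theorem gamma_eps_right : (gamma ⨟ o * eps : Q) = eps * o := by
  rw [← gamma_eps_left, ← comp_assoc, gamma_gamma, id_comp (by simp)]

open Classical in
/-- The gate which crosses a wire over an accumulator, on its right, whose content is passed to
the left; the wire is added to the accumulator when the proposition holds. -/
noncomputable def gate (s : Prop) : Q := Diagram.eval 2 (Diagram.cross (decide s))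

theorem gate_true : (gate True : Q) = delta * o ⨟ o * gamma ⨟ mu * o := by
  simp only [gate, decide_true, Diagram.cross, Diagram.eval, Gate.eval, Gate.inp, Gate.out, pow_zero,
    one_mul, mul_one, pow_two, pow_one, Nat.sub_self, Nat.sub_zero, Nat.reduceSub, Nat.reduceAdd]
  rw [comp_id (f := mu * o) (by simp)]

theorem gate_false : (gate False : Q) = gamma := by
  simp only [gate, decide_false, Diagram.cross, Diagram.eval, Gate.eval, Gate.inp, Gate.out, pow_zero,
    one_mul, mul_one, pow_two, Nat.sub_self, Nat.sub_zero, Nat.reduceAdd]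
  exact comp_id (by simp)

@[simp] theorem src_gate (s : Prop) : src (gate s : Q) = o * o := by
  have := Diagram.src_tgt_eval (Q := Q) (Diagram.cross (@decide s (Classical.propDecidable s))) 2
    (by cases @decide s (Classical.propDecidable s) <;> rfl)
  rw [gate, this.1, pow_two]

@[simp] theorem tgt_gate (s : Prop) : tgt (gate s : Q) = o * o := by
  have := Diagram.src_tgt_eval (Q := Q) (Diagram.cross (@decide s (Classical.propDecidable s))) 2
    (by cases @decide s (Classical.propDecidable s) <;> rfl)
  rw [gate, this.2, ← pow_two]
  cases @decide s (Classical.propDecidable s) <;> rfl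

theorem eval_cross (s : Bool) : (Diagram.eval 2 (Diagram.cross s) : Q) = gate (s = true) := by
  simp [gate]

theorem eval_shift_cross (s : Bool) :
    (Diagram.eval 3 (Diagram.shift 1 (Diagram.cross s)) : Q) = o * gate (s = true) := by
  have := (Diagram.valid_shift (Q := Q) (Diagram.cross s) 1 2 0 (by cases s <;> rfl)).2.2
  simpa [eval_cross] using this

theorem eval_cross_one (s : Bool) :
    (Diagram.eval 3 (Diagram.cross s) : Q) = gate (s = true) * o := by
  have := (Diagram.valid_shift (Q := Q) (Diagram.cross s) 0 2 1 (by cases s <;> rfl)).2.2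
  have e : Diagram.shift 0 (Diagram.cross s) = Diagram.cross s := by cases s <;> rfl
  rw [e] at this
  simpa [eval_cross] using this

theorem eval_cons (n i : ℕ) (g : Gate) (d : Diagram) : (Diagram.eval n ((i, g) :: d) : Q) =
    o ^ i * g.eval * o ^ (n - i - g.inp) ⨟ Diagram.eval (n - g.inp + g.out) d := rfl

theorem gate_eps (s : Prop) : (gate s ⨟ eps * o : Q) = o * eps := by
  obtain ⟨b, rfl⟩ : ∃ b : Bool, (b = true) = s := ⟨@decide s (Classical.propDecidable s), by simp⟩
  have := Diagram.cross_discard (Q := Q) b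
  rw [Diagram.eval_append _ _ _ (by cases b <;> rfl), eval_cross] at this
  have e : Diagram.width 2 (Diagram.cross b) = 2 := by cases b <;> rfl
  have e1 : (eps * o ⨟ o : Q) = eps * o := comp_id (by simp)
  have e2 : (o * eps ⨟ o : Q) = o * eps := comp_id (by simp)
  rw [e] at this
  simpa [Diagram.eval, Gate.eval, Gate.inp, Gate.out, e1, e2] using this

theorem gate_delta (s : Prop) :
    (gate s ⨟ delta * o : Q) = o * delta ⨟ gate s * o ⨟ o * gate s := by
  obtain ⟨b, rfl⟩ : ∃ b : Bool, (b = true) = s := ⟨@decide s (Classical.propDecidable s), by simp⟩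
  have := Diagram.cross_copy (Q := Q) b
  have e : Diagram.width 2 (Diagram.cross b) = 2 := by cases b <;> rfl
  have e' : Diagram.width 3 (Diagram.cross b) = 3 := by cases b <;> rfl
  rw [Diagram.eval_append _ _ _ (by cases b <;> rfl), eval_cross, e] at this
  rw [eval_cons 2 1] at this
  dsimp only [Gate.inp, Gate.out, Nat.reduceSub, Nat.reduceAdd] at this
  rw [Diagram.eval_append _ _ _ (by cases b <;> rfl)] at this
  rw [eval_cross_one, e', eval_shift_cross] at this
  have e1 : (delta * o ⨟ o ^ 3 : Q) = delta * o := comp_id (by simp [pow_succ])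
  simpa [Diagram.eval, Gate.eval, Gate.inp, Gate.out, e1] using this

theorem gate_mu (s t : Prop) :
    (gate s * o ⨟ o * gate t ⨟ mu * o : Q) = o * mu ⨟ gate (s ∨ t) := by
  obtain ⟨b, rfl⟩ : ∃ b : Bool, (b = true) = s := ⟨@decide s (Classical.propDecidable s), by simp⟩
  obtain ⟨c, rfl⟩ : ∃ b : Bool, (b = true) = t := ⟨@decide t (Classical.propDecidable t), by simp⟩
  have := Diagram.cross_add (Q := Q) b c
  have e' : ∀ b, Diagram.width 3 (Diagram.cross b) = 3 := by intro b; cases b <;> rfl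
  have e : ∀ b, Diagram.width 3 (Diagram.shift 1 (Diagram.cross b)) = 3 := by
    intro b; cases b <;> rfl
  rw [Diagram.eval_append _ _ _ (by cases b <;> cases c <;> rfl), e', eval_cross_one,
    Diagram.eval_append _ _ _ (by cases c <;> rfl), e, eval_shift_cross, eval_cons 3 1] at this
  dsimp only [Gate.inp, Gate.out, Nat.reduceSub, Nat.reduceAdd] at this
  rw [eval_cross] at this
  have e1 : (mu * o ⨟ o * o : Q) = mu * o := comp_id (by simp)
  simpa [Diagram.eval, Gate.eval, Gate.inp, Gate.out, pow_two, e1] using this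

theorem gate_gamma (s t : Prop) :
    (gate s * o ⨟ o * gate t ⨟ gamma * o : Q) = o * gamma ⨟ gate t * o ⨟ o * gate s := by
  obtain ⟨b, rfl⟩ : ∃ b : Bool, (b = true) = s := ⟨@decide s (Classical.propDecidable s), by simp⟩
  obtain ⟨c, rfl⟩ : ∃ b : Bool, (b = true) = t := ⟨@decide t (Classical.propDecidable t), by simp⟩
  have := Diagram.cross_comm (Q := Q) b c
  have e' : ∀ b, Diagram.width 3 (Diagram.cross b) = 3 := by intro b; cases b <;> rfl
  have e : ∀ b, Diagram.width 3 (Diagram.shift 1 (Diagram.cross b)) = 3 := by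
    intro b; cases b <;> rfl
  rw [Diagram.eval_append _ _ _ (by cases b <;> cases c <;> rfl), e', eval_cross_one,
    Diagram.eval_append _ _ _ (by cases c <;> rfl), e, eval_shift_cross, eval_cons 3 1] at this
  dsimp only [Gate.inp, Gate.out, Nat.reduceSub, Nat.reduceAdd] at this
  rw [Diagram.eval_append _ _ _ (by cases b <;> cases c <;> rfl)] at this
  rw [e', eval_cross_one, eval_shift_cross] at this
  have e1 : (gamma * o ⨟ o ^ 3 : Q) = gamma * o := comp_id (by simp [pow_succ])
  simpa [Diagram.eval, Gate.eval, Gate.inp, Gate.out, e1] using this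

variable {α β ι : Type}

/-- Add the wires which satisfy `s`, without consuming them, into a new wire on the left. The new wire
is an accumulator: it is created empty on the right, and crosses the wires one by one. -/
noncomputable def collect (s : α → Prop) : List α → Q
  | [] => eta
  | a :: l => o * collect s l ⨟ gate (s a) * o ^ l.length

@[simp] theorem src_tgt_collect (s : α → Prop) : ∀ l : List α,
    src (collect s l : Q) = o ^ l.length ∧ tgt (collect s l : Q) = o * o ^ l.length
  | [] => by simp [collect]
  | a :: l => by
    obtain ⟨h1, h2⟩ := src_tgt_collect s l
    have h3 : tgt (o * collect s l : Q) = src (gate (s a) * o ^ l.length) := by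
      simp [h2, mul_assoc]
    rw [collect, src_comp _ _ h3, tgt_comp _ _ h3]
    simp [h1, pow_succ', mul_assoc]

@[simp] theorem src_collect (s : α → Prop) (l : List α) : src (collect s l : Q) = o ^ l.length :=
  (src_tgt_collect s l).1

@[simp] theorem tgt_collect (s : α → Prop) (l : List α) :
    tgt (collect s l : Q) = o * o ^ l.length :=
  (src_tgt_collect s l).2

theorem collect_congr {s t : α → Prop} : ∀ {l : List α}, (∀ a ∈ l, s a ↔ t a) →
    (collect s l : Q) = collect t l
  | [], _ => rfl
  | a :: l, h => by
    rw [collect, collect, collect_congr fun a ha => h a (List.mem_cons_of_mem _ ha),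
      propext (h a List.mem_cons_self)]

theorem collect_map (f : ι → α) (s : α → Prop) : ∀ l : List ι,
    (collect s (l.map f) : Q) = collect (fun i => s (f i)) l
  | [] => rfl
  | a :: l => by rw [List.map_cons, collect, collect, collect_map f s l, List.length_map]

/-- A sum which is discarded need not be computed. -/
theorem collect_eps (s : α → Prop) : ∀ l : List α,
    (collect s l ⨟ eps * o ^ l.length : Q) = o ^ l.length
  | [] => by simp [collect, eta_eps]
  | a :: l => by
    have h := collect_eps s l
    have e : (eps * o ^ (a :: l).length : Q) = (eps * o) * o ^ l.length := by
      simp [pow_succ', mul_assoc]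
    rw [collect, comp_assoc, e, ← whisker_right _ _ _ (by simp), gate_eps, mul_assoc,
      ← whisker_left _ _ _ (by simp), h, List.length_cons, pow_succ']

/-- The last gates of two successive sums can be performed together, after the other ones. -/
theorem collect_two (s t : α → Prop) (a : α) (l : List α) :
    (collect s (a :: l) ⨟ o * collect t (a :: l) : Q) =
      o * (collect s l ⨟ o * collect t l) ⨟ (gate (s a) * o ⨟ o * gate (t a)) * o ^ l.length := by
  have h := exchange (gate (s a) : Q) (collect t l)
  simp only [src_gate, tgt_gate, src_collect, tgt_collect] at h
  rw [collect, collect, whisker_left _ _ _ (by simp), whisker_left _ _ _ (by simp),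
    whisker_right _ _ _ (by simp)]
  simp only [comp_assoc, mul_assoc] at h ⊢
  rw [← comp_assoc (gate (s a) * _), h]
  simp only [comp_assoc]

theorem collect_two_comp (s t : α → Prop) (a : α) (l : List α) (x : Q) :
    (collect s (a :: l) ⨟ o * collect t (a :: l) ⨟ x * o ^ (a :: l).length : Q) =
      o * (collect s l ⨟ o * collect t l) ⨟
        (gate (s a) * o ⨟ o * gate (t a) ⨟ x * o) * o ^ l.length := by
  rw [← comp_assoc, collect_two, comp_assoc, List.length_cons, pow_succ', ← mul_assoc x,
    ← whisker_right _ _ _ (by simp), comp_assoc]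

/-- The sum of two sums; the same wire may occur in both, as the bialgebra is qualitative. -/
theorem collect_mu (s t : α → Prop) : ∀ l : List α,
    (collect s l ⨟ o * collect t l ⨟ mu * o ^ l.length : Q) = collect (fun a => s a ∨ t a) l
  | [] => by
    have := exchange (eta : Q) (eta : Q)
    simp only [src_eta, tgt_eta, mul_one, one_mul] at this
    simp only [collect, List.length_nil, pow_zero, mul_one]
    rw [← comp_assoc, this, comp_assoc, eta_mu, comp_id (by simp)]
  | a :: l => by
    rw [collect_two_comp, gate_mu, whisker_right _ _ _ (by simp), collect, ← collect_mu s t l,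
      ← comp_assoc, mul_assoc, ← whisker_left _ _ _ (by simp), comp_assoc]

theorem collect_gamma (s t : α → Prop) : ∀ l : List α,
    (collect s l ⨟ o * collect t l ⨟ gamma * o ^ l.length : Q) = collect t l ⨟ o * collect s l
  | [] => by
    have := exchange (eta : Q) (eta : Q)
    simp only [src_eta, tgt_eta, mul_one, one_mul] at this
    simp only [collect, List.length_nil, pow_zero, mul_one]
    rw [eta_gamma_right, this]
  | a :: l => by
    rw [collect_two_comp, gate_gamma, collect_two, ← collect_gamma s t l]
    have w : ∀ f g : Q, (f ⨟ g) * o ^ l.length = f * o ^ l.length ⨟ g * o ^ l.length :=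
      fun f g => whisker_right (o ^ l.length) f g (by simp)
    simp only [w, whisker_left (o : Q) _ _ src_o, comp_assoc, mul_assoc]

theorem collect_delta (s : α → Prop) : ∀ l : List α,
    (collect s l ⨟ delta * o ^ l.length : Q) = collect s l ⨟ o * collect s l
  | [] => by
    have := left_right (eta : Q) (eta : Q)
    simp only [src_eta, tgt_eta, mul_one] at this
    simp only [collect, List.length_nil, pow_zero, mul_one]
    rw [this, eta_delta]
  | a :: l => by
    have e : (delta * o ^ (a :: l).length : Q) = (delta * o) * o ^ l.length := by
      simp [pow_succ', mul_assoc]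
    rw [collect_two, ← collect_delta s l, collect, comp_assoc, e, ← whisker_right _ _ _ (by simp), gate_delta]
    have w : ∀ f g : Q, (f ⨟ g) * o ^ l.length = f * o ^ l.length ⨟ g * o ^ l.length :=
      fun f g => whisker_right (o ^ l.length) f g (by simp)
    simp only [w, whisker_left (o : Q) _ _ src_o, comp_assoc, mul_assoc]

theorem collect_false {s : α → Prop} : ∀ {l : List α}, (∀ a ∈ l, ¬ s a) →
    (collect s l : Q) = eta * o ^ l.length
  | [], _ => by simp [collect]
  | a :: l, h => by
    rw [collect, collect_false fun a ha => h a (List.mem_cons_of_mem _ ha),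
      show s a = False from eq_false (h a List.mem_cons_self), gate_false, ← mul_assoc,
      ← whisker_right _ _ _ (by simp), eta_gamma_right, List.length_cons, pow_succ', mul_assoc]

theorem collect_append_left {s : α → Prop} {m : List α} (hm : ∀ a ∈ m, ¬ s a) : ∀ l : List α,
    (collect s (l ++ m) : Q) = collect s l * o ^ m.length
  | [] => collect_false hm
  | a :: l => by
    rw [List.cons_append, collect, collect_append_left hm l, collect,
      whisker_right _ _ _ (by simp), List.length_append, pow_add, mul_assoc, mul_assoc]

/-- The addition of a sum to another one, under the condition `r`. -/
theorem collect_gate (s t : α → Prop) (r : Prop) (l : List α) :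
    (collect s l ⨟ o * collect t l ⨟ gate r * o ^ l.length : Q) =
      collect (fun a => t a ∨ (r ∧ s a)) l ⨟ o * collect s l := by
  by_cases h : r
  · have h1 := exchange (delta : Q) (collect t l)
    have h2 := exchange (mu : Q) (collect s l)
    simp only [src_delta, tgt_delta, src_mu, tgt_mu, src_collect, tgt_collect, mul_assoc] at h1 h2
    rw [show r = True from eq_true h, gate_true, whisker_right _ _ _ (by simp),
      whisker_right _ _ _ (by simp)]
    simp only [mul_assoc]
    rw [← comp_assoc (o * _) (delta * _), ← h1, comp_assoc, ← comp_assoc (collect s l) (delta * _),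
      collect_delta, comp_assoc, ← comp_assoc (o * (o * _)), ← whisker_left _ _ _ (by simp),
      ← comp_assoc (o * _) _ (mu * _), ← whisker_left _ _ _ (by simp), collect_gamma,
      whisker_left _ _ _ (by simp), comp_assoc, ← h2]
    simp only [← comp_assoc]
    rw [comp_assoc (collect s l), collect_mu]
    congr 1
    exact collect_congr fun a _ => by simp [or_comm]
  · rw [show r = False from eq_false h, gate_false, collect_gamma]
    congr 1
    exact collect_congr fun a _ => by simp

/-- The morphism whose output `b` is the sum of the inputs `a` such that `R b a`: the matrix, with
Boolean coefficients, whose columns are listed by `l` and whose rows are listed by the last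
argument. -/
noncomputable def wiring (R : β → α → Prop) (l : List α) : List β → Q
  | [] => eps ^ l.length
  | b :: l' => collect (R b) l ⨟ o * wiring R l l'

theorem src_tgt_wiring (R : β → α → Prop) (l : List α) : ∀ l' : List β,
    src (wiring R l l' : Q) = o ^ l.length ∧ tgt (wiring R l l' : Q) = o ^ l'.length
  | [] => by simp [wiring]
  | b :: l' => by
    obtain ⟨h1, h2⟩ := src_tgt_wiring R l l'
    have h3 : tgt (collect (R b) l : Q) = src (o * wiring R l l') := by simp [h1]
    rw [wiring, src_comp _ _ h3, tgt_comp _ _ h3]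
    simp [h2, pow_succ']

@[simp] theorem src_wiring (R : β → α → Prop) (l : List α) (l' : List β) :
    src (wiring R l l' : Q) = o ^ l.length :=
  (src_tgt_wiring R l l').1

@[simp] theorem tgt_wiring (R : β → α → Prop) (l : List α) (l' : List β) :
    tgt (wiring R l l' : Q) = o ^ l'.length :=
  (src_tgt_wiring R l l').2

theorem wiring_congr {R S : β → α → Prop} {l : List α} : ∀ {l' : List β},
    (∀ b ∈ l', ∀ a ∈ l, R b a ↔ S b a) → (wiring R l l' : Q) = wiring S l l'
  | [], _ => rfl
  | b :: l', h => by
    rw [wiring, wiring, wiring_congr fun b hb => h b (List.mem_cons_of_mem _ hb),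
      collect_congr (h b List.mem_cons_self)]

theorem wiring_map {ι κ : Type} (R : β → α → Prop) (f : ι → α) (g : κ → β) (l : List ι) :
    ∀ l' : List κ, (wiring R (l.map f) (l'.map g) : Q) = wiring (fun k i => R (g k) (f i)) l l'
  | [] => by simp [wiring]
  | b :: l' => by rw [List.map_cons, wiring, wiring, wiring_map R f g l l', collect_map]

theorem wiring_collect (R : β → α → Prop) (s : β → Prop) (l : List α) : ∀ l' : List β,
    (wiring R l l' ⨟ collect s l' : Q) =
      collect (fun a => ∃ b ∈ l', s b ∧ R b a) l ⨟ o * wiring R l l'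
  | [] => by
    have h1 := left_right (eta : Q) (eps ^ l.length)
    have h2 := right_left (eta : Q) (eps ^ l.length)
    simp only [src_eta, tgt_eta, src_pow, tgt_pow, src_eps, tgt_eps, one_mul, one_pow, mul_one]
      at h1 h2
    rw [wiring, collect, collect_false (by simp), h1, h2]
  | b :: l' => by
    have h := exchange (gate (s b) : Q) (wiring R l l')
    simp only [src_gate, tgt_gate, src_wiring, tgt_wiring, mul_assoc] at h
    rw [wiring, collect, comp_assoc, ← comp_assoc (o * _), ← whisker_left _ _ _ (by simp),
      wiring_collect R s l l', whisker_left _ _ _ (by simp), comp_assoc, ← h, ← comp_assoc (o * _),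
      ← comp_assoc (collect _ _), collect_gate, comp_assoc, whisker_left _ _ _ (by simp)]
    congr 1
    exact collect_congr fun a _ => by simp [or_comm]

/-- The composition of wirings is the product of Boolean matrices. -/
theorem wiring_comp (R : β → α → Prop) (S : ι → β → Prop) (l : List α) (l' : List β) :
    ∀ l'' : List ι, (wiring R l l' ⨟ wiring S l' l'' : Q) =
      wiring (fun c a => ∃ b ∈ l', S c b ∧ R b a) l l''
  | [] => by
    rw [wiring, wiring]
    induction l' with
    | nil => exact comp_id (by simp)
    | cons b l' ih =>
      have h := left_right (eps : Q) (wiring R l l')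
      have h' := right_left (eps : Q) (eps ^ l'.length)
      have h2 := right_left (eps : Q) (wiring R l l')
      simp only [src_eps, tgt_eps, src_wiring, tgt_wiring, tgt_pow, one_mul, one_pow,
        mul_one] at h h' h2
      rw [wiring, List.length_cons, pow_succ', comp_assoc, ← left_right eps]
      simp only [src_eps, tgt_eps, src_pow, one_mul]
      rw [← comp_assoc (o * _), h2, ← h, comp_assoc, ih, ← comp_assoc, collect_eps,
        id_comp (by simp)]
  | c :: l'' => by
    rw [wiring, ← comp_assoc, wiring_collect, comp_assoc, ← whisker_left _ _ _ (by simp),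
      wiring_comp R S l l' l'', wiring]

/-- An input which is used by no output is discarded. -/
theorem wiring_skip {R : β → α → Prop} {a : α} {l : List α} : ∀ {l' : List β},
    (∀ b ∈ l', ¬ R b a) → (wiring R (a :: l) l' : Q) = eps * wiring R l l'
  | [], _ => by rw [wiring, wiring, List.length_cons, pow_succ']
  | b :: l', h => by
    have h1 := interchange (f := (gamma : Q)) (g := o * eps) (f' := o ^ l.length)
      (g' := wiring R l l') (by simp) (by simp)
    have h2 := right_left (eps : Q) (collect (R b) l)
    have h3 := left_right (eps : Q) (o * wiring R l l')
    have h4 := right_left (eps : Q) (o * wiring R l l')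
    have h5 := interchange (f := (eps : Q)) (g := 1) (f' := collect (R b) l)
      (g' := o * wiring R l l') (by simp) (by simp)
    rw [gamma_eps_right, id_comp (f := wiring R l l') (by simp)] at h1
    rw [wiring, wiring, wiring_skip fun b hb => h b (List.mem_cons_of_mem _ hb), collect,
      show R b a = False from eq_false (h b List.mem_cons_self), gate_false, comp_assoc,
      ← mul_assoc o eps, h1]
    have h6 := interchange (f := (o : Q)) (g := eps) (f' := collect (R b) l)
      (g' := o * wiring R l l') (by simp) (by simp)
    rw [mul_assoc, h6, id_comp (by simp)]

/-- A block diagonal matrix is the tensor product of its blocks. -/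
theorem wiring_append {R : β → α → Prop} {l m : List α} {m' : List β}
    (h' : ∀ b ∈ m', ∀ a ∈ l, ¬ R b a) : ∀ {l' : List β}, (∀ b ∈ l', ∀ a ∈ m, ¬ R b a) →
    (wiring R (l ++ m) (l' ++ m') : Q) = wiring R l l' * wiring R m m'
  | [], _ => by
    rw [List.nil_append, wiring]
    clear * - h'
    induction l with
    | nil => simp
    | cons a l ih =>
      rw [List.cons_append, wiring_skip fun b hb => h' b hb a List.mem_cons_self,
        ih fun b hb a ha => h' b hb a (List.mem_cons_of_mem _ ha), List.length_cons, pow_succ',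
        mul_assoc]
  | b :: l', h => by
    have h1 := interchange (f := (collect (R b) l : Q)) (g := o * wiring R l l')
      (f' := o ^ m.length) (g' := wiring R m m') (by simp) (by simp)
    rw [id_comp (f := wiring R m m') (by simp)] at h1
    rw [List.cons_append, wiring, collect_append_left (h b List.mem_cons_self),
      wiring_append h' fun b hb => h b (List.mem_cons_of_mem _ hb), wiring, ← mul_assoc, h1]

theorem collect_one {s : α → Prop} {a : α} (h : s a) : (collect s [a] : Q) = delta := by
  have h1 := exchange (delta : Q) eta
  simp only [src_delta, tgt_delta, src_eta, tgt_eta, mul_one] at h1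
  rw [collect, collect, show s a = True from eq_true h, gate_true, List.length_nil, pow_zero,
    mul_one, ← comp_assoc, ← h1, comp_assoc, ← comp_assoc (o * o * eta), mul_assoc o o eta,
    ← whisker_left _ _ _ (by simp), eta_gamma_right]
  have h2 : (o * (eta * o) ⨟ mu * o : Q) = (o * eta ⨟ mu) * o := by
    rw [whisker_right _ _ _ (by simp), mul_assoc]
  have h3 : (o * eta ⨟ mu : Q) = o := by
    rw [← mu_comm, ← comp_assoc, eta_gamma_right, eta_mu]
  rw [h2, h3, comp_id (by simp)]

theorem wiring_one {R : β → α → Prop} {a : α} {b : β} (h : R b a) :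
    (wiring R [a] [b] : Q) = o := by
  rw [wiring, wiring, collect_one h, List.length_singleton, pow_one, delta_eps_right]

theorem wiring_id {R : α → α → Prop} : ∀ {l : List α}, l.Nodup →
    (∀ b ∈ l, ∀ a ∈ l, R b a ↔ b = a) → (wiring R l l : Q) = o ^ l.length
  | [], _, _ => by simp [wiring]
  | a :: l, hl, h => by
    obtain ⟨hl, hl'⟩ := List.nodup_cons.1 hl
    have := wiring_append (Q := Q) (R := R) (l := [a]) (m := l) (m' := l) (l' := [a])
      (by
        intro b hb a' ha' hR
        rw [List.mem_singleton.1 ha', h b (List.mem_cons_of_mem _ hb) a List.mem_cons_self] at hR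
        exact hl (hR ▸ hb))
      (by
        intro b hb a' ha' hR
        rw [List.mem_singleton.1 hb, h a List.mem_cons_self a' (List.mem_cons_of_mem _ ha')] at hR
        exact hl (hR ▸ ha'))
    rw [List.singleton_append] at this
    rw [this, wiring_one ((h a List.mem_cons_self a List.mem_cons_self).2 rfl),
      wiring_id hl' fun b hb a ha => h b (List.mem_cons_of_mem _ hb) a (List.mem_cons_of_mem _ ha),
      List.length_cons, pow_succ']

end DualBialgebra

end FOC

namespace FOC

open StrictMonoidal DualBialgebra

/-! ### Scheduled morphisms -/

variable {Q : Type} [DualBialgebra Q]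

/-- The generating object of a given polarity. -/
def letter : Polarity → Q
  | .O => o
  | .P => p

/-- The object denoted by a word. -/
def word (w : List Polarity) : Q := (w.map letter).prod

@[simp] theorem word_nil : (word [] : Q) = 1 := rfl

@[simp] theorem word_cons_O (w : List Polarity) : (word (.O :: w) : Q) = o * word w := rfl

@[simp] theorem word_cons_P (w : List Polarity) : (word (.P :: w) : Q) = p * word w := rfl

theorem word_append (v w : List Polarity) : (word (v ++ w) : Q) = word v * word w := by
  simp [word]

@[simp] theorem src_word : ∀ w : List Polarity, src (word w : Q) = word w
  | [] => src_one
  | .O :: w => by rw [word_cons_O, src_mul, src_o, src_word w]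
  | .P :: w => by rw [word_cons_P, src_mul, src_p, src_word w]

@[simp] theorem tgt_word (w : List Polarity) : tgt (word w : Q) = word w := tgt_of_src (src_word w)

/-- The Opponent moves of a source word, from the first one to the last one. -/
def srcConsumers : List Polarity → List Lab
  | [] => []
  | .O :: A => .inl A.length :: srcConsumers A
  | .P :: A => srcConsumers A

/-- The Proponent moves of a target word, from the last one to the first one. -/
def tgtConsumers : List Polarity → List Lab
  | [] => []
  | .O :: B => tgtConsumers B
  | .P :: B => tgtConsumers B ++ [.inr B.length]

/-- The Proponent moves of `A ⊸ B`. -/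
def consumers (A B : List Polarity) : List Lab := srcConsumers A ++ tgtConsumers B

theorem consumers_srcO (A B : List Polarity) :
    consumers (.O :: A) B = .inl A.length :: consumers A B := rfl

theorem consumers_srcP (A B : List Polarity) : consumers (.P :: A) B = consumers A B := rfl

theorem consumers_tgtO (A B : List Polarity) : consumers A (.O :: B) = consumers A B := rfl

theorem consumers_tgtP (A B : List Polarity) :
    consumers A (.P :: B) = consumers A B ++ [.inr B.length] :=
  (List.append_assoc _ _ _).symm

theorem mem_srcConsumers (x : Lab) : ∀ A, x ∈ srcConsumers A ↔ Consumer A [] x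
  | [] => by rcases x with x | x <;> simp [srcConsumers, Consumer, At]
  | .O :: A => by
    rw [srcConsumers, List.mem_cons, mem_srcConsumers x A]
    rcases x with x | x <;> simp [Consumer, At]
  | .P :: A => by
    rw [srcConsumers, mem_srcConsumers x A]
    rcases x with x | x <;> simp [Consumer, At]

theorem mem_tgtConsumers (x : Lab) : ∀ B, x ∈ tgtConsumers B ↔ Consumer [] B x
  | [] => by rcases x with x | x <;> simp [tgtConsumers, Consumer, At]
  | .P :: A => by
    rw [tgtConsumers, List.mem_append, List.mem_singleton, mem_tgtConsumers x A]
    rcases x with x | x <;> simp [Consumer, At, or_comm]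
  | .O :: A => by
    rw [tgtConsumers, mem_tgtConsumers x A]
    rcases x with x | x <;> simp [Consumer, At]

theorem mem_consumers (A B : List Polarity) (x : Lab) : x ∈ consumers A B ↔ Consumer A B x := by
  rw [consumers, List.mem_append, mem_srcConsumers, mem_tgtConsumers]
  rcases x with x | x <;> simp [Consumer, At]

theorem nodup_srcConsumers : ∀ A, (srcConsumers A).Nodup
  | [] => List.nodup_nil
  | .P :: A => nodup_srcConsumers A
  | .O :: A => List.nodup_cons.2 ⟨fun h => ((mem_srcConsumers _ A).1 h).lt.ne rfl,
      nodup_srcConsumers A⟩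

theorem nodup_tgtConsumers : ∀ A, (tgtConsumers A).Nodup
  | [] => List.nodup_nil
  | .O :: A => nodup_tgtConsumers A
  | .P :: A => List.nodup_append.2 ⟨nodup_tgtConsumers A, List.nodup_singleton _, fun _ h _ h' e =>
      At.lt (w := A) (X := .P) ((mem_tgtConsumers (.inr A.length) A).1
        (List.mem_singleton.1 h' ▸ e ▸ h)) |>.ne rfl⟩

theorem nodup_consumers (A B : List Polarity) : (consumers A B).Nodup :=
  List.nodup_append.2 ⟨nodup_srcConsumers A, nodup_tgtConsumers B, fun a h b h' e => by
    rw [mem_srcConsumers] at h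
    rw [mem_tgtConsumers] at h'
    subst e
    rcases a with a | a
    · exact h'
    · exact h⟩

/-- `Rep R A B f` means that `f : A → O ⊗ ⋯ ⊗ O ⊗ B` is built by adding one by one the moves of the
words `A` and `B`, each word being read from its end, in such a way that a Proponent move of `A ⊸ B`
is always added before the Opponent moves which are below it for `R`. The outputs `O` of `f`, which are listed by `consumers A B`, give
access to the Proponent moves of `A ⊸ B`: a new Opponent move is connected to the moves which are
above it by means of these wires. -/
inductive Rep (R : Lab → Lab → Prop) : List Polarity → List Polarity → Q → Prop
  | nil : Rep R [] [] 1
  | srcO {A B f} (h : Rep R A B f) (fresh : ∀ y, Producer A B y → ¬ R y (.inl A.length)) :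
      Rep R (.O :: A) B (o * f)
  | srcP {A B f} (h : Rep R A B f) :
      Rep R (.P :: A) B (p * f ⨟ p * collect (R (.inl A.length)) (consumers A B) * word B ⨟
        counit * o ^ (consumers A B).length * word B)
  | tgtO {A B f} (h : Rep R A B f) :
      Rep R A (.O :: B) (f ⨟ wiring (fun w y => w = y ∨ (w = .inr B.length ∧ R w y))
        (consumers A B) (consumers A B ++ [.inr B.length]) * word B)
  | tgtP {A B f} (h : Rep R A B f) (fresh : ∀ y, Producer A B y → ¬ R y (.inr B.length)) :
      Rep R A (.P :: B) (f ⨟ o ^ (consumers A B).length * unit * word B)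

theorem Rep.src_tgt {R : Lab → Lab → Prop} {A B : List Polarity} {f : Q} (h : Rep R A B f) :
    src f = word A ∧ tgt f = o ^ (consumers A B).length * word B := by
  induction h with
  | nil => simp [consumers, srcConsumers, tgtConsumers]
  | srcO h _ ih => simp [ih, consumers_srcO, pow_succ', mul_assoc]
  | @srcP A B f h ih =>
    have h1 : tgt (p * collect (R (.inl A.length)) (consumers A B) * word B : Q) =
      src (counit * o ^ (consumers A B).length * word B) := by simp [mul_assoc]
    have h2 : tgt (p * f) = src (p * collect (R (.inl A.length)) (consumers A B) * word B ⨟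
      counit * o ^ (consumers A B).length * word B : Q) := by
      rw [src_comp _ _ h1]
      simp [ih, mul_assoc]
    rw [src_comp _ _ h2, tgt_comp _ _ h2, tgt_comp _ _ h1]
    simp [ih, consumers_srcP]
  | @tgtO A B f h ih =>
    have h2 : tgt f = src (wiring (fun w y => w = y ∨ (w = .inr B.length ∧ R w y))
        (consumers A B) (consumers A B ++ [.inr B.length]) * word B : Q) := by
      simp [ih]
    rw [src_comp _ _ h2, tgt_comp _ _ h2]
    simp [ih, consumers_tgtO, pow_succ, mul_assoc]
  | @tgtP A B f h _ ih =>
    have h2 : tgt f = src (o ^ (consumers A B).length * unit * word B : Q) := by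
      simp [ih]
    rw [src_comp _ _ h2, tgt_comp _ _ h2]
    simp [ih, consumers_tgtP, pow_succ, mul_assoc]

/-- The relation `R`, restricted to the pairs which start from an Opponent move, and the orders of the
words `A` and `B` generate an acyclic relation, that is, are contained in a strict order `K`. As
positions are counted from the end, `K` decreases them. -/
def Acyclic (R : Lab → Lab → Prop) (A B : List Polarity) : Prop :=
  ∃ K : Lab → Lab → Prop, (∀ x, ¬ K x x) ∧ (∀ x y z, K x y → K y z → K x z) ∧
    (∀ x y, Producer A B x → R x y → K x y) ∧
    (∀ i j, i < j → j < A.length → K (.inl j) (.inl i)) ∧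
    (∀ i j, i < j → j < B.length → K (.inr j) (.inr i))

theorem Producer.src {A B : List Polarity} {X : Polarity} {x : Lab} (h : Producer A B x) :
    Producer (X :: A) B x := by
  rcases x with x | x
  · exact .inr h
  · exact h

theorem Producer.tgt {A B : List Polarity} {X : Polarity} {x : Lab} (h : Producer A B x) :
    Producer A (X :: B) x := by
  rcases x with x | x
  · exact h
  · exact .inr h

theorem Acyclic.src {R : Lab → Lab → Prop} {A B : List Polarity} {X : Polarity}
    (h : Acyclic R (X :: A) B) : Acyclic R A B := by
  obtain ⟨K, h1, h2, h3, h4, h5⟩ := h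
  exact ⟨K, h1, h2, fun x y hx => h3 x y hx.src, fun i j h h' => h4 i j h (Nat.lt_succ_of_lt h'), h5⟩

theorem Acyclic.tgt {R : Lab → Lab → Prop} {A B : List Polarity} {X : Polarity}
    (h : Acyclic R A (X :: B)) : Acyclic R A B := by
  obtain ⟨K, h1, h2, h3, h4, h5⟩ := h
  exact ⟨K, h1, h2, fun x y hx => h3 x y hx.tgt, h4, fun i j h h' => h5 i j h (Nat.lt_succ_of_lt h')⟩

/-- When the relation is acyclic, only an Opponent move of `B` may prevent the first move of the source
from being added last. -/
theorem Acyclic.fresh_src {R : Lab → Lab → Prop} {A B : List Polarity} {X : Polarity}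
    (h : Acyclic R (X :: A) B) {y : Lab} (hy : Producer A B y) (hR : R y (.inl A.length)) :
    ∃ j, y = .inr j ∧ At B .O j := by
  obtain ⟨K, h1, h2, h3, h4, h5⟩ := h
  rcases y with y | y
  · have lt : y < A.length := At.lt hy
    exact (h1 _ (h2 _ _ _ (h3 _ _ hy.src hR) (h4 _ _ lt (Nat.lt_succ_self _)))).elim
  · exact ⟨y, rfl, hy⟩

/-- When the relation is acyclic, only an Opponent move in `A` may prevent the first move of the target
from being added last. -/
theorem Acyclic.fresh_tgt {R : Lab → Lab → Prop} {A B : List Polarity} {X : Polarity}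
    (h : Acyclic R A (X :: B)) {y : Lab} (hy : Producer A B y) (hR : R y (.inr B.length)) :
    ∃ j, y = .inl j ∧ At A .P j := by
  obtain ⟨K, h1, h2, h3, h4, h5⟩ := h
  rcases y with y | y
  · exact ⟨y, rfl, hy⟩
  · have lt : y < B.length := At.lt hy
    exact (h1 _ (h2 _ _ _ (h3 _ _ hy.tgt hR) (h5 _ _ lt (Nat.lt_succ_self _)))).elim

/-- One of the two first moves can be added last: otherwise each of them would be above the other. -/
theorem Acyclic.fresh {R : Lab → Lab → Prop} {A B : List Polarity} {X Y : Polarity}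
    (h : Acyclic R (X :: A) (Y :: B)) :
    (∀ y, Producer A (Y :: B) y → ¬ R y (.inl A.length)) ∨
      (∀ y, Producer (X :: A) B y → ¬ R y (.inr B.length)) := by
  by_contra hc
  push Not at hc
  obtain ⟨⟨y, hy, hR⟩, z, hz, hS⟩ := hc
  obtain ⟨j, rfl, hj⟩ := h.fresh_src hy hR
  obtain ⟨i, rfl, hi⟩ := h.fresh_tgt hz hS
  obtain ⟨K, h1, h2, h3, h4, h5⟩ := h
  have k1 := h3 _ _ hy.src hR
  have k2 := h3 _ _ hz.tgt hS
  have k3 : K (.inl A.length) (.inl i) ∨ i = A.length := by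
    have := hi.lt
    rcases Nat.lt_or_ge i A.length with h | h
    · exact .inl (h4 _ _ h (Nat.lt_succ_self _))
    · exact .inr (by simp at this; omega)
  have k4 : K (.inr B.length) (.inr j) ∨ j = B.length := by
    have := hj.lt
    rcases Nat.lt_or_ge j B.length with h | h
    · exact .inl (h5 _ _ h (Nat.lt_succ_self _))
    · exact .inr (by simp at this; omega)
  have k5 : K (.inr j) (.inr B.length) := by
    rcases k3 with k3 | rfl
    · exact h2 _ _ _ k1 (h2 _ _ _ k3 k2)
    · exact h2 _ _ _ k1 k2
  rcases k4 with k4 | rfl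
  · exact h1 _ (h2 _ _ _ k4 k5)
  · exact h1 _ k5

variable (Q) in
/-- An acyclic relation can be scheduled. -/
theorem Acyclic.exists_rep {R : Lab → Lab → Prop} : ∀ {A B : List Polarity}, Acyclic R A B →
    ∃ f : Q, Rep R A B f
  | [], [], _ => ⟨1, .nil⟩
  | .P :: A, B, h => have ⟨_, hf⟩ := h.src.exists_rep; ⟨_, hf.srcP⟩
  | A, .O :: B, h => have ⟨_, hf⟩ := h.tgt.exists_rep; ⟨_, hf.tgtO⟩
  | .O :: A, [], h => by
    obtain ⟨f, hf⟩ := h.src.exists_rep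
    refine ⟨_, hf.srcO fun y hy hR => ?_⟩
    obtain ⟨j, _, hj⟩ := h.fresh_src hy hR
    exact hj
  | [], .P :: B, h => by
    obtain ⟨f, hf⟩ := h.tgt.exists_rep
    refine ⟨_, hf.tgtP fun y hy hR => ?_⟩
    obtain ⟨j, _, hj⟩ := h.fresh_tgt hy hR
    exact hj
  | .O :: A, .P :: B, h => by
    rcases h.fresh with h' | h'
    · obtain ⟨f, hf⟩ := h.src.exists_rep
      exact ⟨_, hf.srcO h'⟩
    · obtain ⟨f, hf⟩ := h.tgt.exists_rep
      exact ⟨_, hf.tgtP h'⟩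
termination_by A B => A.length + B.length

theorem producer_srcP (A B : List Polarity) : Producer (.P :: A) B (.inl A.length) :=
  .inl ⟨rfl, rfl⟩

theorem producer_tgtO (A B : List Polarity) : Producer A (.O :: B) (.inr B.length) :=
  .inl ⟨rfl, rfl⟩

theorem consumer_srcO (A B : List Polarity) : Consumer (.O :: A) B (.inl A.length) :=
  .inl ⟨rfl, rfl⟩

theorem consumer_tgtP (A B : List Polarity) : Consumer A (.P :: B) (.inr B.length) :=
  .inl ⟨rfl, rfl⟩

theorem Consumer.src {A B : List Polarity} {X : Polarity} {x : Lab} (h : Consumer A B x) :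
    Consumer (X :: A) B x := by
  rcases x with x | x
  · exact .inr h
  · exact h

theorem Consumer.tgt {A B : List Polarity} {X : Polarity} {x : Lab} (h : Consumer A B x) :
    Consumer A (X :: B) x := by
  rcases x with x | x
  · exact h
  · exact .inr h

theorem src_notMem_consumers (A B : List Polarity) : Sum.inl A.length ∉ consumers A B := by
  rw [mem_consumers]
  exact fun h => (At.lt (w := A) (X := .O) h).ne rfl

theorem tgt_notMem_consumers (A B : List Polarity) : Sum.inr B.length ∉ consumers A B := by
  rw [mem_consumers]
  exact fun h => (At.lt (w := B) (X := .P) h).ne rfl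

/-- Only the restriction of the relation to the moves of `A ⊸ B` matters. -/
theorem Rep.congr {R S : Lab → Lab → Prop} {A B : List Polarity} {f : Q} (h : Rep R A B f)
    (e : ∀ x y, Producer A B x → Consumer A B y → (R x y ↔ S x y)) : Rep S A B f := by
  induction h with
  | nil => exact .nil
  | srcO h fresh ih =>
    refine .srcO (ih fun x y hx hy => e x y hx.src hy.src) fun y hy hS => ?_
    exact fresh y hy ((e _ _ hy.src (consumer_srcO _ _)).2 hS)
  | @srcP A B f h ih =>
    have := Rep.srcP (ih fun x y hx hy => e x y hx.src hy.src)
    rwa [collect_congr (s := S (.inl A.length)) (t := R (.inl A.length))] at this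
    intro y hy
    exact (e _ _ (producer_srcP _ _) ((mem_consumers _ _ _).1 hy).src).symm
  | @tgtO A B f h ih =>
    have := Rep.tgtO (ih fun x y hx hy => e x y hx.tgt hy.tgt)
    rwa [wiring_congr (S := fun w y => w = y ∨ (w = .inr B.length ∧ R w y))] at this
    intro w hw y hy
    by_cases h : w = .inr B.length
    · subst h
      simp only [true_and]
      rw [e _ _ (producer_tgtO _ _) ((mem_consumers _ _ _).1 hy).tgt]
    · simp [h]
  | tgtP h fresh ih =>
    refine .tgtP (ih fun x y hx hy => e x y hx.tgt hy.tgt) fun y hy hS => ?_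
    exact fresh y hy ((e _ _ hy.tgt (consumer_tgtP _ _)).2 hS)

/-- A morphism can be performed before the counit which adds a Proponent move to the source. -/
theorem srcP_comp {n : ℕ} {W f c ψ : Q} (h : src ψ = o ^ n * W) :
    (p * f ⨟ p * c * W ⨟ counit * o ^ n * W) ⨟ ψ =
      p * (f ⨟ c * W ⨟ o * ψ) ⨟ counit * tgt ψ := by
  have := exchange (counit : Q) ψ
  simp only [src_counit, tgt_counit, h, one_mul] at this
  simp only [comp_assoc, whisker_left p _ _ src_p]
  rw [mul_assoc counit, this]
  simp only [mul_assoc]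

/-- The order in which the moves are added does not matter: two schedules of the same relation give the
same morphism. When their last steps differ, one concerns the source and the other the target; by
induction, both morphisms can then be built from a scheduled morphism without these two moves, and
the two steps commute. -/
theorem Rep.unique {R : Lab → Lab → Prop} {A B : List Polarity} (hR : Acyclic R A B) {f f' : Q}
    (h : Rep R A B f) (h' : Rep R A B f') : f = f' := by
  induction n : A.length + B.length using Nat.strong_induction_on generalizing A B f f' with
  | _ n ih =>
  subst n
  have ihs : ∀ {X A' B'}, A = X :: A' → B = B' → ∀ {g g' : Q}, Rep R A' B' g → Rep R A' B' g' →
      g = g' := by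
    rintro X A' B' rfl rfl g g' hg hg'
    exact ih _ (by simp) hR.src hg hg' rfl
  have iht : ∀ {X A' B'}, A = A' → B = X :: B' → ∀ {g g' : Q}, Rep R A' B' g → Rep R A' B' g' →
      g = g' := by
    rintro X A' B' rfl rfl g g' hg hg'
    exact ih _ (by simp) hR.tgt hg hg' rfl
  -- the four ways to add a move to the source and a move to the target, in both orders
  have h1 : ∀ {A' B'} {f g : Q}, A = .O :: A' → B = .O :: B' → Rep R A' B f →
      (∀ y, Producer A' B y → ¬ R y (.inl A'.length)) → Rep R A B' g →
      o * f = g ⨟ wiring (fun w y => w = y ∨ (w = .inr B'.length ∧ R w y))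
        (consumers A B') (consumers A B' ++ [.inr B'.length]) * word B' := by
    rintro A' B' f g rfl rfl hf fresh hg
    obtain ⟨r, hr⟩ := hR.src.tgt.exists_rep Q
    have key := wiring_append (Q := Q) (R := fun w y => w = y ∨ (w = .inr B'.length ∧ R w y))
      (l := [.inl A'.length]) (m := consumers A' B') (l' := [.inl A'.length])
      (m' := consumers A' B' ++ [.inr B'.length])
      (by
        intro b hb a ha
        rw [List.mem_singleton] at ha
        subst ha
        rintro (rfl | ⟨rfl, h⟩)
        · rcases List.mem_append.1 hb with h | h
          · exact src_notMem_consumers _ _ h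
          · cases List.mem_singleton.1 h
        · exact fresh _ (producer_tgtO _ _) h)
      (by
        intro b hb a ha
        rw [List.mem_singleton] at hb
        subst hb
        rintro (rfl | ⟨h, _⟩)
        · exact src_notMem_consumers _ _ ha
        · cases h)
    rw [wiring_one (.inl rfl)] at key
    rw [ihs rfl rfl hf hr.tgtO, iht rfl rfl hg (hr.srcO fun y hy => fresh y hy.tgt),
      whisker_left _ _ _ src_o, ← mul_assoc, ← key]
    rfl
  have h2 : ∀ {A' B'} {f g : Q}, A = .O :: A' → B = .P :: B' → Rep R A' B f →
      (∀ y, Producer A' B y → ¬ R y (.inl A'.length)) → Rep R A B' g →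
      (∀ y, Producer A B' y → ¬ R y (.inr B'.length)) →
      o * f = g ⨟ o ^ (consumers A B').length * unit * word B' := by
    rintro A' B' f g rfl rfl hf fresh hg fresh'
    obtain ⟨r, hr⟩ := hR.src.tgt.exists_rep Q
    rw [ihs rfl rfl hf (hr.tgtP fun y hy => fresh' y hy.src),
      iht rfl rfl hg (hr.srcO fun y hy => fresh y hy.tgt),
      whisker_left _ _ _ src_o, consumers_srcO, List.length_cons, pow_succ']
    simp only [mul_assoc]
  have h3 : ∀ {A' B'} {f g : Q}, A = .P :: A' → B = .O :: B' → Rep R A' B f → Rep R A B' g →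
      (p * f ⨟ p * collect (R (.inl A'.length)) (consumers A' B) * word B ⨟
        counit * o ^ (consumers A' B).length * word B) =
      g ⨟ wiring (fun w y => w = y ∨ (w = .inr B'.length ∧ R w y))
        (consumers A B') (consumers A B' ++ [.inr B'.length]) * word B' := by
    rintro A' B' f g rfl rfl hf hg
    obtain ⟨r, hr⟩ := hR.src.tgt.exists_rep Q
    have hb := tgt_notMem_consumers A' B'
    have e1 : (collect (R (.inl A'.length)) (consumers A' B') * o : Q) =
        collect (fun w => R (.inl A'.length) w ∧ w ≠ .inr B'.length)
          (consumers A' B' ++ [.inr B'.length]) := by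
      rw [collect_append_left (by simp), List.length_singleton, pow_one, collect_congr]
      exact fun a ha => (and_iff_left fun (e : a = .inr B'.length) => hb (e ▸ ha)).symm
    have key : (wiring (fun w y => w = y ∨ (w = .inr B'.length ∧ R w y)) (consumers A' B')
          (consumers A' B' ++ [.inr B'.length]) ⨟
          collect (R (.inl A'.length)) (consumers A' B') * o : Q) =
        collect (R (.inl A'.length)) (consumers A' B') ⨟
          o * wiring (fun w y => w = y ∨ (w = .inr B'.length ∧ R w y)) (consumers A' B')
          (consumers A' B' ++ [.inr B'.length]) := by
      rw [e1, wiring_collect]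
      congr 1
      refine collect_congr fun a ha => ?_
      simp only [List.mem_append, List.mem_singleton]
      constructor
      · rintro ⟨w, -, ⟨h, ne⟩, rfl | ⟨e, -⟩⟩
        · exact h
        · exact absurd e ne
      · exact fun h => ⟨a, .inl ha, ⟨h, fun e => hb (e ▸ ha)⟩, .inl rfl⟩
    rw [ihs rfl rfl hf hr.tgtO, iht rfl rfl hg hr.srcP, consumers_srcP,
      srcP_comp (by simp), consumers_tgtO, word_cons_O,
      ← mul_assoc o (wiring _ _ _), ← whisker_right _ _ _ (src_word _), ← key,
      whisker_right _ _ _ (src_word _), whisker_left _ _ _ src_p, whisker_left _ _ _ src_p,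
      whisker_left _ _ _ src_p]
    simp [comp_assoc, mul_assoc, pow_succ]
  have h4 : ∀ {A' B'} {f g : Q}, A = .P :: A' → B = .P :: B' → Rep R A' B f → Rep R A B' g →
      (∀ y, Producer A B' y → ¬ R y (.inr B'.length)) →
      (p * f ⨟ p * collect (R (.inl A'.length)) (consumers A' B) * word B ⨟
        counit * o ^ (consumers A' B).length * word B) =
      g ⨟ o ^ (consumers A B').length * unit * word B' := by
    rintro A' B' f g rfl rfl hf hg fresh
    obtain ⟨r, hr⟩ := hR.src.tgt.exists_rep Q
    have key := exchange (collect (R (.inl A'.length)) (consumers A' B')) (unit * word B' : Q)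
    simp only [src_collect, tgt_collect, src_mul, tgt_mul, src_unit, tgt_unit, src_word, tgt_word,
      one_mul] at key
    rw [ihs rfl rfl hf (hr.tgtP fun y hy => fresh y hy.src), iht rfl rfl hg hr.srcP, consumers_srcP,
      srcP_comp (by simp), consumers_tgtP, collect_append_left, mul_assoc (o ^ _) unit,
      ← mul_assoc o (o ^ _), key, whisker_left _ _ _ src_p, whisker_left _ _ _ src_p,
      whisker_left _ _ _ src_p]
    · simp [comp_assoc, mul_assoc, pow_succ]
    · intro b hb
      rw [List.mem_singleton.1 hb]
      exact fresh _ (producer_srcP _ _)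
  cases h with
  | nil => cases h' with | nil => rfl
  | srcO hf fresh =>
    cases h' with
    | srcO hf' _ => rw [ihs rfl rfl hf hf']
    | tgtO hf' => exact h1 rfl rfl hf fresh hf'
    | tgtP hf' fresh' => exact h2 rfl rfl hf fresh hf' fresh'
  | srcP hf =>
    cases h' with
    | srcP hf' => rw [ihs rfl rfl hf hf']
    | tgtO hf' => exact h3 rfl rfl hf hf'
    | tgtP hf' fresh' => exact h4 rfl rfl hf hf' fresh'
  | tgtO hf =>
    cases h' with
    | tgtO hf' => rw [iht rfl rfl hf hf']
    | srcO hf' fresh' => exact (h1 rfl rfl hf' fresh' hf).symm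
    | srcP hf' => exact (h3 rfl rfl hf' hf).symm
  | tgtP hf fresh =>
    cases h' with
    | tgtP hf' _ => rw [iht rfl rfl hf hf']
    | srcO hf' fresh' => exact (h2 rfl rfl hf' fresh' hf fresh).symm
    | srcP hf' => exact (h4 rfl rfl hf' hf fresh).symm

end FOC

namespace FOC

open StrictMonoidal DualBialgebra

variable {Q : Type} [DualBialgebra Q]

/-! ### Steps of the composition of scheduled morphisms -/

-- In this section, `f` and `g` are scheduled morphisms, `h` is the one which represents their
-- composite without the moves of the middle word, and `X` is the wiring which defines the outputs of
-- `f` and `g` from those of `h`. Each lemma adds a move to both sides of the equation.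
section Steps

variable {f g h k l t V W X Y Z c c' : Q}

theorem comp_step_srcO (ih : f ⨟ k * g = h ⨟ X * W) :
    o * f ⨟ o * k * g = o * h ⨟ o * X * W := by
  rw [mul_assoc, ← whisker_left _ _ _ src_o, ih, whisker_left _ _ _ src_o, mul_assoc]

theorem comp_step_srcP {n m j : ℕ} (hW : src W = W) (hg : src g = V) (hg' : tgt g = o ^ m * W)
    (hX : src X = o ^ j) (hX' : tgt X = o ^ n * o ^ m) (hc : src c = o ^ n) (hc' : tgt c = o * o ^ n)
    (ih : f ⨟ o ^ n * g = h ⨟ X * W) (key : X ⨟ c * o ^ m = c' ⨟ o * X) :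
    (p * f ⨟ p * c * V ⨟ counit * o ^ n * V) ⨟ o ^ n * g =
      (p * h ⨟ p * c' * W ⨟ counit * o ^ j * W) ⨟ X * W := by
  have hW' := tgt_of_src hW
  have e := exchange c g
  rw [hg, hc, hc', hg'] at e
  rw [srcP_comp (by simp [hg]), srcP_comp (by simp [hX, hW]), ← mul_assoc o (o ^ n), e, ← comp_assoc f,
    ih, ← mul_assoc o X, ← whisker_right _ _ _ hW, ← key, whisker_right _ _ _ hW]
  simp [hg', hX', hW', comp_assoc, mul_assoc]

/-- The unit and the counit of a move hidden by composition straighten to a plain wire. -/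
theorem zigzag_step {m : ℕ} (hW : src W = W) (hg : src g = V) (hg' : tgt g = o ^ m * W)
    (hc : src c = o ^ m) (hc' : tgt c = o * o ^ m) :
    unit * V ⨟ o * (p * g ⨟ p * c * W ⨟ counit * o ^ m * W) = g ⨟ c * W := by
  have hW' := tgt_of_src hW
  have e1 := exchange unit g
  have e2 := exchange unit (c * W)
  simp only [src_unit, tgt_unit, hg, hg', one_mul, src_mul, tgt_mul, hc, hc', hW, hW'] at e1 e2
  have e3 : (unit * (o * o ^ m * W) ⨟ o * (counit * o ^ m * W) : Q) = o * o ^ m * W := by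
    have := whisker_right (o ^ m * W) (unit * o : Q) (o * counit) (by simp [hW])
    rw [zigzag_o] at this
    simpa only [mul_assoc] using this.symm
  rw [whisker_left _ _ _ src_o, whisker_left _ _ _ src_o, ← comp_assoc, ← mul_assoc o p, e1,
    comp_assoc, ← comp_assoc (unit * _), mul_assoc p, ← mul_assoc o p, e2, comp_assoc, e3,
    comp_id (f := c * W) (by simp [hc', hW'])]

theorem comp_step_midP {n m : ℕ} (hW : src W = W) (hg : src g = V) (hg' : tgt g = o ^ m * W)
    (hc : src c = o ^ m) (hc' : tgt c = o * o ^ m)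
    (ih : f ⨟ o ^ n * g = h ⨟ X * W) (key : X ⨟ o ^ n * c = Z) :
    (f ⨟ o ^ n * unit * V) ⨟ o ^ (n + 1) * (p * g ⨟ p * c * W ⨟ counit * o ^ m * W) =
      h ⨟ Z * W := by
  rw [pow_succ, mul_assoc (o ^ n) o, mul_assoc (o ^ n) unit, comp_assoc,
    ← whisker_left (o ^ n) _ _ (by simp), zigzag_step hW hg hg' hc hc',
    whisker_left (o ^ n) _ _ (by simp), ← comp_assoc, ih, ← key, comp_assoc, ← mul_assoc,
    ← whisker_right _ _ _ hW]

theorem comp_step_midO {n m : ℕ} (hW : src W = W) (hg : src g = V) (hg' : tgt g = o ^ m * W)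
    (hY : src Y = o ^ n) (hY' : tgt Y = o ^ (n + 1))
    (ih : f ⨟ o ^ n * g = h ⨟ X * W) (key : X ⨟ Y * o ^ m = Z) :
    (f ⨟ Y * V) ⨟ o ^ n * (o * g) = h ⨟ Z * W := by
  have e := exchange Y g
  rw [hg, hY, hY', hg'] at e
  rw [← mul_assoc, ← pow_succ, comp_assoc, e, ← comp_assoc, ih, ← key, whisker_right _ _ _ hW,
    comp_assoc, mul_assoc]

theorem comp_step_tgtO {n : ℕ} (hW : src W = W) (ih : f ⨟ o ^ n * g = h ⨟ X * W)
    (key : X ⨟ o ^ n * Y = Z ⨟ X * o) :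
    f ⨟ o ^ n * (g ⨟ Y * W) = (h ⨟ Z * W) ⨟ X * (o * W) := by
  rw [whisker_left (o ^ n) _ _ (by simp), ← comp_assoc, ih, comp_assoc, ← mul_assoc,
    ← whisker_right _ _ _ hW, key, whisker_right _ _ _ hW, comp_assoc, mul_assoc X]

theorem comp_step_tgtP {n m j : ℕ} (hW : src W = W) (ih : f ⨟ o ^ n * g = h ⨟ X * W)
    (hX : src X = o ^ j) (hX' : tgt X = o ^ n * o ^ m) :
    f ⨟ o ^ n * (g ⨟ o ^ m * unit * W) = (h ⨟ o ^ j * unit * W) ⨟ X * o * (p * W) := by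
  have e := exchange X (unit * W)
  simp only [hX, hX', src_mul, tgt_mul, src_unit, tgt_unit, hW, tgt_of_src hW, one_mul,
    mul_assoc] at e
  rw [whisker_left (o ^ n) _ _ (by simp), ← comp_assoc, ih, comp_assoc, comp_assoc, mul_assoc (o ^ m),
    e, mul_assoc, mul_assoc]

end Steps

section Insert

variable {α : Type}

/-- The coefficients of the matrix whose row `b` is the sum of the columns in `s`, and whose other rows
copy the column of the same name. -/
def Insert (b : α) (s : α → Prop) (w y : α) : Prop := w = y ∨ (w = b ∧ s y)

theorem wiring_insert_self {b : α} {s : α → Prop} {l : List α} (hl : l.Nodup) (hb : b ∉ l) :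
    (wiring (Insert b s) l (b :: l) : Q) = collect s l := by
  rw [wiring, wiring_id hl, comp_id (by simp)]
  · refine collect_congr fun a ha => ?_
    have : b ≠ a := fun e => hb (e ▸ ha)
    simp [Insert, this]
  · intro w hw y _
    have : w ≠ b := fun e => hb (e ▸ hw)
    simp [Insert, this]

theorem wiring_insert_of_left {b : α} {s : α → Prop} {l m : List α} (hl : (l ++ m).Nodup)
    (hb : b ∉ l ++ m) (hs : ∀ a ∈ l, ¬ s a) :
    (wiring (Insert b s) (l ++ m) (l ++ b :: m) : Q) = o ^ l.length * collect s m := by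
  obtain ⟨h1, h2, h3⟩ := List.nodup_append.1 hl
  rw [List.mem_append, not_or] at hb
  rw [wiring_append, wiring_id h1, wiring_insert_self h2 hb.2]
  · intro w hw y _
    have : w ≠ b := fun e => hb.1 (e ▸ hw)
    simp [Insert, this]
  · rintro w hw y hy (rfl | ⟨_, h⟩)
    · rcases List.mem_cons.1 hw with rfl | hw
      · exact hb.1 hy
      · exact h3 _ hy _ hw rfl
    · exact hs y hy h
  · rintro w hw y hy (rfl | ⟨rfl, h⟩)
    · exact h3 _ hw _ hy rfl
    · exact hb.1 hw

theorem wiring_insert_of_right {b : α} {s : α → Prop} {l m : List α} (hl : (l ++ m).Nodup)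
    (hb : b ∉ l ++ m) (hs : ∀ a ∈ m, ¬ s a) :
    (wiring (Insert b s) (l ++ m) (l ++ b :: m) : Q) =
      wiring (Insert b s) l (l ++ [b]) * o ^ m.length := by
  obtain ⟨h1, h2, h3⟩ := List.nodup_append.1 hl
  rw [List.mem_append, not_or] at hb
  rw [← List.singleton_append, ← List.append_assoc, wiring_append, wiring_id h2]
  · intro w hw y _
    have : w ≠ b := fun e => hb.2 (e ▸ hw)
    simp [Insert, this]
  · rintro w hw y hy (rfl | ⟨rfl, h⟩)
    · exact h3 _ hy _ hw rfl
    · exact hb.2 hw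
  · rintro w hw y hy (rfl | ⟨_, h⟩)
    · rcases List.mem_append.1 hw with hw | hw
      · exact h3 _ hw _ hy rfl
      · exact hb.2 (List.mem_singleton.1 hw ▸ hy)
    · exact hs y hy h

theorem wiring_insert_append {b : α} {s : α → Prop} {l m : List α} (hl : (l ++ m).Nodup)
    (hb : b ∉ l ++ m) (hs : ∀ a ∈ l, ¬ s a) :
    (wiring (Insert b s) (l ++ m) (l ++ m ++ [b]) : Q) =
      o ^ l.length * wiring (Insert b s) m (m ++ [b]) := by
  obtain ⟨h1, h2, h3⟩ := List.nodup_append.1 hl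
  rw [List.mem_append, not_or] at hb
  rw [List.append_assoc, wiring_append, wiring_id h1]
  · intro w hw y _
    have : w ≠ b := fun e => hb.1 (e ▸ hw)
    simp [Insert, this]
  · rintro w hw y hy (rfl | ⟨_, h⟩)
    · rcases List.mem_append.1 hw with hw | hw
      · exact h3 _ hy _ hw rfl
      · exact hb.1 (List.mem_singleton.1 hw ▸ hy)
    · exact hs y hy h
  · rintro w hw y hy (rfl | ⟨rfl, h⟩)
    · exact h3 _ hw _ hy rfl
    · exact hb.1 hw

/-- A row of a matrix which is a sum of other rows can be computed from them. -/
theorem wiring_comp_insert {β : Type} {M : α → β → Prop} {b : α} {s : α → Prop} {l : List β}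
    {m m' : List α} (hb : b ∉ m) (hm : ∀ w ∈ m', w = b ∨ w ∈ m)
    (hM : ∀ y ∈ l, M b y ↔ ∃ w ∈ m, s w ∧ M w y) :
    (wiring M l m ⨟ wiring (Insert b s) m m' : Q) = wiring M l m' := by
  rw [wiring_comp]
  refine wiring_congr fun w hw y hy => ?_
  rcases hm w hw with rfl | hw
  · rw [hM y hy]
    constructor
    · rintro ⟨w', h1, rfl | ⟨_, h2⟩, h3⟩
      · exact absurd h1 hb
      · exact ⟨w', h1, h2, h3⟩
    · rintro ⟨w', h1, h2, h3⟩
      exact ⟨w', h1, .inr ⟨rfl, h2⟩, h3⟩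
  · constructor
    · rintro ⟨w', h1, rfl | ⟨rfl, h2⟩, h3⟩
      · exact h3
      · exact absurd hw hb
    · intro h
      exact ⟨w, hw, .inl rfl, h⟩

end Insert

end FOC

namespace FOC

open StrictMonoidal DualBialgebra

variable {Q : Type} [DualBialgebra Q]

/-! ### Composable relations -/

/-- The moves of `A ⊸ B`, as numbers. -/
def Present (A B : List Polarity) : Lab → Prop := Sum.elim (· < A.length) (· < B.length)

/-- The moves of `A`, `B` and `C`, as numbers. -/
def Present₃ (A B C : List Polarity) : Lab₃ → Prop :=
  Sum.elim (· < A.length) (Sum.elim (· < B.length) (· < C.length))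

theorem Producer.present {A B : List Polarity} {x : Lab} (h : Producer A B x) : Present A B x := by
  rcases x with x | x
  · exact At.lt h
  · exact At.lt h

theorem Consumer.present {A B : List Polarity} {x : Lab} (h : Consumer A B x) : Present A B x := by
  rcases x with x | x
  · exact At.lt h
  · exact At.lt h

/-- Two composable relations between moves which, together with the orders of the words, generate an
acyclic relation, that is, are contained in a strict order `K`. The relations may have pairs outside
of the moves of `A`, `B` and `C`, except above a present move: the words get shorter in the induction
on scheduled morphisms, whereas the relations remain the same. -/
structure Composable (K : Lab₃ → Lab₃ → Prop) (R S : Lab → Lab → Prop) (A B C : List Polarity) :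
    Prop where
  irrefl : ∀ x, ¬ K x x
  trans : ∀ x y z, K x y → K y z → K x z
  left_le : ∀ x y, R x y → K (inAB x) (inAB y)
  right_le : ∀ x y, S x y → K (inBC x) (inBC y)
  left : ∀ x y, R x y → Present A B x → Producer A B x ∧ Consumer A B y
  right : ∀ x y, S x y → Present B C x → Producer B C x ∧ Consumer B C y
  le_A : ∀ i j, i < j → j < A.length → K (.inl j) (.inl i)
  le_B : ∀ i j, i < j → j < B.length → K (.inr (.inl j)) (.inr (.inl i))
  le_C : ∀ i j, i < j → j < C.length → K (.inr (.inr j)) (.inr (.inr i))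

theorem At.tail {X Y : Polarity} {w : List Polarity} {i : ℕ} (h : At (X :: w) Y i)
    (hi : i < w.length) : At w Y i := by
  rcases h with ⟨rfl, _⟩ | h
  · exact absurd hi (lt_irrefl _)
  · exact h

theorem consumer_src_tail {X : Polarity} {A B : List Polarity} {y : Lab}
    (h : Consumer (X :: A) B y) (h' : X = .O → y ≠ .inl A.length) : Consumer A B y := by
  rcases y with y | y
  · rcases h with ⟨rfl, e⟩ | h
    · exact absurd rfl (h' e)
    · exact h
  · exact h

theorem consumer_tgt_tail {X : Polarity} {A B : List Polarity} {y : Lab}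
    (h : Consumer A (X :: B) y) (h' : X = .P → y ≠ .inr B.length) : Consumer A B y := by
  rcases y with y | y
  · exact h
  · rcases h with ⟨rfl, e⟩ | h
    · exact absurd rfl (h' e)
    · exact h

theorem producer_src_tail {X : Polarity} {A B : List Polarity} {y : Lab}
    (h : Producer (X :: A) B y) (h' : Present A B y) : Producer A B y := by
  rcases y with y | y
  · exact At.tail h h'
  · exact h

theorem producer_tgt_tail {X : Polarity} {A B : List Polarity} {y : Lab}
    (h : Producer A (X :: B) y) (h' : Present A B y) : Producer A B y := by
  rcases y with y | y
  · exact h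
  · exact At.tail h h'

theorem Present.src {X : Polarity} {A B : List Polarity} {y : Lab} (h : Present A B y) :
    Present (X :: A) B y := by
  rcases y with y | y
  · exact Nat.lt_succ_of_lt h
  · exact h

theorem Present.tgt {X : Polarity} {A B : List Polarity} {y : Lab} (h : Present A B y) :
    Present A (X :: B) y := by
  rcases y with y | y
  · exact h
  · exact Nat.lt_succ_of_lt h

namespace Composable

variable {K : Lab₃ → Lab₃ → Prop} {R S : Lab → Lab → Prop} {A B C : List Polarity} {X : Polarity}

/-- A move which is above no other one can be removed. -/
theorem tail_A (h : Composable K R S (X :: A) B C)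
    (fresh : X = .O → ∀ y, Producer A B y → ¬ R y (.inl A.length)) : Composable K R S A B C :=
  { h with
    left := fun x y hR hx => by
      obtain ⟨h1, h2⟩ := h.left x y hR hx.src
      have h1 := producer_src_tail h1 hx
      exact ⟨h1, consumer_src_tail h2 fun e e' => fresh e x h1 (e' ▸ hR)⟩
    le_A := fun i j hi hj => h.le_A i j hi (Nat.lt_succ_of_lt hj) }

theorem tail_B (h : Composable K R S A (X :: B) C)
    (fresh : X = .P → ∀ y, Producer A B y → ¬ R y (.inr B.length))
    (fresh' : X = .O → ∀ y, Producer B C y → ¬ S y (.inl B.length)) : Composable K R S A B C :=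
  { h with
    left := fun x y hR hx => by
      obtain ⟨h1, h2⟩ := h.left x y hR hx.tgt
      have h1 := producer_tgt_tail h1 hx
      exact ⟨h1, consumer_tgt_tail h2 fun e e' => fresh e x h1 (e' ▸ hR)⟩
    right := fun x y hR hx => by
      obtain ⟨h1, h2⟩ := h.right x y hR hx.src
      have h1 := producer_src_tail h1 hx
      exact ⟨h1, consumer_src_tail h2 fun e e' => fresh' e x h1 (e' ▸ hR)⟩
    le_B := fun i j hi hj => h.le_B i j hi (Nat.lt_succ_of_lt hj) }

theorem tail_C (h : Composable K R S A B (X :: C))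
    (fresh : X = .P → ∀ y, Producer B C y → ¬ S y (.inr C.length)) : Composable K R S A B C :=
  { h with
    right := fun x y hR hx => by
      obtain ⟨h1, h2⟩ := h.right x y hR hx.tgt
      have h1 := producer_tgt_tail h1 hx
      exact ⟨h1, consumer_tgt_tail h2 fun e e' => fresh e x h1 (e' ▸ hR)⟩
    le_C := fun i j hi hj => h.le_C i j hi (Nat.lt_succ_of_lt hj) }

/-- The moves which are above a present move are present. -/
theorem reach (h : Composable K R S A B C) {u v : Lab₃}
    (r : Relation.ReflTransGen (Join R S) u v) (hu : Present₃ A B C u) : Present₃ A B C v := by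
  induction r with
  | refl => exact hu
  | tail _ hE ih =>
    rcases hE with ⟨x, y, hR, rfl, rfl⟩ | ⟨x, y, hS, rfl, rfl⟩
    · have := (h.left x y hR (by rcases x with x | x <;> exact ih)).2.present
      rcases y with y | y <;> exact this
    · have := (h.right x y hS (by rcases x with x | x <;> exact ih)).2.present
      rcases y with y | y <;> exact this

/-- One of the three first moves can be added last: otherwise each of them would be above another one,
and there would be a cycle. -/
theorem exists_last (h : Composable K R S A B C) : (A = [] ∧ B = [] ∧ C = []) ∨
    (∃ X A', A = X :: A' ∧ (X = .O → ∀ y, Producer A' B y → ¬ R y (.inl A'.length))) ∨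
    (∃ X B', B = X :: B' ∧ (X = .P → ∀ y, Producer A B' y → ¬ R y (.inr B'.length)) ∧
      (X = .O → ∀ y, Producer B' C y → ¬ S y (.inl B'.length))) ∨
    (∃ X C', C = X :: C' ∧ (X = .P → ∀ y, Producer B C' y → ¬ S y (.inr C'.length))) := by
  by_contra hc
  push Not at hc
  obtain ⟨c0, cA, cB, cC⟩ := hc
  have kB : ∀ {j Y B'}, B = Y :: B' → j < B.length → j = B'.length ∨
      K (.inr (.inl B'.length)) (.inr (.inl j)) := by
    rintro j Y B' rfl hj
    rcases Nat.lt_or_ge j B'.length with h' | h'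
    · exact .inr (h.le_B _ _ h' (Nat.lt_succ_self _))
    · simp at hj
      exact .inl (by omega)
  have kA : ∀ {j Y A'}, A = Y :: A' → j < A.length → j = A'.length ∨
      K (.inl A'.length) (.inl j) := by
    rintro j Y B' rfl hj
    rcases Nat.lt_or_ge j B'.length with h' | h'
    · exact .inr (h.le_A _ _ h' (Nat.lt_succ_self _))
    · simp at hj
      exact .inl (by omega)
  have kC : ∀ {j Y C'}, C = Y :: C' → j < C.length → j = C'.length ∨
      K (.inr (.inr C'.length)) (.inr (.inr j)) := by
    rintro j Y B' rfl hj
    rcases Nat.lt_or_ge j B'.length with h' | h'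
    · exact .inr (h.le_C _ _ h' (Nat.lt_succ_self _))
    · simp at hj
      exact .inl (by omega)
  have hA : ∀ {X A'}, A = X :: A' → ∃ Y B', B = Y :: B' ∧
      K (.inr (.inl B'.length)) (.inl A'.length) := by
    intro X A' e
    obtain ⟨-, y, hy, hR⟩ := cA X A' e
    have k := h.left_le _ _ hR
    rcases y with y | y
    · have lt : y < A'.length := hy.present
      subst e
      exact (h.irrefl _ (h.trans _ _ _ k (h.le_A _ _ lt (Nat.lt_succ_self _)))).elim
    · rcases B with _ | ⟨Y, B'⟩
      · exact hy.elim
      · refine ⟨Y, B', rfl, ?_⟩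
        rcases kB rfl hy.present with rfl | k'
        · exact k
        · exact h.trans _ _ _ k' k
  have hC : ∀ {X C'}, C = X :: C' → ∃ Y B', B = Y :: B' ∧
      K (.inr (.inl B'.length)) (.inr (.inr C'.length)) := by
    intro X C' e
    obtain ⟨-, y, hy, hR⟩ := cC X C' e
    have k := h.right_le _ _ hR
    rcases y with y | y
    · rcases B with _ | ⟨Y, B'⟩
      · exact hy.elim
      · refine ⟨Y, B', rfl, ?_⟩
        rcases kB rfl hy.present with rfl | k'
        · exact k
        · exact h.trans _ _ _ k' k
    · have lt : y < C'.length := hy.present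
      subst e
      exact (h.irrefl _ (h.trans _ _ _ k (h.le_C _ _ lt (Nat.lt_succ_self _)))).elim
  rcases B with _ | ⟨X, B'⟩
  · rcases A with _ | ⟨X, A'⟩
    · rcases C with _ | ⟨X, C'⟩
      · exact c0 rfl rfl rfl
      · obtain ⟨_, _, e, _⟩ := hC rfl
        cases e
    · obtain ⟨_, _, e, _⟩ := hA rfl
      cases e
  · have hB := cB X B' rfl
    by_cases hf : X = .P → ∀ y, Producer A B' y → ¬ R y (.inr B'.length)
    · obtain ⟨-, y, hy, hS⟩ := hB hf
      have k := h.right_le _ _ hS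
      rcases y with y | y
      · have lt : y < B'.length := hy.present
        exact h.irrefl _ (h.trans _ _ _ k (h.le_B _ _ lt (Nat.lt_succ_self _)))
      · rcases C with _ | ⟨Y, C'⟩
        · exact hy.elim
        · obtain ⟨_, _, e, k'⟩ := hC rfl
          cases e
          rcases kC rfl hy.present with rfl | k''
          · exact h.irrefl _ (h.trans _ _ _ k k')
          · exact h.irrefl _ (h.trans _ _ _ k (h.trans _ _ _ k' k''))
    · push Not at hf
      obtain ⟨-, y, hy, hR⟩ := hf
      have k := h.left_le _ _ hR
      rcases y with y | y
      · rcases A with _ | ⟨Y, A'⟩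
        · exact hy.elim
        · obtain ⟨_, _, e, k'⟩ := hA rfl
          cases e
          rcases kA rfl hy.present with rfl | k''
          · exact h.irrefl _ (h.trans _ _ _ k k')
          · exact h.irrefl _ (h.trans _ _ _ k (h.trans _ _ _ k' k''))
      · have lt : y < B'.length := hy.present
        exact h.irrefl _ (h.trans _ _ _ k (h.le_B _ _ lt (Nat.lt_succ_self _)))

end Composable

end FOC

namespace FOC

open StrictMonoidal DualBialgebra

variable {Q : Type} [DualBialgebra Q]

/-! ### Composition of scheduled morphisms -/

theorem inAB_injective : Function.Injective inAB :=
  Sum.map_injective.2 ⟨Function.injective_id, Sum.inl_injective⟩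

theorem inBC_injective : Function.Injective inBC := Sum.inr_injective

theorem inAC_injective : Function.Injective inAC :=
  Sum.map_injective.2 ⟨Function.injective_id, Sum.inr_injective⟩

theorem join_inl {R S : Lab → Lab → Prop} {i : ℕ} {w : Lab₃} :
    Join R S (.inl i) w ↔ ∃ y, R (.inl i) y ∧ inAB y = w := by
  constructor
  · rintro (⟨x | x, y, h, e, rfl⟩ | ⟨x | x, y, h, e, rfl⟩) <;> cases e
    exact ⟨y, h, rfl⟩
  · rintro ⟨y, h, rfl⟩
    exact .inl ⟨_, y, h, rfl, rfl⟩

theorem join_inr {R S : Lab → Lab → Prop} {i : ℕ} {w : Lab₃} :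
    Join R S (.inr (.inr i)) w ↔ ∃ y, S (.inr i) y ∧ inBC y = w := by
  constructor
  · rintro (⟨x | x, y, h, e, rfl⟩ | ⟨x | x, y, h, e, rfl⟩) <;> cases e
    exact ⟨y, h, rfl⟩
  · rintro ⟨y, h, rfl⟩
    exact .inr ⟨_, y, h, rfl, rfl⟩

theorem join_mid {R S : Lab → Lab → Prop} {i : ℕ} {w : Lab₃} :
    Join R S (.inr (.inl i)) w ↔
      (∃ y, R (.inr i) y ∧ inAB y = w) ∨ ∃ y, S (.inl i) y ∧ inBC y = w := by
  constructor
  · rintro (⟨x | x, y, h, e, rfl⟩ | ⟨x | x, y, h, e, rfl⟩) <;> cases e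
    · exact .inl ⟨y, h, rfl⟩
    · exact .inr ⟨y, h, rfl⟩
  · rintro (⟨y, h, rfl⟩ | ⟨y, h, rfl⟩)
    · exact .inl ⟨_, y, h, rfl, rfl⟩
    · exact .inr ⟨_, y, h, rfl, rfl⟩

theorem inAB_ne_inBC {A B C : List Polarity} {x y : Lab} (hx : Consumer A B x)
    (hy : Consumer B C y) : inAB x ≠ inBC y := by
  rcases x with x | x <;> rcases y with y | y <;> intro e <;> cases e
  cases At.unique hx hy

/-- The Proponent moves of `A ⊸ B` and `B ⊸ C`. -/
def consumers₃ (A B C : List Polarity) : List Lab₃ :=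
  (consumers A B).map inAB ++ (consumers B C).map inBC

theorem nodup_consumers₃ (A B C : List Polarity) : (consumers₃ A B C).Nodup := by
  refine List.nodup_append.2 ⟨(nodup_consumers A B).map inAB_injective,
    (nodup_consumers B C).map inBC_injective, ?_⟩
  intro a ha b hb
  obtain ⟨x, hx, rfl⟩ := List.mem_map.1 ha
  obtain ⟨y, hy, rfl⟩ := List.mem_map.1 hb
  exact inAB_ne_inBC ((mem_consumers _ _ _).1 hx) ((mem_consumers _ _ _).1 hy)

theorem present_of_mem_consumers₃ {A B C : List Polarity} {u : Lab₃} (h : u ∈ consumers₃ A B C) :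
    Present₃ A B C u := by
  rcases List.mem_append.1 h with h | h
  · obtain ⟨x, hx, rfl⟩ := List.mem_map.1 h
    have := ((mem_consumers _ _ _).1 hx).present
    rcases x with x | x <;> exact this
  · obtain ⟨x, hx, rfl⟩ := List.mem_map.1 h
    have := ((mem_consumers _ _ _).1 hx).present
    rcases x with x | x <;> exact this

theorem present_inAC {A B C : List Polarity} {x : Lab} (h : Present A C x) :
    Present₃ A B C (inAC x) := by
  rcases x with x | x <;> exact h

/-- The wires of the composite of two scheduled morphisms: a Proponent move of `A ⊸ B` or `B ⊸ C` is
connected to the Proponent moves of `A ⊸ C` which are equal to it or reached from it. -/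
noncomputable def reachWiring (R S : Lab → Lab → Prop) (A B C : List Polarity) : Q :=
  wiring (Relation.ReflTransGen (Join R S)) ((consumers A C).map inAC) (consumers₃ A B C)

theorem insert_map {i : Lab → Lab₃} (hi : Function.Injective i) (s : Lab → Prop)
    (t : Lab₃ → Prop) {b : Lab} {l l' : List Lab} (h : ∀ y ∈ l, s y ↔ t (i y)) :
    (wiring (fun w y => w = y ∨ (w = b ∧ s y)) l l' : Q) =
      wiring (Insert (i b) t) (l.map i) (l'.map i) := by
  rw [wiring_map]
  refine wiring_congr fun w _ y hy => ?_
  rw [Insert, hi.eq_iff, hi.eq_iff, h y hy]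

variable {K : Lab₃ → Lab₃ → Prop} {R S : Lab → Lab → Prop}

theorem reflTransGen_iff_of_ne {α : Type} {r : α → α → Prop} {a b : α} (h : a ≠ b) :
    Relation.ReflTransGen r a b ↔ Relation.TransGen r a b := by
  rw [Relation.reflTransGen_iff_eq_or_transGen]
  exact or_iff_right fun e => h e.symm

theorem transGen_iff_head {α : Type} {r : α → α → Prop} {a b : α} :
    Relation.TransGen r a b ↔ ∃ c, r a c ∧ Relation.ReflTransGen r c b :=
  Relation.TransGen.head'_iff

theorem not_reach_of_terminal {α : Type} {r : α → α → Prop} {a b : α} (h : ∀ c, ¬ r a c)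
    (ne : a ≠ b) : ¬ Relation.ReflTransGen r a b := by
  rw [reflTransGen_iff_of_ne ne, transGen_iff_head]
  rintro ⟨c, hc, _⟩
  exact h c hc

variable {A B C : List Polarity}

/-- The relation of the composite of two strategies: paths between moves of `A` and `C`. -/
def CompRel (R S : Lab → Lab → Prop) (x y : Lab) : Prop :=
  Relation.TransGen (Join R S) (inAC x) (inAC y)

theorem reachWiring_srcO (h : Composable K R S (.O :: A) B C) (h' : Composable K R S A B C) :
    (reachWiring R S (.O :: A) B C : Q) = o * reachWiring R S A B C := by
  have na : ∀ {w}, Present₃ A B C w → w ≠ .inl A.length := by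
    rintro w hw rfl
    exact lt_irrefl _ hw
  have := wiring_append (Q := Q) (R := Relation.ReflTransGen (Join R S)) (l := [.inl A.length])
    (m := (consumers A C).map inAC) (l' := [.inl A.length]) (m' := consumers₃ A B C)
    (by
      intro b hb a ha hr
      rw [List.mem_singleton] at ha
      exact na (h'.reach hr (present_of_mem_consumers₃ hb)) ha)
    (by
      intro b hb a ha
      rw [List.mem_singleton] at hb
      subst hb
      obtain ⟨y, hy, rfl⟩ := List.mem_map.1 ha
      refine not_reach_of_terminal ?_
        (na (present_inAC ((mem_consumers _ _ _).1 hy).present)).symm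
      intro c hc
      rw [join_inl] at hc
      obtain ⟨y, hR, -⟩ := hc
      cases At.unique (w := .O :: A) (h.left _ _ hR (Nat.lt_succ_self _)).1
        (.inl ⟨rfl, rfl⟩ : At (.O :: A) .O A.length))
  rw [wiring_one .refl] at this
  exact this

theorem reachWiring_srcP (h : Composable K R S (.P :: A) B C) :
    (reachWiring R S A B C ⨟ collect (R (.inl A.length)) (consumers A B) *
      o ^ (consumers B C).length : Q) =
      collect (CompRel R S (.inl A.length)) (consumers A C) ⨟ o * reachWiring R S A B C := by
  have e1 : (collect (R (.inl A.length)) (consumers A B) : Q) =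
      collect (Join R S (.inl A.length)) ((consumers A B).map inAB) := by
    rw [collect_map]
    refine collect_congr fun y _ => ?_
    rw [join_inl]
    exact ⟨fun h => ⟨y, h, rfl⟩, fun ⟨y', h, e⟩ => inAB_injective e ▸ h⟩
  have e2 := collect_append_left (Q := Q) (s := Join R S (.inl A.length))
    (m := (consumers B C).map inBC) (by
      intro a ha hE
      rw [join_inl] at hE
      obtain ⟨y, hR, rfl⟩ := hE
      obtain ⟨z, hz, e⟩ := List.mem_map.1 ha
      exact inAB_ne_inBC (h.left _ _ hR (Nat.lt_succ_self _)).2 ((mem_consumers _ _ _).1 hz) e.symm)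
    ((consumers A B).map inAB)
  rw [List.length_map] at e2
  rw [e1, ← e2, reachWiring]
  change _ ⨟ collect _ (consumers₃ A B C) = _
  rw [wiring_collect, collect_map]
  congr 1
  refine collect_congr fun y hy => ?_
  change _ ↔ Relation.TransGen _ _ _
  rw [transGen_iff_head]
  constructor
  · rintro ⟨w, -, h1, h2⟩
    exact ⟨w, h1, h2⟩
  · rintro ⟨w, h1, h2⟩
    refine ⟨w, ?_, h1, h2⟩
    change Join R S (.inl A.length) w at h1
    rw [join_inl] at h1
    obtain ⟨y, hR, rfl⟩ := h1
    exact List.mem_append_left _ (List.mem_map_of_mem ((mem_consumers (.P :: A) B _).2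
      (h.left _ _ hR (Nat.lt_succ_self _)).2))

theorem mid_notMem (A B C : List Polarity) : Sum.inr (.inl B.length) ∉ consumers₃ A B C :=
  fun h => lt_irrefl B.length (present_of_mem_consumers₃ h : B.length < B.length)

theorem mid_ne {x : Lab} : Sum.inr (.inl B.length) ≠ inAC x := by
  rcases x with x | x <;> intro e <;> cases e

theorem reachWiring_midP (h : Composable K R S A (.P :: B) C) :
    (reachWiring R S A B C ⨟
      o ^ (consumers A B).length * collect (S (.inl B.length)) (consumers B C) : Q) =
      reachWiring R S A (.P :: B) C := by
  -- only `S` relates the new move to other ones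
  have hE : ∀ w, Join R S (.inr (.inl B.length)) w ↔ ∃ y, S (.inl B.length) y ∧ inBC y = w := by
    intro w
    rw [join_mid, or_iff_right]
    rintro ⟨y, hR, -⟩
    cases At.unique (w := .P :: B) (h.left _ _ hR (Nat.lt_succ_self _)).1
      (.inl ⟨rfl, rfl⟩ : At (.P :: B) .P B.length)
  have hS : ∀ y, S (.inl B.length) y → Consumer B C y := fun y hy =>
    consumer_src_tail (h.right _ _ hy (Nat.lt_succ_self _)).2 (fun e => by cases e)
  have e1 : (collect (S (.inl B.length)) (consumers B C) : Q) =
      collect (Join R S (.inr (.inl B.length))) ((consumers B C).map inBC) := by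
    rw [collect_map]
    refine collect_congr fun y _ => ?_
    rw [hE]
    exact ⟨fun h => ⟨y, h, rfl⟩, fun ⟨y', h, e⟩ => inBC_injective e ▸ h⟩
  have e2 := wiring_insert_of_left (Q := Q) (s := Join R S (.inr (.inl B.length)))
    (nodup_consumers₃ A B C) (mid_notMem A B C) (by
      intro a ha
      rw [hE]
      rintro ⟨y, hy, rfl⟩
      obtain ⟨z, hz, e⟩ := List.mem_map.1 ha
      exact inAB_ne_inBC ((mem_consumers _ _ _).1 hz) (hS y hy) e)
  rw [List.length_map] at e2
  have e3 : consumers₃ A (.P :: B) C =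
      (consumers A B).map inAB ++ .inr (.inl B.length) :: (consumers B C).map inBC := by
    rw [consumers₃, consumers_tgtP, List.map_append, List.append_assoc]
    rfl
  rw [e1, ← e2, reachWiring, reachWiring, e3]
  refine wiring_comp_insert (mid_notMem A B C) ?_ ?_
  · intro w hw
    rcases List.mem_append.1 hw with hw | hw
    · exact .inr (List.mem_append_left _ hw)
    · exact (List.mem_cons.1 hw).imp id (List.mem_append_right _)
  · intro y hy
    obtain ⟨y, -, rfl⟩ := List.mem_map.1 hy
    rw [reflTransGen_iff_of_ne mid_ne, transGen_iff_head]
    constructor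
    · rintro ⟨w, h1, h2⟩
      refine ⟨w, ?_, h1, h2⟩
      rw [hE] at h1
      obtain ⟨z, hz, rfl⟩ := h1
      exact List.mem_append_right _ (List.mem_map_of_mem ((mem_consumers _ _ _).2 (hS z hz)))
    · rintro ⟨w, -, h1, h2⟩
      exact ⟨w, h1, h2⟩

theorem reachWiring_midO (h : Composable K R S A (.O :: B) C) :
    (reachWiring R S A B C ⨟ wiring (fun w y => w = y ∨ (w = .inr B.length ∧ R w y))
        (consumers A B) (consumers A B ++ [.inr B.length]) * o ^ (consumers B C).length : Q) =
      reachWiring R S A (.O :: B) C := by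
  have hE : ∀ w, Join R S (.inr (.inl B.length)) w ↔ ∃ y, R (.inr B.length) y ∧ inAB y = w := by
    intro w
    rw [join_mid, or_iff_left]
    rintro ⟨y, hR, -⟩
    cases At.unique (w := .O :: B) (h.right _ _ hR (Nat.lt_succ_self _)).1
      (.inl ⟨rfl, rfl⟩ : At (.O :: B) .O B.length)
  have hR : ∀ y, R (.inr B.length) y → Consumer A B y := fun y hy =>
    consumer_tgt_tail (h.left _ _ hy (Nat.lt_succ_self _)).2 (fun e => by cases e)
  have e1 : (wiring (fun w y => w = y ∨ (w = .inr B.length ∧ R w y))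
        (consumers A B) (consumers A B ++ [.inr B.length]) : Q) =
      wiring (Insert (.inr (.inl B.length)) (Join R S (.inr (.inl B.length))))
        ((consumers A B).map inAB) ((consumers A B).map inAB ++ [.inr (.inl B.length)]) := by
    have := insert_map (Q := Q) inAB_injective (R (.inr B.length))
      (Join R S (.inr (.inl B.length))) (b := .inr B.length) (l := consumers A B)
      (l' := consumers A B ++ [.inr B.length]) (fun y _ => by
        rw [hE]
        exact ⟨fun h => ⟨y, h, rfl⟩, fun ⟨y', h, e⟩ => inAB_injective e ▸ h⟩)
    rw [List.map_append] at this
    refine Eq.trans (wiring_congr fun w _ y _ => ?_) this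
    refine or_congr Iff.rfl (and_congr_right fun e => ?_)
    rw [e]
  have e2 := wiring_insert_of_right (Q := Q) (s := Join R S (.inr (.inl B.length)))
    (nodup_consumers₃ A B C) (mid_notMem A B C) (by
      intro a ha
      rw [hE]
      rintro ⟨y, hy, rfl⟩
      obtain ⟨z, hz, e⟩ := List.mem_map.1 ha
      exact inAB_ne_inBC (hR y hy) ((mem_consumers _ _ _).1 hz) e.symm)
  rw [List.length_map] at e2
  rw [e1, ← e2, reachWiring, reachWiring]
  refine wiring_comp_insert (mid_notMem A B C) ?_ ?_
  · intro w hw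
    rcases List.mem_append.1 hw with hw | hw
    · exact .inr (List.mem_append_left _ hw)
    · exact (List.mem_cons.1 hw).imp id (List.mem_append_right _)
  · intro y hy
    obtain ⟨y, -, rfl⟩ := List.mem_map.1 hy
    rw [reflTransGen_iff_of_ne mid_ne, transGen_iff_head]
    constructor
    · rintro ⟨w, h1, h2⟩
      refine ⟨w, ?_, h1, h2⟩
      rw [hE] at h1
      obtain ⟨z, hz, rfl⟩ := h1
      exact List.mem_append_left _ (List.mem_map_of_mem ((mem_consumers _ _ _).2 (hR z hz)))
    · rintro ⟨w, -, h1, h2⟩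
      exact ⟨w, h1, h2⟩

theorem tgt_notMem (A B C : List Polarity) : Sum.inr (.inr C.length) ∉ consumers₃ A B C :=
  fun h => lt_irrefl C.length (present_of_mem_consumers₃ h : C.length < C.length)

theorem tgt_ne {x : Lab} (h : Present A C x) : Sum.inr (.inr C.length) ≠ inAC x := by
  rcases x with x | x <;> intro e <;> cases e
  exact lt_irrefl C.length h

theorem reachWiring_tgtO (h : Composable K R S A B (.O :: C)) :
    (reachWiring R S A B C ⨟ o ^ (consumers A B).length *
      wiring (fun w y => w = y ∨ (w = .inr C.length ∧ S w y))
        (consumers B C) (consumers B C ++ [.inr C.length]) : Q) =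
      wiring (fun w y => w = y ∨ (w = .inr C.length ∧ CompRel R S w y))
        (consumers A C) (consumers A C ++ [.inr C.length]) ⨟ reachWiring R S A B C * o := by
  have hS : ∀ y, S (.inr C.length) y → Consumer B C y := fun y hy =>
    consumer_tgt_tail (h.right _ _ hy (Nat.lt_succ_self _)).2 (fun e => by cases e)
  have e1 : (wiring (fun w y => w = y ∨ (w = .inr C.length ∧ S w y))
        (consumers B C) (consumers B C ++ [.inr C.length]) : Q) =
      wiring (Insert (.inr (.inr C.length)) (Join R S (.inr (.inr C.length))))
        ((consumers B C).map inBC) ((consumers B C).map inBC ++ [.inr (.inr C.length)]) := by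
    have := insert_map (Q := Q) inBC_injective (S (.inr C.length))
      (Join R S (.inr (.inr C.length))) (b := .inr C.length) (l := consumers B C)
      (l' := consumers B C ++ [.inr C.length]) (fun y _ => by
        rw [join_inr]
        exact ⟨fun h => ⟨y, h, rfl⟩, fun ⟨y', h, e⟩ => inBC_injective e ▸ h⟩)
    rw [List.map_append] at this
    refine Eq.trans (wiring_congr fun w _ y _ => ?_) this
    refine or_congr Iff.rfl (and_congr_right fun e => ?_)
    rw [e]
  have e2 := wiring_insert_append (Q := Q) (s := Join R S (.inr (.inr C.length)))
    (nodup_consumers₃ A B C) (tgt_notMem A B C) (by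
      intro a ha
      rw [join_inr]
      rintro ⟨y, hy, rfl⟩
      obtain ⟨z, hz, e⟩ := List.mem_map.1 ha
      exact inAB_ne_inBC ((mem_consumers _ _ _).1 hz) (hS y hy) e)
  rw [List.length_map] at e2
  -- the wiring of the present moves, next to the new move
  let M : Lab₃ → Lab₃ → Prop := fun w y => (w = .inr (.inr C.length) ∧ y = .inr (.inr C.length)) ∨
    (w ≠ .inr (.inr C.length) ∧ y ≠ .inr (.inr C.length) ∧ Relation.ReflTransGen (Join R S) w y)
  have ne : ∀ y ∈ (consumers A C).map inAC, y ≠ .inr (.inr C.length) := by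
    intro y hy
    obtain ⟨z, hz, rfl⟩ := List.mem_map.1 hy
    exact (tgt_ne ((mem_consumers _ _ _).1 hz).present).symm
  have ne' : ∀ w ∈ consumers₃ A B C, w ≠ .inr (.inr C.length) := by
    rintro w hw rfl
    exact tgt_notMem A B C hw
  have e3 : (reachWiring R S A B C * o : Q) = wiring M
      ((consumers A C).map inAC ++ [.inr (.inr C.length)])
      (consumers₃ A B C ++ [.inr (.inr C.length)]) := by
    rw [wiring_append, wiring_one (.inl ⟨rfl, rfl⟩), reachWiring]
    · congr 1
      refine wiring_congr fun w hw y hy => ?_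
      simp [M, ne y hy, ne' w hw]
    · rintro w hw y hy (⟨-, rfl⟩ | ⟨h, -⟩)
      · exact ne _ hy rfl
      · exact h (List.mem_singleton.1 hw)
    · rintro w hw y hy (⟨rfl, -⟩ | ⟨-, h, -⟩)
      · exact ne' _ hw rfl
      · exact h (List.mem_singleton.1 hy)
  have e4 : (wiring (fun w y => w = y ∨ (w = .inr C.length ∧ CompRel R S w y))
        (consumers A C) (consumers A C ++ [.inr C.length]) : Q) =
      wiring (Insert (.inr (.inr C.length)) (Relation.TransGen (Join R S) (.inr (.inr C.length))))
        ((consumers A C).map inAC) ((consumers A C).map inAC ++ [.inr (.inr C.length)]) := by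
    have := insert_map (Q := Q) inAC_injective (CompRel R S (.inr C.length))
      (Relation.TransGen (Join R S) (.inr (.inr C.length))) (b := .inr C.length)
      (l := consumers A C) (l' := consumers A C ++ [.inr C.length]) (fun y _ => Iff.rfl)
    rw [List.map_append] at this
    refine Eq.trans (wiring_congr fun w _ y _ => ?_) this
    refine or_congr Iff.rfl (and_congr_right fun e => ?_)
    rw [e]
  rw [e1]
  change _ ⨟ _ = _
  rw [← e2, e3, e4, reachWiring]
  change wiring _ _ (consumers₃ A B C) ⨟ wiring _ (consumers₃ A B C) (consumers₃ A B C ++ _) = _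
  rw [wiring_comp_insert (tgt_notMem A B C), wiring_comp]
  · refine wiring_congr fun w hw y hy => ?_
    rcases List.mem_append.1 hw with hw | hw
    · constructor
      · exact fun h => ⟨y, List.mem_append_left _ hy, .inr ⟨ne' w hw, ne y hy, h⟩, .inl rfl⟩
      · rintro ⟨z, -, ⟨rfl, -⟩ | ⟨-, h1, h2⟩, rfl | ⟨rfl, -⟩⟩
        · exact absurd rfl (ne' _ hw)
        · exact absurd rfl (ne' _ hw)
        · exact h2
        · exact absurd rfl h1
    · rw [List.mem_singleton] at hw
      subst hw
      rw [reflTransGen_iff_of_ne (ne y hy).symm]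
      constructor
      · exact fun h => ⟨_, List.mem_append_right _ (List.mem_singleton_self _), .inl ⟨rfl, rfl⟩,
          .inr ⟨rfl, h⟩⟩
      · rintro ⟨z, -, ⟨-, rfl⟩ | ⟨h1, -⟩, rfl | ⟨-, h2⟩⟩
        · exact absurd rfl (ne _ hy)
        · exact h2
        · exact absurd rfl h1
        · exact absurd rfl h1
  · intro w hw
    rcases List.mem_append.1 hw with hw | hw
    · exact .inr hw
    · exact .inl (List.mem_singleton.1 hw)
  · intro y hy
    rw [reflTransGen_iff_of_ne (ne y hy).symm, transGen_iff_head]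
    constructor
    · rintro ⟨w, h1, h2⟩
      refine ⟨w, ?_, h1, h2⟩
      rw [join_inr] at h1
      obtain ⟨z, hz, rfl⟩ := h1
      exact List.mem_append_right _ (List.mem_map_of_mem ((mem_consumers _ _ _).2 (hS z hz)))
    · rintro ⟨w, -, h1, h2⟩
      exact ⟨w, h1, h2⟩

theorem reachWiring_tgtP (h : Composable K R S A B (.P :: C)) (h' : Composable K R S A B C) :
    (reachWiring R S A B (.P :: C) : Q) = reachWiring R S A B C * o := by
  have na : ∀ {w}, Present₃ A B C w → w ≠ .inr (.inr C.length) := by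
    rintro w hw rfl
    exact lt_irrefl C.length hw
  have := wiring_append (Q := Q) (R := Relation.ReflTransGen (Join R S))
    (l := (consumers A C).map inAC) (m := [.inr (.inr C.length)]) (l' := consumers₃ A B C)
    (m' := [.inr (.inr C.length)])
    (by
      intro b hb a ha
      rw [List.mem_singleton] at hb
      subst hb
      obtain ⟨y, hy, rfl⟩ := List.mem_map.1 ha
      refine not_reach_of_terminal ?_ (tgt_ne ((mem_consumers _ _ _).1 hy).present)
      intro c hc
      rw [join_inr] at hc
      obtain ⟨y, hR, -⟩ := hc
      cases At.unique (w := .P :: C) (h.right _ _ hR (Nat.lt_succ_self _)).1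
        (.inl ⟨rfl, rfl⟩ : At (.P :: C) .P C.length))
    (by
      intro b hb a ha hr
      rw [List.mem_singleton] at ha
      exact na (h'.reach hr (present_of_mem_consumers₃ hb)) ha)
  rw [wiring_one .refl] at this
  rw [reachWiring, consumers₃, consumers_tgtP, consumers_tgtP, List.map_append, List.map_append,
    ← List.append_assoc]
  exact this

/-- The composition of scheduled morphisms follows the composition of strategies: the moves of the
three words can be added one by one, since their orders and the two relations generate an acyclic
relation, and each of them is added to the two composed morphisms and to their composite
simultaneously. -/
theorem exists_rep_comp (Q : Type) [DualBialgebra Q] {K : Lab₃ → Lab₃ → Prop}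
    {R S : Lab → Lab → Prop} {A B C : List Polarity} (hc : Composable K R S A B C) :
    ∃ f g h : Q, Rep R A B f ∧ Rep S B C g ∧ Rep (CompRel R S) A C h ∧
      f ⨟ o ^ (consumers A B).length * g = h ⨟ reachWiring R S A B C * word C := by
  induction n : A.length + (B.length + C.length) using Nat.strong_induction_on
    generalizing A B C with
  | _ n ih =>
  subst n
  have len : ∀ A B C, (tgt (reachWiring R S A B C) : Q) =
      o ^ (consumers A B).length * o ^ (consumers B C).length := by
    intro A B C
    rw [reachWiring, tgt_wiring, consumers₃, List.length_append, List.length_map, List.length_map,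
      pow_add]
  have len' : ∀ A B C, (src (reachWiring R S A B C) : Q) = o ^ (consumers A C).length := by
    intro A B C
    rw [reachWiring, src_wiring, List.length_map]
  rcases hc.exists_last with ⟨rfl, rfl, rfl⟩ | ⟨X, A', rfl, fresh⟩ | ⟨X, B', rfl, fresh, fresh'⟩ |
    ⟨X, C', rfl, fresh⟩
  · exact ⟨1, 1, 1, .nil, .nil, .nil, by
      simp [reachWiring, wiring, consumers₃, consumers, srcConsumers, tgtConsumers]⟩
  · have hc' := hc.tail_A fresh
    obtain ⟨f, g, h, hf, hg, hh, e⟩ := ih _ (by simp) hc' rfl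
    cases X with
    | O =>
      refine ⟨_, g, _, hf.srcO (fresh rfl), hg, hh.srcO ?_, ?_⟩
      · intro y hy hr
        exact lt_irrefl _ (hc'.reach hr.to_reflTransGen (present_inAC hy.present) :
          Present₃ A' B C (.inl A'.length))
      · rw [reachWiring_srcO hc hc', consumers_srcO, List.length_cons, pow_succ']
        exact comp_step_srcO e
    | P =>
      refine ⟨_, g, _, hf.srcP, hg, hh.srcP, ?_⟩
      exact comp_step_srcP (src_word _) hg.src_tgt.1 hg.src_tgt.2 (len' _ _ _) (len _ _ _)
        (src_collect _ _) (tgt_collect _ _) e (reachWiring_srcP hc)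
  · have hc' := hc.tail_B fresh fresh'
    obtain ⟨f, g, h, hf, hg, hh, e⟩ := ih _ (by simp) hc' rfl
    cases X with
    | O =>
      refine ⟨_, _, h, hf.tgtO, hg.srcO (fresh' rfl), hh, ?_⟩
      exact comp_step_midO (src_word _) hg.src_tgt.1 hg.src_tgt.2 (src_wiring _ _ _)
        ((tgt_wiring _ _ _).trans (by rw [List.length_append]; rfl)) e (reachWiring_midO hc)
    | P =>
      refine ⟨_, _, h, hf.tgtP (fresh rfl), hg.srcP, hh, ?_⟩
      have := comp_step_midP (src_word _) hg.src_tgt.1 hg.src_tgt.2 (src_collect _ _)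
        (tgt_collect _ _) e (reachWiring_midP hc)
      rwa [consumers_tgtP, List.length_append, List.length_singleton]
  · have hc' := hc.tail_C fresh
    obtain ⟨f, g, h, hf, hg, hh, e⟩ := ih _ (by simp) hc' rfl
    cases X with
    | O =>
      refine ⟨f, _, _, hf, hg.tgtO, hh.tgtO, ?_⟩
      exact comp_step_tgtO (src_word _) e (reachWiring_tgtO hc)
    | P =>
      refine ⟨f, _, _, hf, hg.tgtP (fresh rfl), hh.tgtP ?_, ?_⟩
      · intro y hy hr
        exact lt_irrefl C'.length (hc'.reach hr.to_reflTransGen (present_inAC hy.present) :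
          Present₃ A B C' (.inr (.inr C'.length)))
      · rw [reachWiring_tgtP hc hc']
        exact comp_step_tgtP (src_word _) e (len' _ _ _) (len _ _ _)

end FOC

namespace FOC

open StrictMonoidal DualBialgebra

variable {Q : Type} [DualBialgebra Q]

/-! ### Juxtaposition of scheduled morphisms -/

/-- The translation of the moves of `A ⊸ B` among those of `A ++ C ⊸ B ++ D`, where `C` and `D` have
`c` and `d` moves. -/
def shiftLab (c d : ℕ) : Lab → Lab := Sum.map (· + c) (· + d)

theorem shiftLab_injective (c d : ℕ) : Function.Injective (shiftLab c d) :=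
  Sum.map_injective.2 ⟨add_left_injective c, add_left_injective d⟩

theorem at_append (A C : List Polarity) (X : Polarity) (i : ℕ) :
    At (A ++ C) X (i + C.length) ↔ At A X i := by
  induction A with
  | nil =>
    refine ⟨fun h => ?_, False.elim⟩
    have := At.lt h
    simp at this
  | cons Y A ih =>
    rw [List.cons_append, At, At, ih, List.length_append, Nat.add_right_cancel_iff]

theorem producer_shiftLab {A B C D : List Polarity} {x : Lab} :
    Producer (A ++ C) (B ++ D) (shiftLab C.length D.length x) ↔ Producer A B x := by
  rcases x with x | x
  · exact at_append _ _ _ _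
  · exact at_append _ _ _ _

theorem consumer_shiftLab {A B C D : List Polarity} {x : Lab} :
    Consumer (A ++ C) (B ++ D) (shiftLab C.length D.length x) ↔ Consumer A B x := by
  rcases x with x | x
  · exact at_append _ _ _ _
  · exact at_append _ _ _ _

theorem not_present_shiftLab {C D : List Polarity} {x : Lab} :
    ¬ Present C D (shiftLab C.length D.length x) := by
  rcases x with x | x
  · exact fun h => absurd (show x + C.length < C.length from h) (by omega)
  · exact fun h => absurd (show x + D.length < D.length from h) (by omega)

-- In this section, `f` is a scheduled morphism, `g` is an arbitrary morphism with target `U`, `h` is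
-- the scheduled morphism of the juxtaposition, and `X` is the wiring which keeps the wires of `f` among
-- those of `h`. Each lemma adds a move to both sides of the equation.
section Steps

variable {f h k V W U X Y Z c c' g : Q}

theorem comp_mul (hU : tgt g = U) (ψ : Q) (hψ : tgt f = src ψ) : (f ⨟ ψ) * g = f * g ⨟ ψ * U := by
  have hU' : src U = U := by rw [← hU, src_tgt]
  rw [interchange hψ (hU.trans hU'.symm), comp_id hU]

theorem mul_step_srcP {n j : ℕ} (hU : tgt g = U) (hV : src V = V) (hf : tgt f = o ^ n * V)
    (hX : src X = o ^ j) (hX' : tgt X = o ^ n) (hc : src c = o ^ n) (hc' : tgt c = o * o ^ n)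
    (ih : f * g = h ⨟ X * (V * U)) (key : X ⨟ c = c' ⨟ o * X) :
    (p * f ⨟ p * c * V ⨟ counit * o ^ n * V) * g =
      (p * h ⨟ p * c' * (V * U) ⨟ counit * o ^ j * (V * U)) ⨟ X * (V * U) := by
  have hU' : src U = U := by rw [← hU, src_tgt]
  have hV' := tgt_of_src hV
  have hU2 := tgt_of_src hU'
  have hVU : src (V * U) = V * U := by rw [src_mul, hV, hU']
  rw [srcP_comp (by rw [src_mul, hX, hVU]), ← comp_assoc,
    comp_mul hU, comp_mul hU, mul_assoc p f, ih, mul_assoc _ V U, mul_assoc _ V U,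
    ← mul_assoc o X, ← whisker_right _ _ _ hVU, ← key, whisker_right _ _ _ hVU]
  · simp [hX', hV', hU2, comp_assoc, mul_assoc]
    simp [whisker_left _ _ _ (src_p (Q := Q)), comp_assoc]
  · simp [hf, hc, hV, mul_assoc]
  · rw [tgt_comp _ _ (by simp [hf, hc, hV, mul_assoc])]
    simp [hc', hV, hV', mul_assoc]

theorem mul_step_tgtO {n : ℕ} (hU : tgt g = U) (hV : src V = V) (hf : tgt f = o ^ n * V)
    (hY : src Y = o ^ n) (ih : f * g = h ⨟ X * (V * U)) (key : X ⨟ Y = Z ⨟ X * o) :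
    (f ⨟ Y * V) * g = (h ⨟ Z * (V * U)) ⨟ X * (o * (V * U)) := by
  have hU' : src U = U := by rw [← hU, src_tgt]
  have hVU : src (V * U) = V * U := by rw [src_mul, hV, hU']
  rw [comp_mul hU _ (by simp [hf, hY, hV]), ih, comp_assoc, mul_assoc Y, ← whisker_right _ _ _ hVU,
    key, whisker_right _ _ _ hVU, comp_assoc, mul_assoc X]

theorem mul_step_tgtP {n j : ℕ} (hU : tgt g = U) (hV : src V = V) (hf : tgt f = o ^ n * V)
    (hX : src X = o ^ j) (hX' : tgt X = o ^ n) (ih : f * g = h ⨟ X * (V * U)) :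
    (f ⨟ o ^ n * unit * V) * g = (h ⨟ o ^ j * unit * (V * U)) ⨟ X * o * (p * (V * U)) := by
  have hU' : src U = U := by rw [← hU, src_tgt]
  have hU2 := tgt_of_src hU'
  have e := exchange X (unit * (V * U))
  simp only [hX, hX', src_mul, tgt_mul, src_unit, tgt_unit, hV, hU', tgt_of_src hV, hU2, one_mul,
    mul_assoc] at e
  rw [comp_mul hU _ (by simp [hf, hV]), ih, comp_assoc, comp_assoc, mul_assoc _ V U,
    mul_assoc (o ^ n), e, mul_assoc, mul_assoc]

end Steps

/-- The wires of the left one of two juxtaposed scheduled morphisms, among all of them. -/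
noncomputable def leftWiring (A B C D : List Polarity) : Q :=
  wiring (fun w y => shiftLab C.length D.length w = y) (consumers (A ++ C) (B ++ D)) (consumers A B)

variable {A B C D : List Polarity}

theorem leftWiring_srcO : (leftWiring (.O :: A) B C D : Q) = o * leftWiring A B C D := by
  have e : (Sum.inl (A ++ C).length : Lab) = shiftLab C.length D.length (.inl A.length) := by
    simp [shiftLab]
  have := wiring_append (Q := Q) (R := fun w y => shiftLab C.length D.length w = y)
    (l := [.inl (A ++ C).length]) (m := consumers (A ++ C) (B ++ D)) (l' := [.inl A.length])
    (m' := consumers A B)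
    (by
      intro b hb a ha h
      rw [List.mem_singleton.1 ha, e] at h
      exact src_notMem_consumers A B (shiftLab_injective _ _ h ▸ hb))
    (by
      intro b hb a ha h
      rw [List.mem_singleton.1 hb, ← e] at h
      exact src_notMem_consumers (A ++ C) (B ++ D) (h ▸ ha))
  rw [wiring_one (R := fun w y => shiftLab C.length D.length w = y) e.symm] at this
  exact this

theorem leftWiring_tgt : (leftWiring A B C D * o : Q) =
    wiring (fun w y => shiftLab C.length D.length w = y)
      (consumers (A ++ C) (B ++ D) ++ [.inr (B ++ D).length]) (consumers A B ++ [.inr B.length]) := by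
  have e : (Sum.inr (B ++ D).length : Lab) = shiftLab C.length D.length (.inr B.length) := by
    simp [shiftLab]
  rw [wiring_append, wiring_one (R := fun w y => shiftLab C.length D.length w = y) e.symm, leftWiring]
  · intro b hb a ha h
    rw [List.mem_singleton.1 hb, ← e] at h
    exact tgt_notMem_consumers (A ++ C) (B ++ D) (h ▸ ha)
  · intro b hb a ha h
    rw [List.mem_singleton.1 ha, e] at h
    exact tgt_notMem_consumers A B (shiftLab_injective _ _ h ▸ hb)

theorem juxt_shiftLab {R S : Lab → Lab → Prop} (hS : ∀ x y, S x y → Producer C D x) (x y : Lab) :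
    Juxt R S C.length D.length (shiftLab C.length D.length x) y ↔
      ∃ z, R x z ∧ shiftLab C.length D.length z = y := by
  constructor
  · rintro (⟨x', z, h, e, rfl⟩ | h)
    · cases shiftLab_injective _ _ e
      exact ⟨z, h, rfl⟩
    · exact absurd (hS _ _ h).present not_present_shiftLab
  · rintro ⟨z, h, rfl⟩
    exact .inl ⟨x, z, h, rfl, rfl⟩

/-- The juxtaposition of scheduled morphisms follows the juxtaposition of strategies. The moves of the
right morphism `g` are added first, and its wires are discarded; those of the left one `f` are then
added one by one. -/
theorem exists_rep_tensor {R S : Lab → Lab → Prop} {f g : Q}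
    (hS : ∀ x y, S x y → Producer C D x ∧ Consumer C D y) (hf : Rep R A B f) (hg : Rep S C D g) :
    ∃ h : Q, Rep (Juxt R S C.length D.length) (A ++ C) (B ++ D) h ∧
      f * (g ⨟ eps ^ (consumers C D).length * word D) =
        h ⨟ leftWiring A B C D * (word B * word D) := by
  have hS' := fun x y h => (hS x y h).1
  have hU : tgt (g ⨟ eps ^ (consumers C D).length * word D) = word D := by
    rw [tgt_comp _ _ (by simp [hg.src_tgt])]
    simp
  have mem : ∀ {A B : List Polarity} {a x y}, Juxt R S C.length D.length
      (shiftLab C.length D.length a) y → y ∈ consumers (A ++ C) (B ++ D) →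
      R a x → shiftLab C.length D.length x = y → x ∈ consumers A B := by
    rintro A B a x y _ hy _ rfl
    exact (mem_consumers _ _ _).2 (consumer_shiftLab.1 ((mem_consumers _ _ _).1 hy))
  induction hf with
  | nil =>
    refine ⟨g, hg.congr fun x y hx hy => ⟨.inr, ?_⟩, ?_⟩
    · rintro (⟨x, y, h, rfl, rfl⟩ | h)
      · exact absurd hx.present not_present_shiftLab
      · exact h
    · rw [one_mul, word_nil, one_mul]
      rfl
  | @srcO A B f hf fresh ih =>
    obtain ⟨h, hh, e⟩ := ih
    refine ⟨_, hh.srcO ?_, ?_⟩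
    · rintro y hy (⟨x, z, hR, rfl, ez⟩ | h)
      · have e' : (Sum.inl (A ++ C).length : Lab) = shiftLab C.length D.length (.inl A.length) := by
          simp [shiftLab]
        cases shiftLab_injective _ _ (ez.trans e')
        exact fresh x (producer_shiftLab.1 hy) hR
      · have := (hS _ _ h).2.present
        simp [Present] at this
    · rw [leftWiring_srcO, mul_assoc, e, whisker_left _ _ _ src_o, mul_assoc]
  | @srcP A B f hf ih =>
    obtain ⟨h, hh, e⟩ := ih
    refine ⟨_, hh.srcP, ?_⟩
    rw [word_append]
    refine mul_step_srcP hU (src_word _) hf.src_tgt.2 (src_wiring _ _ _) (tgt_wiring _ _ _)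
      (src_collect _ _) (tgt_collect _ _) e ?_
    change leftWiring A B C D ⨟ _ = _ ⨟ o * leftWiring A B C D
    rw [leftWiring, wiring_collect]
    congr 1
    refine collect_congr fun y hy => ?_
    have e' : (Sum.inl (A ++ C).length : Lab) = shiftLab C.length D.length (.inl A.length) := by
      simp [shiftLab]
    rw [e', juxt_shiftLab hS']
    constructor
    · rintro ⟨w, -, h1, h2⟩
      exact ⟨w, h1, h2⟩
    · rintro ⟨w, h1, h2⟩
      exact ⟨w, mem ((juxt_shiftLab hS' _ _).2 ⟨w, h1, h2⟩) hy h1 h2, h1, h2⟩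
  | @tgtO A B f hf ih =>
    obtain ⟨h, hh, e⟩ := ih
    refine ⟨_, hh.tgtO, ?_⟩
    rw [word_append, word_cons_O, mul_assoc]
    change _ = _ ⨟ leftWiring A B C D * _
    refine mul_step_tgtO hU (src_word _) hf.src_tgt.2 (src_wiring _ _ _) e ?_
    have e' : (Sum.inr (B ++ D).length : Lab) = shiftLab C.length D.length (.inr B.length) := by
      simp [shiftLab]
    rw [leftWiring_tgt, leftWiring, wiring_comp, wiring_comp]
    refine wiring_congr fun w hw y hy => ?_
    rw [e']
    rcases List.mem_append.1 hw with hw | hw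
    · constructor
      · rintro ⟨w', hw', rfl | ⟨rfl, -⟩, rfl⟩
        · exact ⟨_, List.mem_append_left _ hy, rfl, .inl rfl⟩
        · exact absurd hw (tgt_notMem_consumers A B)
      · rintro ⟨w', -, rfl, rfl | ⟨h1, -⟩⟩
        · exact ⟨w, hw, .inl rfl, rfl⟩
        · rw [shiftLab_injective _ _ h1] at hw
          exact absurd hw (tgt_notMem_consumers A B)
    · rw [List.mem_singleton] at hw
      subst hw
      constructor
      · rintro ⟨w', hw', rfl | ⟨-, h1⟩, rfl⟩
        · exact absurd hw' (tgt_notMem_consumers A B)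
        · exact ⟨_, List.mem_append_right _ (List.mem_singleton_self _), rfl,
            .inr ⟨rfl, (juxt_shiftLab hS' _ _).2 ⟨w', h1, rfl⟩⟩⟩
      · rintro ⟨w', -, rfl, rfl | ⟨-, h1⟩⟩
        · rw [← e'] at hy
          exact absurd hy (tgt_notMem_consumers _ _)
        · obtain ⟨z, h2, h3⟩ := (juxt_shiftLab hS' _ _).1 h1
          exact ⟨z, mem h1 hy h2 h3, .inr ⟨rfl, h2⟩, h3⟩
  | @tgtP A B f hf fresh ih =>
    obtain ⟨h, hh, e⟩ := ih
    have e' : (Sum.inr (B ++ D).length : Lab) = shiftLab C.length D.length (.inr B.length) := by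
      simp [shiftLab]
    refine ⟨_, hh.tgtP ?_, ?_⟩
    · rintro y hy (⟨x, z, hR, rfl, ez⟩ | h)
      · cases shiftLab_injective _ _ (ez.trans e')
        exact fresh x (producer_shiftLab.1 hy) hR
      · have := (hS _ _ h).2.present
        simp [Present] at this
    · have l' : (leftWiring A (.P :: B) C D : Q) = leftWiring A B C D * o := by
        rw [leftWiring_tgt, leftWiring, List.cons_append, consumers_tgtP, consumers_tgtP]
      rw [l', word_append, word_cons_P, mul_assoc p]
      exact mul_step_tgtP hU (src_word _) hf.src_tgt.2 (src_wiring _ _ _) (tgt_wiring _ _ _) e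

end FOC

namespace FOC

open StrictMonoidal DualBialgebra

/-! ### Acyclicity of strategies -/

theorem exists_idx : ∀ {w : List Polarity} {i : ℕ}, i < w.length → ∃ m, idx w m = i
  | [], _, h => absurd h (Nat.not_lt_zero _)
  | _ :: w, i, h => by
    rcases Nat.lt_succ_iff_lt_or_eq.1 h with h | rfl
    · obtain ⟨m, rfl⟩ := exists_idx h
      exact ⟨.inr m, rfl⟩
    · exact ⟨.inl (), rfl⟩

theorem le_of_idx_lt : ∀ {w : List Polarity} {m n : (wordGame w).Moves}, idx w n < idx w m →
    (wordGame w).le m n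
  | [], m, _, _ => Empty.elim m
  | _ :: _, .inl _, .inl _, h => absurd h (lt_irrefl _)
  | _ :: _, .inl _, .inr _, _ => .sep _ _
  | _ :: w, .inr m, .inl _, h => absurd h (idx_lt w m).le.not_gt
  | _ :: _, .inr _, .inr _, h => .inr (le_of_idx_lt h)

theorem ne_of_idx_lt {w : List Polarity} {m n : (wordGame w).Moves} (h : idx w n < idx w m) :
    m ≠ n := by
  rintro rfl
  exact lt_irrefl _ h

/-- The compatibility of a strategy with the order of the game is the acyclicity of its edges. -/
theorem acyclic_edge {A B : List Polarity} (σ : WordStrategy A B) : Acyclic (edge σ) A B := by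
  refine ⟨Relation.Map (fun m n => Closure ((wordGame A).arrow (wordGame B).toGame) σ.le m n ∧ m ≠ n)
    lab lab, ?_, ?_, ?_, ?_, ?_⟩
  · rintro _ ⟨m, n, ⟨h, ne⟩, rfl, e⟩
    exact ne (lab_injective e).symm
  · rintro _ _ _ ⟨m, n, ⟨h, ne⟩, rfl, rfl⟩ ⟨n', k, ⟨h', ne'⟩, e, rfl⟩
    cases lab_injective e
    refine ⟨m, k, ⟨h.trans h', ?_⟩, rfl, rfl⟩
    rintro rfl
    exact ne (σ.compatible _ _ h h')
  · rintro _ _ - ⟨m, n, h, ne, rfl, rfl⟩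
    exact ⟨m, n, ⟨.single (.inr h), ne⟩, rfl, rfl⟩
  · intro i j h hj
    obtain ⟨m, rfl⟩ := exists_idx hj
    obtain ⟨n, rfl⟩ := exists_idx (h.trans hj)
    exact ⟨.inl m, .inl n, ⟨.single (.inl (.inl (le_of_idx_lt h))),
      Sum.inl_injective.ne (ne_of_idx_lt h)⟩, rfl, rfl⟩
  · intro i j h hj
    obtain ⟨m, rfl⟩ := exists_idx hj
    obtain ⟨n, rfl⟩ := exists_idx (h.trans hj)
    exact ⟨.inr m, .inr n, ⟨.single (.inl (.inr (le_of_idx_lt h))),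
      Sum.inr_injective.ne (ne_of_idx_lt h)⟩, rfl, rfl⟩

/-- The orders of two composable strategies and of the three games generate an acyclic relation: it is
contained in the order `Amalgam`. -/
theorem composable_edge {A B C : List Polarity} (σ : WordStrategy A B) (τ : WordStrategy B C) :
    Composable (Relation.Map (fun m n => Amalgam σ τ m n ∧ m ≠ n) lab₃ lab₃) (edge σ) (edge τ)
      A B C where
  irrefl := by
    rintro _ ⟨m, n, ⟨h, ne⟩, rfl, e⟩
    exact ne (lab₃_injective e).symm
  trans := by
    rintro _ _ _ ⟨m, n, ⟨h, ne⟩, rfl, rfl⟩ ⟨n', k, ⟨h', ne'⟩, e, rfl⟩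
    cases lab₃_injective e
    refine ⟨m, k, ⟨amalgam_trans _ _ _ _ _ h h', ?_⟩, rfl, rfl⟩
    rintro rfl
    exact ne (amalgam_antisymm _ _ _ _ h h')
  left_le := by
    rintro _ _ ⟨m, n, h, ne, rfl, rfl⟩
    exact ⟨_, _, ⟨amalgam_of_compStep _ _ _ _ (.left m n h),
      (Sum.map_injective.2 ⟨Function.injective_id, Sum.inl_injective⟩).ne ne⟩,
      lab₃_inAB m, lab₃_inAB n⟩
  right_le := by
    rintro _ _ ⟨m, n, h, ne, rfl, rfl⟩
    exact ⟨_, _, ⟨amalgam_of_compStep _ _ _ _ (.right m n h), Sum.inr_injective.ne ne⟩, rfl, rfl⟩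
  left := fun _ _ h _ => ⟨edge_producer h, edge_consumer h⟩
  right := fun _ _ h _ => ⟨edge_producer h, edge_consumer h⟩
  le_A := by
    intro i j h hj
    obtain ⟨m, rfl⟩ := exists_idx hj
    obtain ⟨n, rfl⟩ := exists_idx (h.trans hj)
    exact ⟨.inl m, .inl n, ⟨le_of_idx_lt h, Sum.inl_injective.ne (ne_of_idx_lt h)⟩, rfl, rfl⟩
  le_B := by
    intro i j h hj
    obtain ⟨m, rfl⟩ := exists_idx hj
    obtain ⟨n, rfl⟩ := exists_idx (h.trans hj)
    exact ⟨.inr (.inl m), .inr (.inl n), ⟨le_of_idx_lt h,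
      (Sum.inr_injective.comp Sum.inl_injective).ne (ne_of_idx_lt h)⟩, rfl, rfl⟩
  le_C := by
    intro i j h hj
    obtain ⟨m, rfl⟩ := exists_idx hj
    obtain ⟨n, rfl⟩ := exists_idx (h.trans hj)
    exact ⟨.inr (.inr m), .inr (.inr n), ⟨le_of_idx_lt h,
      (Sum.inr_injective.comp Sum.inr_injective).ne (ne_of_idx_lt h)⟩, rfl, rfl⟩

/-! ### Normal forms -/

variable {Q : Type} [DualBialgebra Q]

/-- The morphism `g : A → B` is obtained by discarding the wires of a scheduled morphism: it is the
normal form of the relation `R`. -/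
def Normal (R : Lab → Lab → Prop) (A B : List Polarity) (g : Q) : Prop :=
  ∃ f, Rep R A B f ∧ g = f ⨟ eps ^ (consumers A B).length * word B

/-- A normal form is determined by its relation. -/
theorem Normal.unique {R : Lab → Lab → Prop} {A B : List Polarity} (hR : Acyclic R A B) {f f' : Q}
    (h : Normal R A B f) (h' : Normal R A B f') : f = f' := by
  obtain ⟨g, hg, rfl⟩ := h
  obtain ⟨g', hg', rfl⟩ := h'
  rw [hg.unique hR hg']

theorem Normal.congr {R S : Lab → Lab → Prop} {A B : List Polarity} {f : Q} (h : Normal R A B f)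
    (e : ∀ x y, Producer A B x → Consumer A B y → (R x y ↔ S x y)) : Normal S A B f := by
  obtain ⟨g, hg, rfl⟩ := h
  exact ⟨g, hg.congr e, rfl⟩

/-- Normal forms are closed under composition. -/
theorem Normal.comp {A B C : List Polarity} {σ : WordStrategy A B} {τ : WordStrategy B C} {f g : Q}
    (hf : Normal (edge σ) A B f) (hg : Normal (edge τ) B C g) :
    Normal (edge (σ.comp τ)) A C (f ⨟ g) := by
  obtain ⟨f', hf', rfl⟩ := hf
  obtain ⟨g', hg', rfl⟩ := hg
  obtain ⟨f, g, h, hf, hg, hh, e⟩ := exists_rep_comp Q (composable_edge σ τ)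
  obtain rfl := hf.unique (acyclic_edge σ) hf'
  obtain rfl := hg.unique (acyclic_edge τ) hg'
  refine ⟨h, hh.congr fun x y _ _ => (edge_comp σ τ x y).symm, ?_⟩
  have e1 := exchange (eps ^ (consumers A B).length : Q) g
  simp only [src_pow, src_eps, tgt_pow, tgt_eps, hg.src_tgt, one_pow, one_mul] at e1
  have e2 := left_right (eps ^ (consumers A B).length : Q)
    (eps ^ (consumers B C).length * word C)
  simp only [src_pow, src_mul, src_word, src_eps, tgt_pow, tgt_eps, one_pow, one_mul] at e2
  have e3 : (reachWiring (edge σ) (edge τ) A B C ⨟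
      eps ^ (consumers A B).length * eps ^ (consumers B C).length : Q) =
      eps ^ (consumers A C).length := by
    have := wiring_comp (Q := Q) (ι := Lab) (Relation.ReflTransGen (Join (edge σ) (edge τ)))
      (fun _ _ => False) ((consumers A C).map inAC) (consumers₃ A B C) []
    simpa only [wiring, reachWiring, consumers₃, List.length_append, List.length_map, pow_add] using this
  have e4 : (f ⨟ eps ^ (consumers A B).length * word B) ⨟ g ⨟
      eps ^ (consumers B C).length * word C =
    (f ⨟ o ^ (consumers A B).length * g) ⨟
      (eps ^ (consumers A B).length * eps ^ (consumers B C).length) * word C := by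
    rw [comp_assoc, comp_assoc, ← comp_assoc (_ * word B), e1, comp_assoc, e2, mul_assoc]
  rw [e4, e, comp_assoc, ← whisker_right _ _ _ (src_word C), e3]

/-- Normal forms are closed under tensor products. -/
theorem Normal.tensor {A B C D : List Polarity} {σ : WordStrategy A B} {τ : WordStrategy C D}
    {f g : Q} (hf : Normal (edge σ) A B f) (hg : Normal (edge τ) C D g) :
    Normal (edge (wordTensor σ τ)) (A ++ C) (B ++ D) (f * g) := by
  obtain ⟨f, hf, rfl⟩ := hf
  obtain ⟨g, hg, rfl⟩ := hg
  obtain ⟨h, hh, e⟩ := exists_rep_tensor (R := edge σ)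
    (fun x y h => ⟨edge_producer h, edge_consumer h⟩) hf hg
  refine ⟨h, hh.congr fun x y _ _ => (edge_wordTensor σ τ x y).symm, ?_⟩
  have e1 : tgt (g ⨟ eps ^ (consumers C D).length * word D) = word D := by
    rw [tgt_comp _ _ (by simp [hg.src_tgt])]
    simp
  have e2 : (leftWiring A B C D ⨟ eps ^ (consumers A B).length : Q) =
      eps ^ (consumers (A ++ C) (B ++ D)).length := by
    have := wiring_comp (Q := Q) (ι := Lab) (fun w y => shiftLab C.length D.length w = y)
      (fun _ _ => False) (consumers (A ++ C) (B ++ D)) (consumers A B) []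
    simpa only [wiring, leftWiring] using this
  rw [comp_mul e1 _ (by simp [hf.src_tgt]), e, comp_assoc, mul_assoc,
    ← whisker_right _ _ _ (by simp), e2, word_append]

/-! ### Normal forms of the generators -/

/-- The moves of a target word without Proponent moves, from the first one to the last one. -/
def tgtProducers : ℕ → List Lab
  | 0 => []
  | n + 1 => .inr n :: tgtProducers n

theorem mem_tgtProducers {x : Lab} : ∀ {n : ℕ}, x ∈ tgtProducers n → ∃ i < n, x = .inr i
  | 0, h => by cases h
  | n + 1, h => by
    rcases List.mem_cons.1 h with rfl | h
    · exact ⟨n, n.lt_succ_self, rfl⟩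
    · obtain ⟨i, hi, rfl⟩ := mem_tgtProducers h
      exact ⟨i, hi.trans n.lt_succ_self, rfl⟩

theorem nodup_tgtProducers : ∀ n : ℕ, (tgtProducers n).Nodup
  | 0 => List.nodup_nil
  | n + 1 => List.nodup_cons.2 ⟨fun h => by
      obtain ⟨i, hi, e⟩ := mem_tgtProducers h
      exact hi.ne (Sum.inr_injective e).symm, nodup_tgtProducers n⟩

theorem length_tgtProducers : ∀ n : ℕ, (tgtProducers n).length = n
  | 0 => rfl
  | n + 1 => congrArg (· + 1) (length_tgtProducers n)

theorem word_replicate : ∀ n : ℕ, (word (List.replicate n .O) : Q) = o ^ n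
  | 0 => (pow_zero _).symm
  | n + 1 => by rw [List.replicate_succ, word_cons_O, word_replicate n, pow_succ']

theorem rep_replicate_nil (R : Lab → Lab → Prop) : ∀ n : ℕ,
    Rep R (List.replicate n .O) [] (o ^ n : Q)
  | 0 => by
    rw [pow_zero]
    exact .nil
  | n + 1 => by
    have := (rep_replicate_nil R n).srcO (by
      rintro (y | y) hy
      · exfalso
        have := (at_iff_getElem _ _ _).1 (show At (List.replicate n .O) .P y from hy)
        rw [List.reverse_replicate, List.getElem?_replicate] at this
        split at this <;> simp at this
      · exact hy.elim)
    rwa [← pow_succ'] at this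

theorem consumers_replicate_tgt (A : List Polarity) : ∀ m : ℕ,
    consumers A (List.replicate m .O) = consumers A []
  | 0 => rfl
  | m + 1 => consumers_replicate_tgt A m

theorem length_consumers_replicate : ∀ n : ℕ, (consumers (List.replicate n .O) []).length = n
  | 0 => rfl
  | n + 1 => congrArg (· + 1) (length_consumers_replicate n)

/-- Between Opponent moves, scheduled morphisms are wirings. -/
theorem rep_replicate (R : Lab → Lab → Prop) (n : ℕ) : ∀ m : ℕ,
    Rep R (List.replicate n .O) (List.replicate m .O)
      (wiring (fun w y => w = y ∨ w ∈ tgtProducers m ∧ R w y) (consumers (List.replicate n .O) [])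
        (consumers (List.replicate n .O) [] ++ tgtProducers m) : Q)
  | 0 => by
    have := rep_replicate_nil (Q := Q) R n
    rw [List.replicate_zero]
    rwa [tgtProducers, List.append_nil, wiring_id (nodup_consumers _ _) (by simp),
      length_consumers_replicate]
  | m + 1 => by
    have := (rep_replicate R n m).tgtO
    rw [List.replicate_succ]
    have hl : ∀ y ∈ consumers (List.replicate n .O) [], ∃ i, y = .inl i := by
      intro y hy
      rw [mem_consumers] at hy
      rcases y with y | y
      · exact ⟨y, rfl⟩
      · exact hy.elim
    rw [consumers_replicate_tgt, List.length_replicate, word_replicate] at this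
    have e := wiring_append (Q := Q) (m := tgtProducers m) (m' := tgtProducers m)
      (l := consumers (List.replicate n .O) [])
      (l' := consumers (List.replicate n .O) [] ++ [.inr m])
      (R := fun w y => w = y ∨ w = .inr m ∧ R w y ∧ ∃ i, y = .inl i)
      (by
        rintro b hb a ha (rfl | ⟨rfl, -⟩)
        · obtain ⟨i, rfl⟩ := hl _ ha
          obtain ⟨j, hj, e⟩ := mem_tgtProducers hb
          cases e
        · obtain ⟨j, hj, e⟩ := mem_tgtProducers hb
          exact hj.ne (Sum.inr_injective e).symm)
      (by
        rintro b hb a ha (rfl | ⟨rfl, -, i, rfl⟩)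
        · obtain ⟨j, hj, rfl⟩ := mem_tgtProducers ha
          rcases List.mem_append.1 hb with hb | hb
          · obtain ⟨i, e⟩ := hl _ hb
            cases e
          · exact hj.ne (Sum.inr_injective (List.mem_singleton.1 hb))
        · obtain ⟨j, hj, e⟩ := mem_tgtProducers ha
          cases e)
    have e2 : (wiring (fun w y => w = y ∨ w = .inr m ∧ R w y ∧ ∃ i, y = .inl i)
        (consumers (List.replicate n .O) []) (consumers (List.replicate n .O) [] ++ [.inr m]) : Q) =
        wiring (fun w y => w = y ∨ w = .inr m ∧ R w y) (consumers (List.replicate n .O) [])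
          (consumers (List.replicate n .O) [] ++ [.inr m]) :=
      wiring_congr fun b hb a ha => by simp [hl a ha]
    rw [wiring_id (l := tgtProducers m) (nodup_tgtProducers m) (by
        intro b hb a ha
        refine ⟨fun h => h.resolve_right ?_, .inl⟩
        rintro ⟨rfl, -⟩
        obtain ⟨j, hj, e⟩ := mem_tgtProducers hb
        exact hj.ne (Sum.inr_injective e).symm), length_tgtProducers, e2] at e
    rw [← e, wiring_comp] at this
    have e' : (consumers (List.replicate n .O) [] ++ [Sum.inr m]) ++ tgtProducers m =
      consumers (List.replicate n .O) [] ++ tgtProducers (m + 1) := by simp [tgtProducers]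
    rw [e'] at this
    refine cast (congrArg _ (wiring_congr fun w hw y hy => ?_)) this
    obtain ⟨i, rfl⟩ := hl _ hy
    constructor
    · rintro ⟨z, hz, rfl | ⟨rfl, h1, i', rfl⟩, e3 | ⟨h2, h3⟩⟩
      · exact .inl e3
      · exact .inr ⟨List.mem_cons_of_mem _ h2, h3⟩
      · cases Sum.inl_injective e3
        exact .inr ⟨List.mem_cons_self, h1⟩
      · obtain ⟨j, hj, e⟩ := mem_tgtProducers h2
        cases e
    · rintro (rfl | ⟨hw, h⟩)
      · exact ⟨_, List.mem_append_left _ hy, .inl rfl, .inl rfl⟩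
      · rcases List.mem_cons.1 hw with rfl | hw
        · exact ⟨_, List.mem_append_left _ hy, .inr ⟨rfl, h, i, rfl⟩, .inl rfl⟩
        · exact ⟨w, List.mem_append_right _ hw, .inl rfl, .inr ⟨hw, h⟩⟩

/-- Between Opponent moves, normal forms are the wirings from the source to the target. -/
theorem normal_replicate (R : Lab → Lab → Prop) (n m : ℕ) :
    Normal R (List.replicate n .O) (List.replicate m .O)
      (wiring R (consumers (List.replicate n .O) []) (tgtProducers m) : Q) := by
  refine ⟨_, rep_replicate R n m, ?_⟩
  have hl : ∀ y ∈ consumers (List.replicate n .O) [], ∃ i, y = .inl i := by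
    intro y hy
    rw [mem_consumers] at hy
    rcases y with y | y
    · exact ⟨y, rfl⟩
    · exact hy.elim
  have e := wiring_append (Q := Q) (R := Eq) (l := consumers (List.replicate n .O) [])
    (m := tgtProducers m) (m' := tgtProducers m) (l' := []) (by
      rintro b hb _ ha rfl
      obtain ⟨i, rfl⟩ := hl _ ha
      obtain ⟨j, hj, e⟩ := mem_tgtProducers hb
      cases e) (by simp)
  rw [wiring_id (l := tgtProducers m) (nodup_tgtProducers m) (by simp), length_tgtProducers,
    wiring] at e
  rw [consumers_replicate_tgt, word_replicate, ← e, wiring_comp, List.nil_append]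
  refine wiring_congr fun w hw y hy => ?_
  obtain ⟨i, rfl⟩ := hl _ hy
  obtain ⟨j, hj, rfl⟩ := mem_tgtProducers hw
  constructor
  · intro h
    exact ⟨_, List.mem_append_right _ hw, rfl, .inr ⟨hw, h⟩⟩
  · rintro ⟨z, hz, rfl, e | ⟨-, h⟩⟩
    · cases e
    · exact h

theorem wiring_two {α β : Type} {R : β → α → Prop} {a a' : α} {b : β} (h : R b a) (h' : R b a') :
    (wiring R [a, a'] [b] : Q) = mu := by
  have e1 : (gate True ⨟ o * eps : Q) = mu := by
    have h1 := exchange (mu : Q) eps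
    simp only [src_mu, tgt_mu, src_eps, tgt_eps, mul_one] at h1
    rw [gate_true, comp_assoc, comp_assoc, h1, ← comp_assoc (o * gamma), mul_assoc o o eps,
      ← whisker_left _ _ _ src_o, gamma_eps_right, ← comp_assoc, ← mul_assoc,
      ← whisker_right _ _ _ src_o, delta_eps_right, id_comp (by simp)]
  have e2 := interchange (f := gate True) (g := o * eps) (f' := (o : Q)) (g' := eps)
    (by simp) (by simp [tgt_of_src])
  have e3 := right_left (mu : Q) (eps : Q)
  have e4 : (o * delta ⨟ o * o * eps : Q) = o * o := by
    rw [mul_assoc, ← whisker_left _ _ _ src_o, delta_eps_right]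
  simp only [src_mu, tgt_eps, mul_one] at e3
  rw [e1, id_comp src_eps, mul_assoc] at e2
  rw [wiring, wiring, collect, collect_one h', show R b a = True from eq_true h,
    List.length_singleton, pow_one, comp_assoc, List.length_cons, List.length_singleton, pow_two, e2,
    ← e3, ← comp_assoc, e4, id_comp src_mu]

theorem wiring_swap {α β : Type} {R : β → α → Prop} {a a' : α} {b b' : β} (h1 : ¬ R b a)
    (h2 : R b a') (h3 : R b' a) (h4 : ¬ R b' a') : (wiring R [a, a'] [b, b'] : Q) = gamma := by
  have e1 := wiring_append (Q := Q) (R := R) (l := [a]) (m := [a']) (l' := [b']) (m' := [])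
    (by simp) (by simpa using h4)
  rw [wiring_one h3, wiring, List.length_singleton, pow_one] at e1
  have e2 := exchange (gamma : Q) eps
  have e3 : (o * delta ⨟ o * o * eps : Q) = o * o := by
    rw [mul_assoc, ← whisker_left _ _ _ src_o, delta_eps_right]
  simp only [src_gamma, tgt_gamma, src_eps, tgt_eps, mul_one] at e2
  rw [wiring, show [a, a'] = [a] ++ [a'] from rfl, show [b'] = [b'] ++ [] from rfl, e1,
    show [a] ++ [a'] = [a, a'] from rfl, collect, collect_one h2, show R b a = False from eq_false h1,
    gate_false, List.length_singleton, pow_one, ← mul_assoc, comp_assoc, e2, ← comp_assoc, e3,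
    id_comp src_gamma]

theorem normal_mu : Normal (fun x y => (x, y) ∈ genEdges .muO) [.O, .O] [.O] (mu : Q) := by
  have := normal_replicate (Q := Q) (fun x y => (x, y) ∈ genEdges .muO) 2 1
  rwa [show consumers (List.replicate 2 .O) [] = [.inl 1, .inl 0] from rfl, tgtProducers,
    tgtProducers, wiring_two (by simp [genEdges]) (by simp [genEdges])] at this

theorem normal_eta : Normal (fun x y => (x, y) ∈ genEdges .etaO) [] [.O] (eta : Q) := by
  have := normal_replicate (Q := Q) (fun x y => (x, y) ∈ genEdges .etaO) 0 1
  rwa [show consumers (List.replicate 0 .O) [] = [] from rfl, tgtProducers, tgtProducers, wiring,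
    wiring, collect, List.length_nil, pow_zero, mul_one, comp_id tgt_eta] at this

theorem normal_delta : Normal (fun x y => (x, y) ∈ genEdges .deltaO) [.O] [.O, .O] (delta : Q) := by
  have := normal_replicate (Q := Q) (fun x y => (x, y) ∈ genEdges .deltaO) 1 2
  rwa [show consumers (List.replicate 1 .O) [] = [.inl 0] from rfl, tgtProducers, tgtProducers,
    tgtProducers, wiring, wiring_one (by simp [genEdges]), collect_one (by simp [genEdges]),
    comp_id tgt_delta] at this

theorem normal_eps : Normal (fun x y => (x, y) ∈ genEdges .epsO) [.O] [] (eps : Q) := by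
  have := normal_replicate (Q := Q) (fun x y => (x, y) ∈ genEdges .epsO) 1 0
  rwa [show consumers (List.replicate 1 .O) [] = [.inl 0] from rfl, tgtProducers, wiring,
    List.length_singleton, pow_one] at this

theorem normal_gamma :
    Normal (fun x y => (x, y) ∈ genEdges .gammaO) [.O, .O] [.O, .O] (gamma : Q) := by
  have := normal_replicate (Q := Q) (fun x y => (x, y) ∈ genEdges .gammaO) 2 2
  rwa [show consumers (List.replicate 2 .O) [] = [.inl 1, .inl 0] from rfl, tgtProducers,
    tgtProducers, tgtProducers, wiring_swap (by simp [genEdges]) (by simp [genEdges])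
    (by simp [genEdges]) (by simp [genEdges])] at this

theorem normal_o : Normal (Copy [.O]) [.O] [.O] (o : Q) := by
  have := normal_replicate (Q := Q) (Copy [.O]) 1 1
  rwa [show consumers (List.replicate 1 .O) [] = [.inl 0] from rfl, tgtProducers, tgtProducers,
    wiring_one ⟨0, .inr ⟨.inl ⟨rfl, rfl⟩, rfl, rfl⟩⟩] at this

theorem rep_unit (R : Lab → Lab → Prop) : Rep R [] [.P] (unit : Q) := by
  have := (Rep.nil (R := R) (Q := Q)).tgtP (by rintro (y | y) h <;> exact h.elim)
  rwa [show consumers [] [] = [] from rfl, List.length_nil, pow_zero, one_mul, word_nil, mul_one,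
    id_comp src_unit] at this

theorem normal_unit : Normal (fun x y => (x, y) ∈ genEdges .etaOP) [] [.O, .P] (unit : Q) := by
  refine ⟨_, (rep_unit _).tgtO, ?_⟩
  have e1 : (delta * p ⨟ eps * (o * p) : Q) = o * p := by
    rw [← mul_assoc, ← whisker_right _ _ _ src_p, delta_eps_left]
  rw [show consumers [] [.P] = [.inr 0] from rfl, show consumers [] [.O, .P] = [.inr 0] from rfl]
  simp only [List.length_singleton, List.singleton_append, pow_one, word_cons_P, word_cons_O,
    word_nil, mul_one]
  rw [wiring, wiring_one, collect_one, comp_id tgt_delta, comp_assoc, e1, comp_id tgt_unit]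
  · exact .inl rfl
  · exact .inr ⟨rfl, by simp [genEdges]⟩

theorem normal_counit : Normal (fun x y => (x, y) ∈ genEdges .epsOP) [.P, .O] [] (counit : Q) := by
  refine ⟨_, (rep_replicate_nil _ 1).srcP, ?_⟩
  have e1 := exchange (counit : Q) (eps : Q)
  simp only [src_counit, tgt_counit, src_eps, tgt_eps, one_mul, mul_one] at e1
  have e2 : (p * delta ⨟ p * o * eps : Q) = p * o := by
    rw [mul_assoc, ← whisker_left _ _ _ src_p, delta_eps_right]
  rw [show consumers (List.replicate 1 .O) [] = [.inl 0] from rfl,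
    show consumers [.P, .O] [] = [.inl 0] from rfl]
  simp only [List.length_singleton, pow_one, word_nil, mul_one]
  rw [collect_one (by simp [genEdges]), comp_assoc, comp_assoc, e1, ← comp_assoc (p * delta), e2,
    id_comp src_counit, id_comp src_counit]

theorem normal_p : Normal (Copy [.P]) [.P] [.P] (p : Q) := by
  refine ⟨_, (rep_unit _).srcP, ?_⟩
  have e1 := exchange (counit : Q) (eps * p : Q)
  simp only [src_counit, tgt_counit, src_mul, tgt_mul, src_eps, tgt_eps, src_p, tgt_of_src src_p,
    one_mul] at e1
  have e2 : (p * delta * p ⨟ p * o * (eps * p) : Q) = p * o * p := by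
    rw [← mul_assoc, ← whisker_right _ _ _ src_p, mul_assoc, ← whisker_left _ _ _ src_p,
      delta_eps_right]
  rw [show consumers [] [.P] = [.inr 0] from rfl, show consumers [.P] [.P] = [.inr 0] from rfl]
  simp only [List.length_singleton, pow_one, word_nil, mul_one, word_cons_P]
  rw [collect_one ⟨0, .inl ⟨.inl ⟨rfl, rfl⟩, rfl, rfl⟩⟩, comp_assoc, comp_assoc, mul_assoc counit, e1,
    ← comp_assoc (p * delta * p), e2,
    id_comp (U := p * o * p) (by simp), zigzag_p]

end FOC

namespace FOC

open StrictMonoidal DualBialgebra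

/-! ### The syntactic model -/

namespace Syntactic

/-- A formal morphism, with its source and its target. Gathering all of them in one type avoids casts
along equations between words. -/
structure Arrow where
  src : List stratTheory.Atom
  tgt : List stratTheory.Atom
  expr : stratTheory.Expr src tgt

instance arrowSetoid : Setoid Arrow where
  r f g := stratTheory.Cong f.expr g.expr
  iseqv := ⟨fun _ => .refl _, .symm, .trans⟩

/-- The classes of formal morphisms. -/
abbrev Mor : Type := _root_.Quotient arrowSetoid

/-- The class of a formal morphism. -/
abbrev cls {A B : List stratTheory.Atom} (f : stratTheory.Expr A B) : Mor :=
  _root_.Quotient.mk arrowSetoid ⟨A, B, f⟩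

theorem cls_eq {A B A' B' : List stratTheory.Atom} {f : stratTheory.Expr A B}
    {g : stratTheory.Expr A' B'} : cls f = cls g ↔ stratTheory.Cong f g :=
  _root_.Quotient.eq (r := arrowSetoid)

theorem Mor.ind {p : Mor → Prop}
    (h : ∀ (A B : List stratTheory.Atom) (f : stratTheory.Expr A B), p (cls f)) (x : Mor) : p x :=
  _root_.Quotient.ind (fun ⟨A, B, f⟩ => h A B f) x

instance : Monoid Mor where
  mul := _root_.Quotient.map₂ (fun f g => ⟨f.src ++ g.src, f.tgt ++ g.tgt, f.expr.tensor g.expr⟩)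
    fun _ _ h _ _ h' => .tensor h h'
  one := cls (.id [])
  mul_assoc := by
    rintro ⟨f⟩ ⟨g⟩ ⟨h⟩
    exact cls_eq.2 (.tensor_assoc _ _ _)
  one_mul := by
    rintro ⟨f⟩
    exact cls_eq.2 (.unit_tensor _)
  mul_one := by
    rintro ⟨f⟩
    exact cls_eq.2 (.tensor_unit _)

theorem cls_mul {A B C D : List stratTheory.Atom} (f : stratTheory.Expr A B)
    (g : stratTheory.Expr C D) : cls f * cls g = cls (f.tensor g) := rfl

/-- The source of a class, as an identity. -/
def Mor.src : Mor → Mor :=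
  _root_.Quotient.map (fun f => ⟨f.src, f.src, .id f.src⟩) fun f g h => by
    obtain ⟨A, B, f⟩ := f
    obtain ⟨A', B', g⟩ := g
    obtain ⟨rfl, -⟩ : A = A' ∧ B = B' := word_eq_of_cong h
    exact .refl _

/-- The target of a class, as an identity. -/
def Mor.tgt : Mor → Mor :=
  _root_.Quotient.map (fun f => ⟨f.tgt, f.tgt, .id f.tgt⟩) fun f g h => by
    obtain ⟨A, B, f⟩ := f
    obtain ⟨A', B', g⟩ := g
    obtain ⟨-, rfl⟩ : A = A' ∧ B = B' := word_eq_of_cong h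
    exact .refl _

open Classical in
/-- The composite of two classes, which is zero when the target of the first one is not the source
of the second one. -/
noncomputable def Mor.comp : Mor → Mor → WithZero Mor :=
  _root_.Quotient.lift₂ (fun f g => if h : f.tgt = g.src then ↑(cls (f.expr.comp (h ▸ g.expr))) else 0) <| by
    rintro ⟨A, B, f⟩ ⟨C, D, g⟩ ⟨A', B', f'⟩ ⟨C', D', g'⟩ h h'
    obtain ⟨rfl, rfl⟩ : A = A' ∧ B = B' := word_eq_of_cong h
    obtain ⟨rfl, rfl⟩ : C = C' ∧ D = D' := word_eq_of_cong h'
    dsimp only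
    split
    · rename_i e
      subst e
      exact congrArg _ (cls_eq.2 (.comp h h'))
    · rfl

theorem Mor.comp_cls {A B C : List stratTheory.Atom} (f : stratTheory.Expr A B)
    (g : stratTheory.Expr B C) : (cls f).comp (cls g) = ↑(cls (f.comp g)) :=
  dif_pos rfl

theorem Mor.comp_ne {A B C D : List stratTheory.Atom} (f : stratTheory.Expr A B)
    (g : stratTheory.Expr C D) (h : B ≠ C) : (cls f).comp (cls g) = 0 :=
  dif_neg h

/-- Composition, with a zero for the composites which are not defined. -/
noncomputable def comp : WithZero Mor → WithZero Mor → WithZero Mor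
  | none, _ => 0
  | some _, none => 0
  | some f, some g => f.comp g

@[simp] theorem zero_comp (f : WithZero Mor) : comp 0 f = 0 := rfl

@[simp] theorem comp_zero : ∀ f : WithZero Mor, comp f 0 = 0
  | none => rfl
  | some _ => rfl

theorem comp_cls {A B C : List stratTheory.Atom} (f : stratTheory.Expr A B)
    (g : stratTheory.Expr B C) : comp (cls f) (cls g) = ↑(cls (f.comp g)) :=
  Mor.comp_cls f g

theorem comp_ne {A B C D : List stratTheory.Atom} (f : stratTheory.Expr A B)
    (g : stratTheory.Expr C D) (h : B ≠ C) : comp (cls f) (cls g) = 0 :=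
  Mor.comp_ne f g h

theorem ind {p : WithZero Mor → Prop} (h0 : p 0)
    (h : ∀ (A B : List stratTheory.Atom) (f : stratTheory.Expr A B), p ↑(cls f)) :
    ∀ x : WithZero Mor, p x
  | none => h0
  | some x => Mor.ind (p := fun x => p ↑x) h x

/-- The source of a class, as an identity; the source of zero is zero. -/
def src : WithZero Mor → WithZero Mor := Option.map Mor.src

/-- The target of a class, as an identity; the target of zero is zero. -/
def tgt : WithZero Mor → WithZero Mor := Option.map Mor.tgt

@[simp] theorem src_zero : src 0 = 0 := rfl

@[simp] theorem tgt_zero : tgt 0 = 0 := rfl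

@[simp] theorem src_cls {A B : List stratTheory.Atom} (f : stratTheory.Expr A B) :
    src (cls f) = ↑(cls (.id A)) := rfl

@[simp] theorem tgt_cls {A B : List stratTheory.Atom} (f : stratTheory.Expr A B) :
    tgt (cls f) = ↑(cls (.id B)) := rfl

theorem coe_cls_eq {A B A' B' : List stratTheory.Atom} {f : stratTheory.Expr A B}
    {g : stratTheory.Expr A' B'} : (↑(cls f) : WithZero Mor) = ↑(cls g) ↔ stratTheory.Cong f g := by
  rw [WithZero.coe_inj, cls_eq]

theorem id_cls_eq {A B : List stratTheory.Atom} (h : (↑(cls (.id A)) : WithZero Mor) = ↑(cls (.id B))) :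
    A = B :=
  (word_eq_of_cong (coe_cls_eq.1 h)).1

theorem coe_mul_cls {A B C D : List stratTheory.Atom} (f : stratTheory.Expr A B)
    (g : stratTheory.Expr C D) : (↑(cls f) * ↑(cls g) : WithZero Mor) = ↑(cls (f.tensor g)) := by
  rw [← WithZero.coe_mul, cls_mul]

theorem id_mul_id (A B : List stratTheory.Atom) : (↑(cls (.id A)) * ↑(cls (.id B)) : WithZero Mor) =
    ↑(cls (.id (A ++ B))) := by
  rw [coe_mul_cls, coe_cls_eq]
  exact .id_tensor_id A B

/-- The classes of formal morphisms form a strict monoidal category, in which zero stands for the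
composites which are not defined. -/
noncomputable instance : StrictMonoidal (WithZero Mor) where
  src := src
  tgt := tgt
  comp := comp
  tgt_src := ind rfl fun A B f => rfl
  src_tgt := ind rfl fun A B f => rfl
  src_one := rfl
  src_mul := by
    refine ind (by simp) fun A B f => ind (by simp) fun C D g => ?_
    rw [coe_mul_cls, src_cls, src_cls, src_cls, id_mul_id]
  tgt_mul := by
    refine ind (by simp) fun A B f => ind (by simp) fun C D g => ?_
    rw [coe_mul_cls, tgt_cls, tgt_cls, tgt_cls, id_mul_id]
  src_comp := by
    refine ind (by simp) fun A B f => ind (by simp) fun C D g h => ?_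
    obtain rfl := id_cls_eq h
    rw [comp_cls, src_cls, src_cls]
  tgt_comp := by
    refine ind (ind (by simp) fun C D g h => (WithZero.coe_ne_zero h.symm).elim) fun A B f =>
      ind (by simp) fun C D g h => ?_
    obtain rfl := id_cls_eq h
    rw [comp_cls, tgt_cls, tgt_cls]
  src_id_comp := ind rfl fun A B f => by
    rw [src_cls, comp_cls, coe_cls_eq]
    exact .id_comp f
  comp_tgt_id := ind rfl fun A B f => by
    rw [tgt_cls, comp_cls, coe_cls_eq]
    exact .comp_id f
  comp_assoc := by
    refine ind (by simp) fun A B f => ind (by simp) fun C D g => ind (by simp) fun E F h => ?_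
    by_cases e : B = C
    · subst e
      by_cases e' : D = E
      · subst e'
        rw [comp_cls, comp_cls, comp_cls, comp_cls, coe_cls_eq]
        exact .assoc f g h
      · rw [comp_cls, comp_ne _ _ e', comp_ne _ _ e', comp_zero]
    · by_cases e' : D = E
      · subst e'
        rw [comp_cls, comp_ne _ _ e, comp_ne _ _ e, zero_comp]
      · rw [comp_ne _ _ e, comp_ne _ _ e', zero_comp, comp_zero]
  whisker_left := by
    refine ind (by simp) fun X Y u => ind (by simp) fun A B f => ind (by simp) fun C D g hU => ?_
    rw [← hU, src_cls]
    by_cases e : B = C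
    · subst e
      rw [comp_cls, coe_mul_cls, coe_mul_cls, coe_mul_cls, comp_cls, coe_cls_eq]
      exact .trans (.tensor (.symm (.id_comp _)) (.refl _)) (.interchange _ _ _ _)
    · rw [comp_ne _ _ e, coe_mul_cls, coe_mul_cls, comp_ne _ _ fun h => e (List.append_cancel_left h),
        mul_zero]
  whisker_right := by
    refine ind (by simp) fun X Y u => ind (by simp) fun A B f => ind (by simp) fun C D g hU => ?_
    rw [← hU, src_cls]
    by_cases e : B = C
    · subst e
      rw [comp_cls, coe_mul_cls, coe_mul_cls, coe_mul_cls, comp_cls, coe_cls_eq]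
      exact .trans (.tensor (.refl _) (.symm (.id_comp _))) (.interchange _ _ _ _)
    · rw [comp_ne _ _ e, coe_mul_cls, coe_mul_cls,
        comp_ne _ _ fun h => e (List.append_cancel_right h), zero_mul]
  left_right := by
    refine ind (by simp) fun A B f => ind (by simp) fun C D g => ?_
    rw [src_cls, tgt_cls, coe_mul_cls, coe_mul_cls, coe_mul_cls, comp_cls, coe_cls_eq]
    exact .trans (.symm (.interchange _ _ _ _)) (.tensor (.comp_id _) (.id_comp _))
  right_left := by
    refine ind (by simp) fun A B f => ind (by simp) fun C D g => ?_
    rw [src_cls, tgt_cls, coe_mul_cls, coe_mul_cls, coe_mul_cls, comp_cls, coe_cls_eq]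
    exact .trans (.symm (.interchange _ _ _ _)) (.tensor (.id_comp _) (.comp_id _))

/-- The value of a formal morphism in the syntactic model, by induction. It is its class (`value_eq`),
but this form lets the lemmas about `StrictMonoidal` apply. -/
noncomputable def value {A B : List Polarity} : stratSignature.Expr A B → WithZero Mor
  | .gen g => ↑(cls (.gen (S := stratSignature) g))
  | .id A => ↑(cls (.id (S := stratSignature) A))
  | .comp f g => value f ⨟ value g
  | .tensor f g => value f * value g

theorem value_eq : ∀ {A B : List Polarity} (f : stratSignature.Expr A B), value f = ↑(cls f)
  | _, _, .gen _ => rfl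
  | _, _, .id _ => rfl
  | _, _, .comp f g => by
    refine (congrArg₂ comp (value_eq f) (value_eq g)).trans ?_
    exact comp_cls f g
  | _, _, .tensor f g => by
    refine (congrArg₂ (· * ·) (value_eq f) (value_eq g)).trans ?_
    exact coe_mul_cls f g

theorem value_eqn {A B : List Polarity} {f g : StratGen.E A B} (h : StratGen.Eqn f g) :
    value f = value g := by
  rw [value_eq, value_eq]
  exact coe_cls_eq.2 (.eqn h)

open StratGen in
theorem id_value (A B : List Polarity) : value (i (A ++ B)) = value (i A) * value (i B) :=
  (id_mul_id A B).symm

open StratGen in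
/-- The generators `O` and `P` of the theory, among formal morphisms. -/
noncomputable instance : DualBialgebra (WithZero Mor) where
  o := value (i O)
  p := value (i P)
  mu := value μO
  eta := value ηO
  delta := value δO
  eps := value εO
  gamma := value γO
  unit := value ηOP
  counit := value εOP
  src_o := rfl
  src_p := rfl
  src_mu := id_value O O
  tgt_mu := rfl
  src_eta := rfl
  tgt_eta := rfl
  src_delta := rfl
  tgt_delta := id_value O O
  src_eps := rfl
  tgt_eps := rfl
  src_gamma := id_value O O
  tgt_gamma := id_value O O
  src_unit := rfl
  tgt_unit := id_value O P
  src_counit := id_value P O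
  tgt_counit := rfl
  yangBaxter := by
    have := value_eqn .yangBaxter
    simp only [value] at this
    simpa only [StrictMonoidal.comp_assoc, value] using this
  gamma_gamma := (value_eqn .gamma_gamma).trans (id_value O O)
  mu_assoc := value_eqn .mu_assoc
  eta_mu := value_eqn .eta_mu
  mu_gamma_left := (value_eqn .mu_gamma_left).trans (StrictMonoidal.comp_assoc _ _ _)
  mu_gamma_right := (value_eqn .mu_gamma_right).trans (StrictMonoidal.comp_assoc _ _ _)
  eta_gamma_right := value_eqn .eta_gamma_right
  mu_comm := value_eqn .mu_comm
  delta_assoc := value_eqn .delta_assoc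
  delta_eps_left := value_eqn .delta_eps_left
  delta_eps_right := value_eqn .delta_eps_right
  gamma_delta_left := (value_eqn .gamma_delta_left).trans (StrictMonoidal.comp_assoc _ _ _)
  gamma_delta_right := (value_eqn .gamma_delta_right).trans (StrictMonoidal.comp_assoc _ _ _)
  gamma_eps_left := value_eqn .gamma_eps_left
  delta_comm := value_eqn .delta_comm
  mu_delta := (value_eqn .mu_delta).trans (StrictMonoidal.comp_assoc _ _ _)
  eta_eps := value_eqn .eta_eps
  mu_eps := value_eqn .mu_eps
  eta_delta := value_eqn .eta_delta
  delta_mu := value_eqn .delta_mu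
  zigzag_p := value_eqn .zigzag_P
  zigzag_o := value_eqn .zigzag_O

theorem normal_congr {A B : List Polarity} {R S : Lab → Lab → Prop} {f : WithZero Mor}
    (h : Normal R A B f) (e : ∀ x y, R x y ↔ S x y) : Normal S A B f :=
  h.congr fun x y _ _ => e x y

theorem normal_id : ∀ w : List Polarity, Normal (Copy w) w w (value (.id (S := stratSignature) w))
  | [] => by
    refine ⟨1, .nil, ?_⟩
    change (1 : WithZero Mor) = 1 ⨟ eps ^ 0 * 1
    rw [pow_zero, mul_one, id_comp src_one]
  | X :: w => by
    have h1 : Normal (Copy [X]) [X] [X] (value (.id (S := stratSignature) [X])) := by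
      cases X
      · exact normal_o
      · exact normal_p
    have h2 := (normal_congr h1 fun x y => (edge_copycat (.refl _) x y).symm).tensor
      (normal_congr (normal_id w) fun x y => (edge_copycat (.refl _) x y).symm)
    rw [show value (.id (S := stratSignature) [X]) * value (.id (S := stratSignature) w) =
      value (.id (S := stratSignature) (X :: w)) from (id_value [X] w).symm] at h2
    refine normal_congr h2 fun x y => ?_
    rw [edge_wordTensor, juxt_congr (edge_copycat (.refl _)) (edge_copycat (.refl _))]
    exact copy_append [X] w x y

/-- The formal morphisms which do not use the generators which are defined by duality. -/
def Primitive {A B : List Polarity} : stratSignature.Expr A B → Prop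
  | .gen g => match g with
    | .muP | .etaP | .deltaP | .epsP | .gammaP | .gammaOP => False
    | _ => True
  | .id _ => True
  | .comp f g => Primitive f ∧ Primitive g
  | .tensor f g => Primitive f ∧ Primitive g

theorem normal_of_primitive : ∀ {A B : List Polarity} (f : stratSignature.Expr A B), Primitive f →
    Normal (edge (interp f)) A B (value f)
  | _, _, .gen g, h => by
    refine normal_congr ?_ fun x y => (edge_strategy g x y).symm
    cases g
    · exact normal_mu
    · exact normal_eta
    · exact normal_delta
    · exact normal_eps
    · exact normal_gamma
    · exact h.elim
    · exact h.elim
    · exact h.elim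
    · exact h.elim
    · exact h.elim
    · exact normal_unit
    · exact normal_counit
    · exact h.elim
  | _, _, .id w, _ => normal_congr (normal_id w) fun x y => (edge_copycat (.refl _) x y).symm
  | _, _, .comp f g, h => (normal_of_primitive f h.1).comp (normal_of_primitive g h.2)
  | _, _, .tensor f g, h => (normal_of_primitive f h.1).tensor (normal_of_primitive g h.2)

theorem normal_of_eqn {A B : List Polarity} {f g : StratGen.E A B} (h : StratGen.Eqn f g)
    (hg : Primitive g) : Normal (edge (interp f)) A B (value f) := by
  rw [interp_eqn h, value_eqn h]
  exact normal_of_primitive g hg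

/-- The value of every formal morphism is the normal form of the associated strategy. The generators
defined by duality are equal to formal morphisms which do not use them, and which denote the same
strategies. -/
theorem normal_value : ∀ {A B : List Polarity} (f : stratSignature.Expr A B),
    Normal (edge (interp f)) A B (value f)
  | _, _, .gen g => by
    cases g
    case muP => exact normal_of_eqn .mu_P (by simp [Primitive])
    case etaP => exact normal_of_eqn .eta_P (by simp [Primitive])
    case deltaP => exact normal_of_eqn .delta_P (by simp [Primitive])
    case epsP => exact normal_of_eqn .eps_P (by simp [Primitive])
    case gammaP => exact normal_of_eqn .gamma_P (by simp [Primitive])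
    case gammaOP => exact normal_of_eqn .gamma_OP (by simp [Primitive])
    all_goals exact normal_of_primitive _ trivial
  | _, _, .id w => normal_of_primitive (.id w) trivial
  | _, _, .comp f g => (normal_value f).comp (normal_value g)
  | _, _, .tensor f g => (normal_value f).tensor (normal_value g)

end Syntactic

/-- The equations of the theory are complete: formal morphisms which denote the same strategy have the
same normal form, hence are congruent. -/
theorem cong_of_interp_eq {A B : List Polarity} (f g : stratSignature.Expr A B)
    (h : interp f = interp g) : stratTheory.Cong f g := by
  have hf := Syntactic.normal_value f
  rw [h] at hf
  have e := hf.unique (acyclic_edge _) (Syntactic.normal_value g)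
  exact Syntactic.coe_cls_eq.1 ((Syntactic.value_eq f).symm.trans (e.trans (Syntactic.value_eq g)))

end FOC

namespace FOC

open StrictMonoidal DualBialgebra

/-! ### Forgetting moves -/

/-- A word some letters of which are marked. -/
abbrev Marked : Type := List (Polarity × Bool)

/-- The word underlying a marked word. -/
def full : Marked → List Polarity
  | [] => []
  | (X, _) :: w => X :: full w

/-- The word of the marked letters. -/
def kept : Marked → List Polarity
  | [] => []
  | (X, true) :: w => X :: kept w
  | (_, false) :: w => kept w

/-- The `j`-th marked letter is the `i`-th letter, the letters being numbered from the end. -/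
def Kept : Marked → ℕ → ℕ → Prop
  | [], _, _ => False
  | (_, true) :: w, i, j => (i = (full w).length ∧ j = (kept w).length) ∨ Kept w i j
  | (_, false) :: w, i, j => Kept w i j

theorem Kept.lt : ∀ {w : Marked} {i j : ℕ}, Kept w i j → i < (full w).length ∧ j < (kept w).length
  | (_, true) :: _, _, _, .inl ⟨h, h'⟩ => ⟨h ▸ Nat.lt_succ_self _, h' ▸ Nat.lt_succ_self _⟩
  | (_, true) :: _, _, _, .inr h => ⟨h.lt.1.trans (Nat.lt_succ_self _),
      h.lt.2.trans (Nat.lt_succ_self _)⟩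
  | (_, false) :: w, i, j, h =>
    have h : Kept w i j := h
    ⟨h.lt.1.trans (Nat.lt_succ_self _), h.lt.2⟩

theorem Kept.unique : ∀ {w : Marked} {i i' j : ℕ}, Kept w i j → Kept w i' j → i = i'
  | (_, true) :: _, _, _, _, .inl ⟨h, _⟩, .inl ⟨h', _⟩ => h.trans h'.symm
  | (_, true) :: _, _, _, _, .inl ⟨_, h⟩, .inr h' => absurd h h'.lt.2.ne
  | (_, true) :: _, _, _, _, .inr h', .inl ⟨_, h⟩ => absurd h h'.lt.2.ne
  | (_, true) :: _, _, _, _, .inr h, .inr h' => h.unique h'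
  | (_, false) :: w, _, _, j, h, h' =>
    have h : Kept w _ j := h
    h.unique h'

theorem exists_kept_none : ∀ A : List Polarity, ∃ w, full w = A ∧ kept w = []
  | [] => ⟨[], rfl, rfl⟩
  | X :: A => have ⟨w, h, h'⟩ := exists_kept_none A
    ⟨(X, false) :: w, congrArg (X :: ·) h, h'⟩

theorem exists_kept_one {X : Polarity} {i : ℕ} : ∀ {A : List Polarity}, At A X i →
    ∃ w, full w = A ∧ kept w = [X] ∧ Kept w i 0
  | Y :: A, .inl ⟨h, e⟩ => by
    subst e h
    obtain ⟨w, h, h'⟩ := exists_kept_none A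
    exact ⟨(Y, true) :: w, congrArg (Y :: ·) h, congrArg (Y :: ·) h',
      .inl ⟨by rw [h], by rw [h']; rfl⟩⟩
  | Y :: A, .inr h => have ⟨w, h1, h2, h3⟩ := exists_kept_one h
    ⟨(Y, false) :: w, congrArg (Y :: ·) h1, h2, h3⟩

theorem exists_kept_two {X Y : Polarity} {i j : ℕ} (lt : j < i) : ∀ {A : List Polarity}, At A X i →
    At A Y j → ∃ w, full w = A ∧ kept w = [X, Y] ∧ Kept w i 1 ∧ Kept w j 0
  | _ :: A, .inl ⟨h, _⟩, .inl ⟨h', _⟩ => absurd (h'.trans h.symm) lt.ne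
  | Z :: A, .inl ⟨h, e⟩, .inr h' => by
    subst e h
    obtain ⟨w, h1, h2, h3⟩ := exists_kept_one h'
    exact ⟨(Z, true) :: w, congrArg (Z :: ·) h1, congrArg (Z :: ·) h2,
      .inl ⟨by rw [h1], by rw [h2]; rfl⟩, .inr h3⟩
  | _ :: A, .inr h, .inl ⟨h', _⟩ => absurd (h'.symm ▸ h.lt) lt.not_gt
  | Z :: A, .inr h, .inr h' => have ⟨w, h1, h2, h3⟩ := exists_kept_two lt h h'
    ⟨(Z, false) :: w, congrArg (Z :: ·) h1, h2, h3⟩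

open StratGen in
/-- The formal morphism which forgets the letters which are not marked. -/
def drop : ∀ w : Marked, E (full w) (kept w)
  | [] => i []
  | (X, true) :: w => .tensor (i [X]) (drop w)
  | (.O, false) :: w => .tensor εO (drop w)
  | (.P, false) :: w => .tensor εP (drop w)

open StratGen in
/-- The formal morphism which introduces the letters which are not marked. -/
def restore : ∀ w : Marked, E (kept w) (full w)
  | [] => i []
  | (X, true) :: w => .tensor (i [X]) (restore w)
  | (.O, false) :: w => .tensor ηO (restore w)
  | (.P, false) :: w => .tensor ηP (restore w)

/-- The edges of `drop w`: those of an identity on the marked letters. -/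
def DropEdge (w : Marked) (x y : Lab) : Prop :=
  ∃ i j, Kept w i j ∧ ((At (full w) .P i ∧ x = .inl i ∧ y = .inr j) ∨
    (At (full w) .O i ∧ x = .inr j ∧ y = .inl i))

theorem dropEdge_false {X : Polarity} {w : Marked} {x y : Lab} :
    DropEdge ((X, false) :: w) x y ↔ DropEdge w x y := by
  constructor
  · rintro ⟨i, j, h, h'⟩
    have lt := (Kept.lt (w := w) h).1
    refine ⟨i, j, h, h'.imp (fun h' => ⟨h'.1.resolve_left fun e => lt.ne e.1, h'.2⟩)
      fun h' => ⟨h'.1.resolve_left fun e => lt.ne e.1, h'.2⟩⟩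
  · rintro ⟨i, j, h, h'⟩
    exact ⟨i, j, h, h'.imp (fun h' => ⟨.inr h'.1, h'.2⟩) fun h' => ⟨.inr h'.1, h'.2⟩⟩

theorem dropEdge_true {X : Polarity} {w : Marked} {x y : Lab} :
    DropEdge ((X, true) :: w) x y ↔
      Juxt (Copy [X]) (DropEdge w) (full w).length (kept w).length x y := by
  constructor
  · rintro ⟨i, j, ⟨rfl, rfl⟩ | h, h'⟩
    · left
      rcases h' with ⟨h | h, rfl, rfl⟩ | ⟨h | h, rfl, rfl⟩
      · exact ⟨_, _, ⟨0, .inl ⟨.inl ⟨rfl, h.2⟩, rfl, rfl⟩⟩, by simp, by simp⟩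
      · exact absurd rfl h.lt.ne
      · exact ⟨_, _, ⟨0, .inr ⟨.inl ⟨rfl, h.2⟩, rfl, rfl⟩⟩, by simp, by simp⟩
      · exact absurd rfl h.lt.ne
    · exact .inr ((dropEdge_false (X := X)).1 ⟨i, j, h, h'⟩)
  · rintro (⟨_, _, ⟨i, ⟨⟨rfl, rfl⟩ | h, rfl, rfl⟩ | ⟨⟨rfl, rfl⟩ | h, rfl, rfl⟩⟩, rfl, rfl⟩ | h)
    · exact ⟨_, _, .inl ⟨rfl, rfl⟩, .inl ⟨.inl ⟨rfl, rfl⟩, by simp, by simp⟩⟩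
    · exact h.elim
    · exact ⟨_, _, .inl ⟨rfl, rfl⟩, .inr ⟨.inl ⟨rfl, rfl⟩, by simp, by simp⟩⟩
    · exact h.elim
    · obtain ⟨i, j, h, h'⟩ := (dropEdge_false (X := X)).2 h
      exact ⟨i, j, .inr h, h'⟩

theorem juxt_none {R S : Lab → Lab → Prop} (hR : ∀ x y, ¬ R x y) {c d : ℕ} {x y : Lab} :
    Juxt R S c d x y ↔ S x y := by
  simp [Juxt, hR]

theorem edge_drop : ∀ (w : Marked) (x y : Lab), edge (interp (drop w)) x y ↔ DropEdge w x y
  | [], x, y => by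
    refine (edge_interp_id [] x y).trans (iff_of_false (not_copy_nil x y) ?_)
    rintro ⟨i, j, h, -⟩
    exact h
  | (X, true) :: w, x, y => by
    refine (edge_interp_tensor (.id (S := stratSignature) [X]) (drop w) x y).trans ?_
    exact (juxt_congr (edge_interp_id [X]) (edge_drop w)).trans dropEdge_true.symm
  | (.O, false) :: w, x, y => by
    refine (edge_interp_tensor StratGen.εO (drop w) x y).trans ?_
    rw [juxt_none fun x y => ?_, edge_drop w, dropEdge_false]
    exact (edge_strategy .epsO x y).not.2 (by simp [genEdges])
  | (.P, false) :: w, x, y => by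
    refine (edge_interp_tensor StratGen.εP (drop w) x y).trans ?_
    rw [juxt_none fun x y => ?_, edge_drop w, dropEdge_false]
    exact (edge_strategy .epsP x y).not.2 (by simp [genEdges])

/-- Juxtaposition commutes with the exchange of the source and the target, which reverses the edges. -/
theorem juxt_swap {R S : Lab → Lab → Prop} {c d : ℕ} {x y : Lab} :
    Juxt (fun x y => R y.swap x.swap) (fun x y => S y.swap x.swap) c d x y ↔
      Juxt R S d c y.swap x.swap := by
  constructor
  · rintro (⟨x, y, h, rfl, rfl⟩ | h)
    · exact .inl ⟨_, _, h, by rcases y with y | y <;> rfl, by rcases x with x | x <;> rfl⟩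
    · exact .inr h
  · rintro (⟨x', y', h, e, e'⟩ | h)
    · exact .inl ⟨y'.swap, x'.swap, by simpa using h, by
        rw [← Sum.swap_swap x, ← e']
        rcases y' with y' | y' <;> rfl, by
        rw [← Sum.swap_swap y, ← e]
        rcases x' with x' | x' <;> rfl⟩
    · exact .inr h

theorem copy_swap {A : List Polarity} {x y : Lab} : Copy A y.swap x.swap ↔ Copy A x y := by
  have : ∀ {x y : Lab}, Copy A x y → Copy A y.swap x.swap := by
    rintro _ _ ⟨i, ⟨h, rfl, rfl⟩ | ⟨h, rfl, rfl⟩⟩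
    · exact ⟨i, .inl ⟨h, rfl, rfl⟩⟩
    · exact ⟨i, .inr ⟨h, rfl, rfl⟩⟩
  exact ⟨fun h => by simpa using this h, this⟩

theorem edge_restore : ∀ (w : Marked) (x y : Lab),
    edge (interp (restore w)) x y ↔ DropEdge w y.swap x.swap
  | [], x, y => by
    refine (edge_interp_id [] x y).trans (iff_of_false (not_copy_nil x y) ?_)
    rintro ⟨i, j, h, -⟩
    exact h
  | (X, true) :: w, x, y => by
    refine (edge_interp_tensor (.id (S := stratSignature) [X]) (restore w) x y).trans ?_
    rw [dropEdge_true, ← juxt_swap]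
    exact juxt_congr (fun x y => (edge_interp_id [X] x y).trans copy_swap.symm) (edge_restore w)
  | (.O, false) :: w, x, y => by
    refine (edge_interp_tensor StratGen.ηO (restore w) x y).trans ?_
    rw [juxt_none fun x y => ?_, edge_restore w, dropEdge_false]
    exact (edge_strategy .etaO x y).not.2 (by simp [genEdges])
  | (.P, false) :: w, x, y => by
    refine (edge_interp_tensor StratGen.ηP (restore w) x y).trans ?_
    rw [juxt_none fun x y => ?_, edge_restore w, dropEdge_false]
    exact (edge_strategy .etaP x y).not.2 (by simp [genEdges])

theorem Producer.not_consumer {A B : List Polarity} {x : Lab} (h : Producer A B x)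
    (h' : Consumer A B x) : False := by
  rcases x with x | x
  · cases At.unique (w := A) h h'
  · cases At.unique (w := B) h h'

/-- As the edges of a strategy go from Opponent moves to Proponent moves, they cannot be composed. -/
theorem edge_of_reflTransGen {A B : List Polarity} {σ : WordStrategy A B} {x y : Lab}
    (hx : Producer A B x) (hy : Consumer A B y) (h : Relation.ReflTransGen (edge σ) x y) :
    edge σ x y := by
  cases h with
  | refl => exact (hx.not_consumer hy).elim
  | tail h h' =>
    cases h with
    | refl => exact h'
    | tail _ h => exact ((edge_producer h').not_consumer (edge_consumer h)).elim

/-- If `Ψ` is a simulation of `T` by `R`, paths of `T` are simulated by possibly empty paths of `R`. -/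
theorem exists_reflTransGen {X Y : Type} {T : X → X → Prop} {R : Y → Y → Prop} {Ψ : X → Y → Prop}
    (step : ∀ u v x, T u v → Ψ u x → ∃ y, Ψ v y ∧ (x = y ∨ R x y)) {u v : X} {x : Y}
    (h : Relation.TransGen T u v) (hx : Ψ u x) : ∃ y, Ψ v y ∧ Relation.ReflTransGen R x y := by
  have cons : ∀ {x y z}, Relation.ReflTransGen R x y → (y = z ∨ R y z) →
      Relation.ReflTransGen R x z := by
    rintro x y z h (rfl | h')
    · exact h
    · exact h.tail h'
  induction h with
  | single h =>
    obtain ⟨y, hy, h⟩ := step _ _ _ h hx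
    exact ⟨y, hy, cons .refl h⟩
  | tail _ h ih =>
    obtain ⟨y, hy, h1⟩ := ih
    obtain ⟨z, hz, h2⟩ := step _ _ _ h hy
    exact ⟨z, hz, cons h1 h2⟩

/-- The second move, of the game `A ⊸ B'`, is the first one, of the game `A ⊸ B`, where `B'` is obtained
from `B` by forgetting moves. -/
def KeptTgt (w : Marked) : Lab → Lab → Prop
  | .inl i, .inl i' => i = i'
  | .inr i, .inr j => Kept w i j
  | _, _ => False

/-- The second move, of the game `A' ⊸ B`, is the first one, of the game `A ⊸ B`, where `A'` is obtained
from `A` by forgetting moves. -/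
def KeptSrc (w : Marked) (x x' : Lab) : Prop := KeptTgt w x.swap x'.swap

/-- The composition with `drop w` restricts a strategy to the moves which are kept. -/
theorem edge_comp_drop {A : List Polarity} {w : Marked} (σ : WordStrategy A (full w)) {x y x' y' : Lab}
    (hx : KeptTgt w x x') (hy : KeptTgt w y y') (px : Producer A (full w) x)
    (cy : Consumer A (full w) y) : edge (σ.comp (interp (drop w))) x' y' ↔ edge σ x y := by
  rw [edge_comp]
  constructor
  · intro h
    -- the moves of the target of the composite simulate moves of the middle word
    obtain ⟨z, hz, h⟩ := exists_reflTransGen (R := edge σ) (Ψ := fun (u : Lab₃) z => match u, z with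
      | .inl i, z => z = .inl i
      | .inr (.inl i), z => z = .inr i
      | .inr (.inr j), .inr i => Kept w i j
      | .inr (.inr j), .inl _ => False) (x := x) (by
        rintro _ _ z (⟨u, v, h, rfl, rfl⟩ | ⟨u, v, h, rfl, rfl⟩) hz
        · refine ⟨v, by rcases v with v | v <;> rfl, .inr ?_⟩
          have : z = u := by rcases u with u | u <;> exact hz
          rwa [this]
        · obtain ⟨i, j, hk, ⟨-, rfl, rfl⟩ | ⟨-, rfl, rfl⟩⟩ := (edge_drop w _ _).1 h
          · obtain rfl : z = .inr i := hz
            exact ⟨_, hk, .inl rfl⟩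
          · rcases z with z | z
            · exact False.elim hz
            · exact ⟨.inr i, rfl, .inl (by rw [hk.unique hz])⟩) h (by
        rcases x with x | x <;> rcases x' with x' | x' <;> first | exact hx.elim | exact hx | skip
        exact congrArg _ hx)
    have : z = y := by
      rcases y with y | y <;> rcases y' with y' | y' <;> first | exact hy.elim | skip
      · exact hz.trans (congrArg _ hy.symm)
      · rcases z with z | z
        · exact False.elim hz
        · exact congrArg _ (hz.unique hy)
    subst this
    exact edge_of_reflTransGen px cy h
  · intro h
    have h1 : Relation.ReflTransGen (Join (edge σ) (edge (interp (drop w)))) (inAC x') (inAB x) := by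
      rcases x with x | x <;> rcases x' with x' | x' <;> first | exact hx.elim | skip
      · cases hx
        exact .refl
      · exact .single (.inr ⟨.inr x', .inl x, (edge_drop _ _ _).2 ⟨x, x', hx, .inr ⟨px, rfl, rfl⟩⟩,
          rfl, rfl⟩)
    have h2 : Relation.ReflTransGen (Join (edge σ) (edge (interp (drop w)))) (inAB y) (inAC y') := by
      rcases y with y | y <;> rcases y' with y' | y' <;> first | exact hy.elim | skip
      · cases hy
        exact .refl
      · exact .single (.inr ⟨.inl y, .inr y', (edge_drop _ _ _).2 ⟨y, y', hy, .inl ⟨cy, rfl, rfl⟩⟩,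
          rfl, rfl⟩)
    exact Relation.TransGen.trans_left (.tail' h1 (.inl ⟨x, y, h, rfl, rfl⟩)) h2

/-- The composition with `restore w` restricts a strategy to the moves which are kept. -/
theorem edge_restore_comp {B : List Polarity} {w : Marked} (σ : WordStrategy (full w) B)
    {x y x' y' : Lab} (hx : KeptSrc w x x') (hy : KeptSrc w y y') (px : Producer (full w) B x)
    (cy : Consumer (full w) B y) : edge ((interp (restore w)).comp σ) x' y' ↔ edge σ x y := by
  rw [edge_comp]
  constructor
  · intro h
    obtain ⟨z, hz, h⟩ := exists_reflTransGen (R := edge σ) (Ψ := fun (u : Lab₃) z => match u, z with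
      | .inr (.inr i), z => z = .inr i
      | .inr (.inl i), z => z = .inl i
      | .inl j, .inl i => Kept w i j
      | .inl _, .inr _ => False) (x := x) (by
        rintro _ _ z (⟨u, v, h, rfl, rfl⟩ | ⟨u, v, h, rfl, rfl⟩) hz
        · obtain ⟨i, j, hk, ⟨-, e, e'⟩ | ⟨-, e, e'⟩⟩ := (edge_restore w _ _).1 h
          · rcases u with u | u <;> cases e'
            rcases v with v | v <;> cases e
            rcases z with z | z
            · exact ⟨.inl i, rfl, .inl (by rw [hk.unique hz])⟩
            · exact False.elim hz
          · rcases u with u | u <;> cases e'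
            rcases v with v | v <;> cases e
            obtain rfl : z = .inl i := hz
            exact ⟨_, hk, .inl rfl⟩
        · refine ⟨v, by rcases v with v | v <;> rfl, .inr ?_⟩
          have : z = u := by rcases u with u | u <;> exact hz
          rwa [this]) h (by
        rcases x with x | x <;> rcases x' with x' | x' <;> first | exact hx.elim | exact hx | skip
        exact congrArg _ hx)
    have : z = y := by
      rcases y with y | y <;> rcases y' with y' | y' <;> first | exact hy.elim | skip
      · rcases z with z | z
        · exact congrArg _ (hz.unique hy)
        · exact False.elim hz
      · exact hz.trans (congrArg _ hy.symm)
    subst this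
    exact edge_of_reflTransGen px cy h
  · intro h
    have h1 : Relation.ReflTransGen (Join (edge (interp (restore w))) (edge σ)) (inAC x') (inBC x) := by
      rcases x with x | x <;> rcases x' with x' | x' <;> first | exact hx.elim | skip
      · exact .single (.inl ⟨.inl x', .inr x,
          (edge_restore _ _ _).2 ⟨x, x', hx, .inl ⟨px, rfl, rfl⟩⟩, rfl, rfl⟩)
      · cases hx
        exact .refl
    have h2 : Relation.ReflTransGen (Join (edge (interp (restore w))) (edge σ)) (inBC y) (inAC y') := by
      rcases y with y | y <;> rcases y' with y' | y' <;> first | exact hy.elim | skip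
      · exact .single (.inl ⟨.inr y, .inl y',
          (edge_restore _ _ _).2 ⟨y, y', hy, .inr ⟨cy, rfl, rfl⟩⟩, rfl, rfl⟩)
      · cases hy
        exact .refl
    exact Relation.TransGen.trans_left (.tail' h1 (.inr ⟨x, y, h, rfl, rfl⟩)) h2

/-! ### Fullness -/

open FOC.Syntactic (Mor value id_value value_eq normal_value id_cls_eq coe_cls_eq)

theorem word_eq_value : ∀ w : List Polarity, (word w : WithZero Mor) =
    value (.id (S := stratSignature) w)
  | [] => rfl
  | .O :: w => by
    rw [word_cons_O, word_eq_value w]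
    exact (id_value [.O] w).symm
  | .P :: w => by
    rw [word_cons_P, word_eq_value w]
    exact (id_value [.P] w).symm

/-- The normal form of a strategy is a formal morphism. -/
theorem exists_normal {A B : List Polarity} (σ : WordStrategy A B) :
    ∃ f : stratSignature.Expr A B, Normal (edge σ) A B (value f) := by
  obtain ⟨f, hf⟩ := (acyclic_edge σ).exists_rep (Q := WithZero Mor)
  obtain ⟨h1, h2⟩ := hf.src_tgt
  have e : tgt f = StrictMonoidal.src (eps ^ (consumers A B).length * word B) := by simp [h2]
  have hs := (src_comp _ _ e).trans h1
  have ht := (tgt_comp _ _ e).trans (by simp : _ = (word B : WithZero Mor))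
  have hn : Normal (edge σ) A B _ := ⟨f, hf, rfl⟩
  revert hs ht hn
  generalize (f ⨟ eps ^ (consumers A B).length * word B) = g
  rw [word_eq_value, word_eq_value]
  induction g using Syntactic.ind with
  | h0 => exact fun hs => (WithZero.coe_ne_zero hs.symm).elim
  | h A' B' g =>
    intro hs ht hn
    obtain rfl : A' = A := id_cls_eq hs
    obtain rfl : B' = B := id_cls_eq ht
    exact ⟨g, (congrArg (Normal (edge σ) A' B') (value_eq g)).mpr hn⟩

/-- When `A ⊸ B` has one Opponent move and one Proponent move, normal forms determine strategies: there
are at most two strategies, with and without an edge, each of them is denoted by a formal morphism,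
and by soundness these formal morphisms are not congruent. -/
theorem edge_of_normal_two {A B : List Polarity} {σ τ : WordStrategy A B} {g : WithZero Mor}
    (hσ : Normal (edge σ) A B g) (hτ : Normal (edge τ) A B g) {x y : Lab}
    (hx : ∀ u, Producer A B u → u = x) (hy : ∀ u, Consumer A B u → u = y)
    (e₁ e₂ : stratSignature.Expr A B) (h₁ : ∀ u v, edge (interp e₁) u v ↔ (u, v) ∈ [(x, y)])
    (h₂ : ∀ u v, ¬ edge (interp e₂) u v) (h : edge σ x y) : edge τ x y := by
  by_contra h'
  have s : σ = interp e₁ := eq_of_edge fun u v => by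
    rw [h₁, List.mem_singleton, Prod.mk.injEq]
    constructor
    · intro h
      exact ⟨hx _ (edge_producer h), hy _ (edge_consumer h)⟩
    · rintro ⟨rfl, rfl⟩
      exact h
  have t : τ = interp e₂ := eq_of_edge fun u v => by
    refine iff_of_false (fun h => h' ?_) (h₂ u v)
    rwa [hx _ (edge_producer h), hy _ (edge_consumer h)] at h
  subst s t
  have c := (normal_value e₁).unique (acyclic_edge _) hσ
  rw [← (normal_value e₂).unique (acyclic_edge _) hτ, value_eq, value_eq] at c
  exact h₂ x y ((edge_of_cong (coe_cls_eq.1 c) x y).1 ((h₁ x y).2 List.mem_cons_self))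

open StratGen in
/-- Normal forms determine strategies: two moves are related when this is the case after all the
other moves have been forgotten. -/
theorem edge_of_normal {A B : List Polarity} {σ τ : WordStrategy A B} {g : WithZero Mor}
    (hσ : Normal (edge σ) A B g) (hτ : Normal (edge τ) A B g) {x y : Lab} (h : edge σ x y) :
    edge τ x y := by
  have reduce : ∀ (v w : Marked), full v = A → full w = B → ∀ {A' B' : List Polarity},
      kept v = A' → kept w = B' → ∀ x' y' : Lab,
      (∃ z, KeptTgt w x z ∧ KeptSrc v z x') → (∃ z, KeptTgt w y z ∧ KeptSrc v z y') →
      (∀ u, Producer A' B' u → u = x') → (∀ u, Consumer A' B' u → u = y') →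
      ∀ e₁ e₂ : stratSignature.Expr A' B',
      (∀ u v, edge (interp e₁) u v ↔ (u, v) ∈ [(x', y')]) → (∀ u v, ¬ edge (interp e₂) u v) →
      edge τ x y := by
    rintro v w rfl rfl _ _ rfl rfl x' y' ⟨x₁, hx, hx'⟩ ⟨y₁, hy, hy'⟩ ux uy e₁ e₂ h₁ h₂
    have k1 := (edge_comp_drop σ hx hy (edge_producer h) (edge_consumer h)).2 h
    have k2 := (edge_restore_comp (σ.comp (interp (drop w))) hx' hy' (edge_producer k1)
      (edge_consumer k1)).2 k1
    have k3 := edge_of_normal_two ((normal_value (restore v)).comp (hσ.comp (normal_value (drop w))))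
      ((normal_value (restore v)).comp (hτ.comp (normal_value (drop w)))) ux uy e₁ e₂ h₁ h₂ k2
    rw [edge_restore_comp (τ.comp (interp (drop w))) hx' hy' (edge_producer k1) (edge_consumer k1),
      edge_comp_drop τ hx hy (edge_producer h) (edge_consumer h)] at k3
    exact k3
  have none : ∀ {A' B' : List Polarity} (e : stratSignature.Expr A' B'), edgesOk e = true →
      edges e = [] → ∀ u v, ¬ edge (interp e) u v := by
    intro A' B' e he he' u v
    rw [mem_edges e he, he']
    exact List.not_mem_nil
  have px := edge_producer h
  have cy := edge_consumer h
  obtain ⟨K, K1, K2, K3, K4, K5⟩ := acyclic_edge σ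
  have hK := K3 _ _ px h
  -- the edge which remains is that of the counit of the duality, of an identity, or of the unit of the
  -- duality, according to the sides of the two moves
  rcases x with x | x <;> rcases y with y | y
  · have lt : y < x := by
      rcases lt_trichotomy x y with lt | rfl | lt
      · exact (K1 _ (K2 _ _ _ hK (K4 _ _ lt (At.lt (w := A) (X := .O) cy)))).elim
      · exact (K1 _ hK).elim
      · exact lt
    obtain ⟨v, hv, kv, k1, k2⟩ := exists_kept_two lt px cy
    obtain ⟨w, hw, kw⟩ := exists_kept_none B
    refine reduce v w hv hw kv kw (.inl 1) (.inl 0) ⟨.inl x, rfl, k1⟩ ⟨.inl y, rfl, k2⟩ ?_ ?_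
      εOP (.tensor εP εO) (mem_edges εOP rfl) (none _ rfl rfl)
    · rintro (u | u) h <;> simpa [Producer, At] using h
    · rintro (u | u) h <;> simpa [Consumer, At] using h
  · obtain ⟨v, hv, kv, k1⟩ := exists_kept_one (A := A) px
    obtain ⟨w, hw, kw, k2⟩ := exists_kept_one (A := B) cy
    refine reduce v w hv hw kv kw (.inl 0) (.inr 0) ⟨.inl x, rfl, k1⟩ ⟨.inr 0, k2, rfl⟩ ?_ ?_
      (i P) (.comp εP ηP) (mem_edges (i P) rfl) (none _ rfl rfl)
    · rintro (u | u) h <;> simpa [Producer, At] using h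
    · rintro (u | u) h <;> simpa [Consumer, At] using h
  · obtain ⟨v, hv, kv, k1⟩ := exists_kept_one (A := A) cy
    obtain ⟨w, hw, kw, k2⟩ := exists_kept_one (A := B) px
    refine reduce v w hv hw kv kw (.inr 0) (.inl 0) ⟨.inr 0, k2, rfl⟩ ⟨.inl y, rfl, k1⟩ ?_ ?_
      (i O) (.comp εO ηO) (mem_edges (i O) rfl) (none _ rfl rfl)
    · rintro (u | u) h <;> simpa [Producer, At] using h
    · rintro (u | u) h <;> simpa [Consumer, At] using h
  · have lt : y < x := by
      rcases lt_trichotomy x y with lt | rfl | lt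
      · exact (K1 _ (K2 _ _ _ hK (K5 _ _ lt (At.lt (w := B) (X := .P) cy)))).elim
      · exact (K1 _ hK).elim
      · exact lt
    obtain ⟨v, hv, kv⟩ := exists_kept_none A
    obtain ⟨w, hw, kw, k1, k2⟩ := exists_kept_two lt px cy
    refine reduce v w hv hw kv kw (.inr 1) (.inr 0) ⟨.inr 1, k1, rfl⟩ ⟨.inr 0, k2, rfl⟩ ?_ ?_
      ηOP (.tensor ηO ηP) (mem_edges ηOP rfl) (none _ rfl rfl)
    · rintro (u | u) h <;> simpa [Producer, At] using h
    · rintro (u | u) h <;> simpa [Consumer, At] using h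

/-- Every strategy between words is the interpretation of a formal morphism. -/
theorem exists_interp_eq {A B : List Polarity} (σ : WordStrategy A B) :
    ∃ f : stratSignature.Expr A B, interp f = σ := by
  obtain ⟨f, hf⟩ := exists_normal σ
  exact ⟨f, eq_of_edge fun x y =>
    ⟨edge_of_normal (normal_value f) hf, edge_of_normal hf (normal_value f)⟩⟩

end FOC

namespace FOC

/-! ### The functor from formal morphisms to strategies -/

/-- The interpretation of formal morphisms, as a functor; soundness makes it well defined on classes. -/
def interpFunctor : stratTheory.Generated ⥤ FiliformGame where
  obj w := wordGame w.word
  map {A B} := _root_.Quotient.lift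
    (fun f : stratTheory.Expr A.word B.word => (interp f : wordGame A.word ⟶ wordGame B.word))
    fun _ _ h => eq_of_edge (edge_of_cong h)
  map_id _ := rfl
  map_comp := by
    rintro _ _ _ ⟨f⟩ ⟨g⟩
    rfl

instance : interpFunctor.Faithful where
  map_injective := by
    rintro A B ⟨f⟩ ⟨g⟩ h
    exact _root_.Quotient.sound (s := stratTheory.homSetoid A.word B.word) (cong_of_interp_eq f g h)

instance : interpFunctor.Full where
  map_surjective {A B} σ :=
    have ⟨f, h⟩ := exists_interp_eq (A := A.word) (B := B.word) σ
    ⟨MonoidalTheory.homMk (T := stratTheory) f, h⟩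

theorem exists_position {w : List Polarity} {i : ℕ} (h : i < w.length) :
    ∃ m, position w m = i := by
  obtain ⟨m, hm⟩ := exists_idx (w := w) (i := w.length - 1 - i) (by omega)
  exact ⟨m, by have := position_add_idx w m; omega⟩

/-- A filiform game is isomorphic to the game of the word of the polarities of its moves. -/
theorem exists_wordGame_iso (A : FiliformGame) : ∃ w, Nonempty (GameIso (wordGame w) A) := by
  have := A.finite
  let _ : LinearOrder A.Moves :=
    { le := A.le, le_refl := A.le_refl, le_trans := A.le_trans, le_antisymm := A.le_antisymm,
      le_total := A.le_total, toDecidableLE := Classical.decRel _ }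
  let _ := Fintype.ofFinite A.Moves
  let e := Fintype.orderIsoFinOfCardEq A.Moves rfl
  let w := List.ofFn fun i => A.pol (e i)
  have hw : w.length = Fintype.card A.Moves := List.length_ofFn
  let p : (wordGame w).Moves → Fin (Fintype.card A.Moves) :=
    fun m => ⟨position w m, hw ▸ StratGen.position_lt w m⟩
  have hp : Function.Bijective p := by
    refine ⟨fun m n h => StratGen.position_injective w m n (Fin.mk.inj_iff.1 h), fun i => ?_⟩
    obtain ⟨m, hm⟩ := exists_position (w := w) (i := i) (hw.symm ▸ i.2)
    exact ⟨m, Fin.ext hm⟩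
  refine ⟨w, ⟨(Equiv.ofBijective p hp).trans e.toEquiv, fun m => ?_, fun m n => ?_⟩⟩
  · have h := StratGen.getElem_position w m
    rw [List.getElem?_eq_getElem (StratGen.position_lt w m), Option.some.injEq, List.getElem_ofFn] at h
    exact h
  · refine (e.le_iff_le (x := p m) (y := p n)).trans ⟨fun h => ?_, StratGen.position_le w m n⟩
    rcases (wordGame w).le_total m n with h' | h'
    · exact h'
    · rw [StratGen.position_injective w m n (le_antisymm h (StratGen.position_le w n m h'))]
      exact (wordGame w).le_refl n

instance : interpFunctor.EssSurj where
  mem_essImage A :=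
    have ⟨w, ⟨e⟩⟩ := exists_wordGame_iso A
    ⟨⟨w⟩, ⟨e.toIso⟩⟩

instance : interpFunctor.IsEquivalence where

/-! ### Coherence -/

/-- The morphisms of games which are copycat strategies. -/
def IsCopycat {A B : FiliformGame} (f : A ⟶ B) : Prop := ∃ e : GameIso A B, f = Strategy.copycat e

/-- Since games are rigid, diagrams of copycat strategies commute. -/
theorem IsCopycat.eq {A B : FiliformGame} {f g : A ⟶ B} (hf : IsCopycat f) (hg : IsCopycat g) :
    f = g := by
  obtain ⟨e, rfl⟩ := hf
  obtain ⟨e', rfl⟩ := hg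
  exact copycat_eq e e'

theorem isCopycat_id (A : FiliformGame) : IsCopycat (𝟙 A) := ⟨.refl A, rfl⟩

theorem GameIso.isCopycat_hom {A B : FiliformGame} (e : GameIso A B) : IsCopycat e.toIso.hom :=
  ⟨e, rfl⟩

theorem GameIso.isCopycat_inv {A B : FiliformGame} (e : GameIso A B) : IsCopycat e.toIso.inv :=
  ⟨e.symm, rfl⟩

theorem IsCopycat.comp {A B C : FiliformGame} {f : A ⟶ B} {g : B ⟶ C} (hf : IsCopycat f)
    (hg : IsCopycat g) : IsCopycat (f ≫ g) := by
  obtain ⟨e, rfl⟩ := hf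
  obtain ⟨e', rfl⟩ := hg
  exact ⟨e.trans e', copycat_comp_copycat e e'⟩

theorem IsCopycat.tensor {A B C D : FiliformGame} {f : A ⟶ B} {g : C ⟶ D} (hf : IsCopycat f)
    (hg : IsCopycat g) : IsCopycat (f ⊗ₘ g) := by
  obtain ⟨e, rfl⟩ := hf
  obtain ⟨e', rfl⟩ := hg
  exact ⟨e.before e', copycat_tensor e e'⟩

theorem IsCopycat.whiskerRight {A B : FiliformGame} {f : A ⟶ B} (hf : IsCopycat f)
    (C : FiliformGame) : IsCopycat (f ▷ C) :=
  hf.tensor (isCopycat_id C)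

theorem IsCopycat.whiskerLeft {A B : FiliformGame} {f : A ⟶ B} (hf : IsCopycat f)
    (C : FiliformGame) : IsCopycat (C ◁ f) :=
  (isCopycat_id C).tensor hf

theorem isCopycat_map_eqToHom {A B : stratTheory.Generated} (h : A = B) :
    IsCopycat (interpFunctor.map (eqToHom h)) := by
  cases h
  exact isCopycat_id _

theorem interpFunctor_map_tensor {A B C D : stratTheory.Generated} (f : A ⟶ B) (g : C ⟶ D) :
    (interpFunctor.map f ⊗ₘ interpFunctor.map g) ≫ (appendIso B.word D.word).toIso.hom =
      (appendIso A.word C.word).toIso.hom ≫ interpFunctor.map (f ⊗ₘ g) := by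
  obtain ⟨f⟩ := f
  obtain ⟨g⟩ := g
  exact (Iso.inv_comp_eq (appendIso A.word C.word).toIso).1 rfl

/-- The functor from formal morphisms to strategies is monoidal, with the isomorphisms `appendIso` as
structure. All the morphisms in the coherence diagrams are copycat strategies. -/
def interpCoreMonoidal : interpFunctor.CoreMonoidal where
  εIso := Iso.refl FiliformGame.empty
  μIso A B := (appendIso A.word B.word).toIso
  μIso_hom_natural_left f A := interpFunctor_map_tensor f (𝟙 A)
  μIso_hom_natural_right A f := interpFunctor_map_tensor (𝟙 A) f
  associativity A B C := by
    refine IsCopycat.eq ?_ ?_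
    · exact ((GameIso.isCopycat_hom _).whiskerRight _).comp
        ((GameIso.isCopycat_hom _).comp (isCopycat_map_eqToHom (MonoidalTheory.assoc_eq A B C)))
    · exact (GameIso.isCopycat_hom (GameIso.assoc _ _ _)).comp
        (((GameIso.isCopycat_hom _).whiskerLeft _).comp (GameIso.isCopycat_hom _))
  left_unitality A := by
    refine IsCopycat.eq (GameIso.isCopycat_hom (GameIso.leftUnit _)) ?_
    exact ((isCopycat_id FiliformGame.empty).whiskerRight _).comp
      ((GameIso.isCopycat_hom (appendIso [] A.word)).comp (isCopycat_map_eqToHom rfl))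
  right_unitality A := by
    refine IsCopycat.eq (GameIso.isCopycat_hom (GameIso.rightUnit _)) ?_
    exact ((isCopycat_id FiliformGame.empty).whiskerLeft _).comp
      ((GameIso.isCopycat_hom (appendIso A.word [])).comp
        (isCopycat_map_eqToHom (MonoidalTheory.unit_eq A)))

noncomputable instance : interpFunctor.Monoidal := interpCoreMonoidal.toMonoidal

/-- The canonical isomorphisms between the images of words and word games are copycat strategies, hence
identities by rigidity. -/
theorem isCopycat_wordIso : ∀ w : List Polarity, IsCopycat (wordIso interpFunctor
    (fun X => (GameIso.rightUnit (FiliformGame.single X)).toIso) w).hom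
  | [] => isCopycat_id (𝟙_ FiliformGame)
  | X :: w => by
    have e : (wordIso interpFunctor
        (fun X => (GameIso.rightUnit (FiliformGame.single X)).toIso) (X :: w)).hom =
      Functor.OplaxMonoidal.δ interpFunctor ⟨[X]⟩ ⟨w⟩ ≫
        ((GameIso.rightUnit (FiliformGame.single X)).toIso.hom ⊗ₘ (wordIso interpFunctor
          (fun X => (GameIso.rightUnit (FiliformGame.single X)).toIso) w).hom) := rfl
    rw [e]
    exact IsCopycat.comp (GameIso.isCopycat_inv (appendIso [X] w))
      ((GameIso.isCopycat_hom _).tensor (isCopycat_wordIso w))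

/-- The interpretation of formal morphisms, as an equivalence of categories. -/
noncomputable def interpEquivalence : stratTheory.Generated ≌ FiliformGame :=
  interpFunctor.asEquivalence

/-- The functor sends the generators to the strategies which interpret them. -/
theorem map_gen (g : StratGen) :
    interpFunctor.map (MonoidalTheory.homMk (T := stratTheory) (.gen (S := stratSignature) g)) ≫
        (wordIso interpFunctor
          (fun X => (GameIso.rightUnit (FiliformGame.single X)).toIso) g.tgt).hom =
      (wordIso interpFunctor
          (fun X => (GameIso.rightUnit (FiliformGame.single X)).toIso) g.src).hom ≫ g.strategy := by
  have h := fun w => (isCopycat_wordIso w).eq (isCopycat_id (wordGame w))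
  refine (congrArg (_ ≫ ·) (h g.tgt)).trans (Eq.trans ?_ (congrArg (· ≫ _) (h g.src).symm))
  exact (Category.comp_id (X := wordGame g.src) (Y := wordGame g.tgt) g.strategy).trans
    (Category.id_comp (X := wordGame g.src) (Y := wordGame g.tgt) g.strategy).symm

end FOC
open FOC
theorem mainTheorem1 :
    ∃ (e : stratTheory.Generated ≌ FiliformGame) (_ : e.functor.Monoidal)
      (_ : e.inverse.Monoidal) (_ : e.IsMonoidal)
      (ι : ∀ X : Polarity, e.functor.obj ⟨[X]⟩ ≅ FiliformGame.single X),
      ∀ g : StratGen,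
        e.functor.map (MonoidalTheory.homMk (T := stratTheory) (.gen (S := stratSignature) g)) ≫
            (wordIso e.functor ι g.tgt).hom =
          (wordIso e.functor ι g.src).hom ≫ g.strategy := by
  let _ : interpEquivalence.functor.Monoidal := interpCoreMonoidal.toMonoidal
  let _ := interpEquivalence.inverseMonoidal
  exact ⟨interpEquivalence, interpCoreMonoidal.toMonoidal, interpEquivalence.inverseMonoidal,
    { leftAdjoint_ε := rfl, leftAdjoint_μ := fun _ _ => rfl },
    fun X => (GameIso.rightUnit (.single X)).toIso, map_gen⟩
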